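/- **Setting.** Let $\mathbb K$ be an algebraically closed field of characteristic $0$, and let $G=\varinjlim G_n$ be a diagonal ind-group exhausted by simply connected classical groups $G_n$ of one fixed type $A$, $B$, $C$ or $D$, with Lie algebras $\mathfrak g_n$ (simple, of rank $r_n$; $r_n\ge 1$, and $r_n\ge 3$ in type $D$) and injections $\delta_n:\mathfrak g_n\to\mathfrak g_{n+1}$. "Diagonal" means that the natural representation $V_{n+1}$ of $\mathfrak g_{n+1}$ is, as a $\mathfrak g_n$-module, a direct sum $L_{n,1}\oplus\dots\oplus L_{n,s_n}\oplus N_n$, where each $L_{n,i}$ is isomorphic to the natural representation of $\mathfrak g_n$ or to its dual and $N_n$ is trivial. Fix Cartan subalgebras $\mathfrak h_n\subset\mathfrak g_n$ with $\mathfrak h_n=\mathfrak h_{n+1}\cap\mathfrak g_n$. As usual, the decomposition is taken to be the one determined by the $\mathfrak h_{n+1}$-weights of $V_{n+1}$: the sum $\mathfrak h_nL_{n,i}$ of the nonzero $\mathfrak h_n$-weight spaces of $L_{n,i}$ (which is all of $L_{n,i}$ in types $A,C,D$) is $\mathfrak h_{n+1}$-stable, and in types $B,C,D$ the $L_{n,i}$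 are mutually orthogonal for the invariant form on $V_{n+1}$. Let $B=\varinjlim B_n$ be given by Borel subalgebras $\mathfrak b_n\supset\mathfrak h_n$ of $\mathfrak g_n$ with $\mathfrak b_n=\mathfrak b_{n+1}\cap\mathfrak g_n$, and let $\rho_n$ be the half-sum of the roots of $\mathfrak b_n$. **Weights.** $\mathcal P$ is the set of weights of $G$, i.e. of sequences $\lambda=(\lambda_n)$ of integral weights $\lambda_n\in\mathfrak h_n^*$ of $\mathfrak g_n$ such that $\lambda_{n+1}$ restricts to $\lambda_n$ for every $n$; $\mathcal P_B^+\subset\mathcal P$ consists of those $\lambda$ for which every $\lambda_n$ is $\mathfrak b_n$-dominant. **The group $W_B$.** Let $W_n$ be the Weyl group of $(\mathfrak g_n,\mathfrak h_n)$. For $1\le i\le s_n$ let $\kappa_n^i:\mathfrak g_n\to\mathfrak g_{n+1}$ be the map sending $x$ to the endomorphism that equals $\delta_n(x)$ on $L_{n,i}$ and $0$ on $N_n$ and on all $L_{n,j}$, $j\ne i$. In types $A,C,D$ it maps each root space $\mathfrak g_n^\alpha$ into a root space $\mathfrak g_{n+1}^{\beta}$ and so yields an injective homomorphism $\tau_n^i:W_n\to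 W_{n+1}$, $\sigma_\alpha\mapsto\sigma_\beta$. (Call $G$ root reductive if for all large $n$ every root space of $\mathfrak g_n$ is mapped by $\delta_n$ into a single root space of $\mathfrak g_{n+1}$. If $G$ is of type $B$ and not root reductive, $W_n$ is replaced as the domain of $\tau_n^i$ by its subgroup generated by the reflections along the long simple roots of $\mathfrak b_n$, where a root is long if it is of the form $\pm\varepsilon_j\pm\varepsilon_k$, $j\neq k$, i.e. is not a weight of the natural representation; here the root spaces of long roots are mapped into root spaces. If $G$ is of type $B$ and root reductive, all root spaces are mapped into root spaces for large $n$, and only such $n$ are used.) Let $\mathcal T$ be the set of sequences $(t_n)$ with $1\le t_n\le s_n$, two sequences being identified if they agree for all large $n$. For $t\in\mathcal T$ let $W^t=\varinjlim W_n$ along the maps $\tau_n^{t_n}$, and let $W$ be the restricted direct product of the groups $W^t$, $t\in\mathcal T$. Let $\ell_n$ be the length function on $W_n$ determined by $\mathfrak b_n$. For an element $w^t\in W^t$, represented by $w^t_n\in W_n$ for all large $n$, put $\ell_B(w^t)=\lim_n\ell_n(w^t_n)\in\mathbb N\cup\{\infty\}$; for $w=(w^t)\in W$ put $\ell_B(w)=\sum_t\ell_B(w^t)$.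 Then $W_B=\{w\in W:\ell_B(w)<\infty\}$. For $w\in W_B$ with support $\{t^1,\dots,t^l\}$ and $n$ large, let $w(n)=w^{t^1}_n\cdots w^{t^l}_n\in W_n$; for $n$ large it does not depend on the order of the factors or on the representatives. On $\mathfrak h_n^*$ put $w(n)\cdot\mu=w(n)(\mu+\rho_n)-\rho_n$. **Proposition.** (i) If $w\in W_B$, then $w\cdot 0$ is a well-defined element of $\mathcal P$: there is a unique $\mu\in\mathcal P$ with $\mu_n=w(n)\cdot 0=w(n)(\rho_n)-\rho_n$ for all sufficiently large $n$. (ii) If $w\in W_B$ and $\lambda\in\mathcal P_B^+$, then $w(\lambda)$ is a well-defined element of $\mathcal P$: there is a unique $\mu\in\mathcal P$ with $\mu_n=w(n)(\lambda_n)$ for all sufficiently large $n$. (iii) If $w\in W_B$ and $\lambda\in\mathcal P_B^+$, then $w\cdot\lambda$ is a well-defined element of $\mathcal P$: there is a unique $\mu\in\mathcal P$ with $\mu_n=w(n)\cdot\lambda_n$ for all sufficiently large $n$. -/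

import Mathlib

open Filter

attribute [local instance 100] LieRing.ofAssociativeRing

noncomputable section

/-! ### Roots, coroots, Weyl group and Borel subalgebras of a Lie algebra with a Cartan subalgebra -/

namespace CartanPair

variable {K L : Type*} [Field K] [LieRing L] [LieAlgebra K L] [FiniteDimensional K L]
variable (H : LieSubalgebra K L) [H.IsCartanSubalgebra]

/-- `α ∈ 𝔥^*` is a root: it is nonzero and its root space is nonzero. -/
def IsRoot (α : Module.Dual K H) : Prop :=
  α ≠ 0 ∧ LieAlgebra.rootSpace H α ≠ ⊥

/-- `c ∈ 𝔥` is the coroot of `α`: the element `c` of `[𝔤_α, 𝔤_{-α}]` with `α(c) = 2`. -/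
def IsCoroot (α : Module.Dual K H) (c : H) : Prop :=
  c ∈ LieAlgebra.corootSpace (H := H) α ∧ α c = 2

/-- `s` is the reflection `μ ↦ μ - μ(α^∨) α` of `𝔥^*` along the root `α`. -/
def IsReflectionAlong (α : Module.Dual K H) (s : Module.Dual K H ≃ₗ[K] Module.Dual K H) : Prop :=
  IsRoot H α ∧ ∃ c : H, IsCoroot H α c ∧ ∀ μ : Module.Dual K H, s μ = μ - μ c • α

/-- The group generated by the reflections along the roots in a given set of roots. -/
def reflectionGroup (S : Set (Module.Dual K H)) :
    Subgroup (Module.Dual K H ≃ₗ[K] Module.Dual K H) :=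
  Subgroup.closure {s | ∃ α ∈ S, IsReflectionAlong H α s}

/-- The Weyl group, acting on `𝔥^*`. -/
def weylGroup : Subgroup (Module.Dual K H ≃ₗ[K] Module.Dual K H) :=
  reflectionGroup H {α | IsRoot H α}

/-- `μ ∈ 𝔥^*` is an integral weight: it takes integral values on all coroots. -/
def IsIntegral (μ : Module.Dual K H) : Prop :=
  ∀ α c, IsRoot H α → IsCoroot H α c → ∃ k : ℤ, μ c = k

/-- A Borel subalgebra: a maximal solvable subalgebra. -/
def IsBorel (b : LieSubalgebra K L) : Prop :=
  Maximal (fun a : LieSubalgebra K L => LieAlgebra.IsSolvable a) b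

variable (b : LieSubalgebra K L)

/-- The roots of `𝔟` (for a Borel subalgebra `𝔟 ⊇ 𝔥`: the positive roots). -/
def posRoots : Set (Module.Dual K H) :=
  {α | IsRoot H α ∧ ∀ x ∈ LieAlgebra.rootSpace H α, x ∈ b}

/-- The simple roots of `𝔟`: the positive roots which are not sums of two positive roots. -/
def simpleRoots : Set (Module.Dual K H) :=
  {α | α ∈ posRoots H b ∧ ∀ β ∈ posRoots H b, ∀ γ ∈ posRoots H b, α ≠ β + γ}

/-- The half-sum of the roots of `𝔟`. -/
def rho : Module.Dual K H :=
  (2 : K)⁻¹ • ∑ᶠ α ∈ posRoots H b, α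

/-- The length function determined by `𝔟`: the least number of factors in an expression
of `w` as a product of reflections along simple roots of `𝔟`. -/
def length (w : Module.Dual K H ≃ₗ[K] Module.Dual K H) : ℕ :=
  sInf {k | ∃ l : List (Module.Dual K H ≃ₗ[K] Module.Dual K H), l.length = k ∧
    (∀ s ∈ l, ∃ α ∈ simpleRoots H b, IsReflectionAlong H α s) ∧ l.prod = w}

/-- `μ` is a `𝔟`-dominant (integral) weight. -/
def IsDominant (μ : Module.Dual K H) : Prop :=
  IsIntegral H μ ∧ ∀ α ∈ posRoots H b, ∀ c, IsCoroot H α c → ∃ k : ℕ, μ c = k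

/-- The dot action `w · μ = w (μ + ρ) - ρ`. -/
def dot (w : Module.Dual K H ≃ₗ[K] Module.Dual K H) (μ : Module.Dual K H) : Module.Dual K H :=
  w (μ + rho H b) - rho H b

end CartanPair

/-! ### The classical simple Lie algebras -/

/-- The four classical types. -/
inductive ClassicalType
  | A | B | C | D

namespace ClassicalType

/-- The least rank for which the classical Lie algebra of the given type is simple. -/
def minRank : ClassicalType → ℕ
  | A => 1
  | B => 1
  | C => 1
  | D => 3

/-- The index set of the standard basis of the natural representation in rank `r`. -/
abbrev Idx : ClassicalType → ℕ → Type
  | A, r => Fin (r + 1)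
  | B, r => Unit ⊕ (Fin r ⊕ Fin r)
  | C, r => Fin r ⊕ Fin r
  | D, r => Fin r ⊕ Fin r

instance instFintypeIdx : (X : ClassicalType) → (r : ℕ) → Fintype (X.Idx r)
  | A, r => inferInstanceAs (Fintype (Fin (r + 1)))
  | B, r => inferInstanceAs (Fintype (Unit ⊕ (Fin r ⊕ Fin r)))
  | C, r => inferInstanceAs (Fintype (Fin r ⊕ Fin r))
  | D, r => inferInstanceAs (Fintype (Fin r ⊕ Fin r))

instance instDecidableEqIdx : (X : ClassicalType) → (r : ℕ) → DecidableEq (X.Idx r)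
  | A, r => inferInstanceAs (DecidableEq (Fin (r + 1)))
  | B, r => inferInstanceAs (DecidableEq (Unit ⊕ (Fin r ⊕ Fin r)))
  | C, r => inferInstanceAs (DecidableEq (Fin r ⊕ Fin r))
  | D, r => inferInstanceAs (DecidableEq (Fin r ⊕ Fin r))

variable (K : Type*) [Field K]

/-- The matrix of the invariant bilinear form on the natural representation (for type `A` there
is no such form and we put `0`). -/
def form : (X : ClassicalType) → (r : ℕ) → Matrix (X.Idx r) (X.Idx r) K
  | A, _ => 0
  | B, r => LieAlgebra.Orthogonal.JB (Fin r) K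
  | C, r => Matrix.J (Fin r) K
  | D, r => LieAlgebra.Orthogonal.JD (Fin r) K

/-- The classical Lie algebra of type `X` and rank `r`:
`sl(r+1)`, `so(2r+1)`, `sp(2r)`, `so(2r)` for `X = A, B, C, D`. -/
def lieAlg (X : ClassicalType) (r : ℕ) : LieSubalgebra K (Matrix (X.Idx r) (X.Idx r) K) :=
  match X with
  | A => LieAlgebra.SpecialLinear.sl (Fin (r + 1)) K
  | B => LieAlgebra.Orthogonal.typeB (Fin r) K
  | C => LieAlgebra.Symplectic.sp (Fin r) K
  | D => LieAlgebra.Orthogonal.typeD (Fin r) K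

/-- The underlying space of the natural representation; `x` acts by `v ↦ x *ᵥ v`. -/
abbrev NatRep (X : ClassicalType) (r : ℕ) : Type _ := X.Idx r → K

end ClassicalType

/-! ### Diagonal ind-groups with a fixed Cartan subgroup -/

open scoped Matrix

/-- A diagonal ind-group `G = lim G_n` with a fixed Cartan subgroup `H = lim H_n`. As the groups
`G_n` are simply connected, they and the embeddings `G_n → G_{n+1}` are recorded through their Lie
algebras `𝔤_n` (classical simple of one fixed type) and the injections `δ_n : 𝔤_n → 𝔤_{n+1}`.
The embeddings are diagonal: the natural representation `V_{n+1}` of `𝔤_{n+1}` is, as a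
`𝔤_n`-module, the direct sum of `s_n` submodules `L_{n,i}`, each isomorphic to the natural
representation of `𝔤_n` or to its dual, and a trivial module `N_n`. -/
structure DiagonalIndGroup (K : Type*) [Field K] where
  /-- The type of `G`. -/
  type : ClassicalType
  /-- The rank of `𝔤_n`. -/
  rank : ℕ → ℕ
  minRank_le : ∀ n, type.minRank ≤ rank n
  /-- The injection `δ_n : 𝔤_n → 𝔤_{n+1}`. -/
  δ : ∀ n, type.lieAlg K (rank n) →ₗ⁅K⁆ type.lieAlg K (rank (n + 1))
  δ_injective : ∀ n, Function.Injective (δ n)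
  /-- The Cartan subalgebra `𝔥_n` of `𝔤_n`. -/
  cartan : ∀ n, LieSubalgebra K (type.lieAlg K (rank n))
  isCartan : ∀ n, (cartan n).IsCartanSubalgebra
  /-- `𝔥_n = 𝔥_{n+1} ∩ 𝔤_n`. -/
  cartan_compat : ∀ n x, δ n x ∈ cartan (n + 1) ↔ x ∈ cartan n
  /-- The number `s_n` of nontrivial simple constituents of `V_{n+1}` over `𝔤_n`. -/
  s : ℕ → ℕ
  /-- The nontrivial simple constituents. -/
  constituent : ∀ n, Fin (s n) → Submodule K (type.NatRep K (rank (n + 1)))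
  /-- The trivial part. -/
  trivialPart : ∀ n, Submodule K (type.NatRep K (rank (n + 1)))
  isInternal : ∀ n, DirectSum.IsInternal
    (fun o : Option (Fin (s n)) => o.elim (trivialPart n) (constituent n))
  trivialPart_trivial : ∀ n x, ∀ v ∈ trivialPart n, (δ n x).1 *ᵥ v = 0
  /-- Each constituent is a copy of the natural representation of `𝔤_n` or of its dual. -/
  constituent_iso : ∀ n i, ∃ φ : type.NatRep K (rank n) →ₗ[K] type.NatRep K (rank (n + 1)),
    Function.Injective φ ∧ LinearMap.range φ = constituent n i ∧
    ((∀ x v, (δ n x).1 *ᵥ φ v = φ (x.1 *ᵥ v)) ∨ (∀ x v, (δ n x).1 *ᵥ φ v = φ (-(x.1ᵀ *ᵥ v))))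
  /-- In types `B`, `C`, `D` distinct constituents are orthogonal (void in type `A`). -/
  constituent_orthogonal : ∀ n i j, i ≠ j → ∀ v ∈ constituent n i, ∀ u ∈ constituent n j,
    v ⬝ᵥ (type.form K (rank (n + 1)) *ᵥ u) = 0
  /-- The decomposition is the one determined by the weight decomposition of `V_{n+1}` under
  `𝔥_{n+1}`: the sum `𝔥_n L_{n,i}` of the nonzero `𝔥_n`-weight spaces of `L_{n,i}` (in types
  `A`, `C`, `D` it is all of `L_{n,i}`) is stable under `𝔥_{n+1}`. -/
  constituent_compat : ∀ n i, ∀ h ∈ cartan n, ∀ h' ∈ cartan (n + 1), ∀ v ∈ constituent n i,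
    h'.1 *ᵥ ((δ n h).1 *ᵥ v) ∈ constituent n i

namespace DiagonalIndGroup

variable {K : Type*} [Field K] (G : DiagonalIndGroup K)

/-- The Lie algebra `𝔤_n`. -/
abbrev g (n : ℕ) : LieSubalgebra K
    (Matrix (G.type.Idx (G.rank n)) (G.type.Idx (G.rank n)) K) :=
  G.type.lieAlg K (G.rank n)

/-- The dual space `𝔥_n^*`. -/
abbrev hDual (n : ℕ) : Type _ := Module.Dual K (G.cartan n)

instance (n : ℕ) : (G.cartan n).IsCartanSubalgebra := G.isCartan n

/-- The inclusion `𝔥_n → 𝔥_{n+1}`. -/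
def cartanMap (n : ℕ) : G.cartan n →ₗ[K] G.cartan (n + 1) where
  toFun h := ⟨G.δ n h.1, (G.cartan_compat n h.1).2 h.2⟩
  map_add' x y := by ext1; simp
  map_smul' c x := by ext1; simp

/-- The restriction of weights `𝔥_{n+1}^* → 𝔥_n^*`. -/
def restrict (n : ℕ) (μ : G.hDual (n + 1)) : G.hDual n := μ ∘ₗ G.cartanMap n

/-- The set `𝒫` of weights of `G`: inverse systems of integral weights of the `𝔤_n`. -/
def Weight : Type _ :=
  {μ : ∀ n, G.hDual n //
    (∀ n, CartanPair.IsIntegral (G.cartan n) (μ n)) ∧ ∀ n, G.restrict n (μ (n + 1)) = μ n}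

/-- `y` is the image of `x` under `𝔤_n → 𝔤_n^{⊕ s_n} → 𝔤_n^i → 𝔤_{n+1}`: it acts as `δ_n(x)` on
the `i`-th constituent and as `0` on the other constituents and on the trivial part. -/
def IsComponent (n : ℕ) (i : Fin (G.s n)) (x : G.g n) (y : G.g (n + 1)) : Prop :=
  (∀ v ∈ G.constituent n i, y.1 *ᵥ v = (G.δ n x).1 *ᵥ v) ∧
  (∀ j, j ≠ i → ∀ v ∈ G.constituent n j, y.1 *ᵥ v = 0) ∧
  (∀ v ∈ G.trivialPart n, y.1 *ᵥ v = 0)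

/-- The `i`-th component map `𝔤_n → 𝔤_{n+1}` sends the root space of `α` into that of `β`. -/
def RootMapsTo (n : ℕ) (i : Fin (G.s n)) (α : G.hDual n) (β : G.hDual (n + 1)) : Prop :=
  CartanPair.IsRoot (G.cartan n) α ∧ CartanPair.IsRoot (G.cartan (n + 1)) β ∧
  ∀ x ∈ LieAlgebra.rootSpace (G.cartan n) α, ∃ y ∈ LieAlgebra.rootSpace (G.cartan (n + 1)) β,
    G.IsComponent n i x y

/-- `G` is root reductive: for all large `n`, every `𝔥_n`-root space of `𝔤_n` is mapped by `δ_n`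
into a single `𝔥_{n+1}`-root space of `𝔤_{n+1}`. -/
def IsRootReductive : Prop :=
  ∀ᶠ n in atTop, ∀ α, CartanPair.IsRoot (G.cartan n) α →
    ∃ β, CartanPair.IsRoot (G.cartan (n + 1)) β ∧
      ∀ x ∈ LieAlgebra.rootSpace (G.cartan n) α,
        G.δ n x ∈ LieAlgebra.rootSpace (G.cartan (n + 1)) β

/-- For `G` of type `B`: a root of `𝔤_n` is long if it is not a weight of the natural
representation (the short roots are `±ε_i`, the long ones are `±ε_i ± ε_j`). -/
def IsLong (n : ℕ) (α : G.hDual n) : Prop :=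
  ∀ v : G.type.NatRep K (G.rank n), (∀ h : G.cartan n, h.1.1 *ᵥ v = α h • v) → v = 0

/-- The set `𝒯` of sequences `(t_n)` with `t_n ∈ {1, …, s_n}` up to equality for large `n`. -/
def Tails : Type := Filter.Product atTop fun n => Fin (G.s n)

/-- Sequences of automorphisms of the spaces `𝔥_n^*`, up to equality for large `n`. -/
def AutGerm : Type _ := Filter.Product atTop fun n => G.hDual n ≃ₗ[K] G.hDual n

/-- The class of a sequence `(t_n)`. -/
def Tails.mk (a : ∀ n, Fin (G.s n)) : G.Tails :=
  Quotient.mk (Filter.productSetoid atTop fun n => Fin (G.s n)) a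

/-- The class of a sequence of automorphisms. -/
def AutGerm.mk (x : ∀ n, G.hDual n ≃ₗ[K] G.hDual n) : G.AutGerm :=
  Quotient.mk (Filter.productSetoid atTop fun n => G.hDual n ≃ₗ[K] G.hDual n) x

instance : One G.AutGerm := ⟨AutGerm.mk G fun _ => 1⟩

/-- A Borel subgroup `B = lim B_n` of `G` containing `H`, given by the Lie algebras `𝔟_n`. -/
structure Borel where
  /-- The Borel subalgebra `𝔟_n` of `𝔤_n`. -/
  b : ∀ n, LieSubalgebra K (G.g n)
  isBorel : ∀ n, CartanPair.IsBorel (b n)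
  cartan_le : ∀ n, G.cartan n ≤ b n
  /-- `𝔟_n = 𝔟_{n+1} ∩ 𝔤_n`. -/
  compat : ∀ n x, G.δ n x ∈ b (n + 1) ↔ x ∈ b n

namespace Borel

variable {G} (B : G.Borel)

/-- The roots of `𝔤_n` whose reflections are used to build `W`: all roots, except that
for `G` of type `B` and not root reductive only the long simple roots of `𝔟_n` are taken. -/
def admissibleRoots (n : ℕ) : Set (G.hDual n) :=
  {α | CartanPair.IsRoot (G.cartan n) α ∧ (G.type = ClassicalType.B → ¬ G.IsRootReductive →
    α ∈ CartanPair.simpleRoots (G.cartan n) (B.b n) ∧ G.IsLong n α)}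

/-- The group `W_n` (replaced by its subgroup generated by the reflections along the long simple
roots if `G` is of type `B` and not root reductive). -/
def W (n : ℕ) : Subgroup (G.hDual n ≃ₗ[K] G.hDual n) :=
  CartanPair.reflectionGroup (G.cartan n) (B.admissibleRoots n)

/-- The graph of the homomorphism `τ_n^i : W_n → W_{n+1}`, which sends the reflection along `α`
to the reflection along the root `β` whose root space contains the image of that of `α`. -/
def tauGraph (n : ℕ) (i : Fin (G.s n)) :
    Subgroup ((G.hDual n ≃ₗ[K] G.hDual n) × (G.hDual (n + 1) ≃ₗ[K] G.hDual (n + 1))) :=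
  Subgroup.closure {p | ∃ α ∈ B.admissibleRoots n, ∃ β, G.RootMapsTo n i α β ∧
    CartanPair.IsReflectionAlong (G.cartan n) α p.1 ∧
    CartanPair.IsReflectionAlong (G.cartan (n + 1)) β p.2}

/-- The group `W^t`, the direct limit of the `W_n` along the maps `τ_n^{t_n}`: sequences `(x_n)`
with `x_n ∈ W_n` and `τ_n^{t_n}(x_n) = x_{n+1}` for large `n`, up to equality for large `n`. -/
def limitGroup (t : G.Tails) : Set G.AutGerm :=
  {w | ∃ (a : ∀ n, Fin (G.s n)) (x : ∀ n, G.hDual n ≃ₗ[K] G.hDual n),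
    Tails.mk G a = t ∧ AutGerm.mk G x = w ∧
    ∀ᶠ n in atTop, x n ∈ B.W n ∧ (x n, x (n + 1)) ∈ B.tauGraph n (a n)}

/-- The elements of `W`, the restricted direct product of the groups `W^t`. -/
structure WElem where
  /-- The component `w^t`. -/
  comp : G.Tails → G.AutGerm
  comp_mem : ∀ t, comp t ∈ B.limitGroup t
  finite_support : {t | comp t ≠ 1}.Finite

/-- The length of an element of `W^t`: the limit of the lengths `ℓ_n(x_n)`. -/
def germLength : G.AutGerm → ℕ∞ :=
  Quotient.lift
    (fun x => liminf (fun n => (CartanPair.length (G.cartan n) (B.b n) (x n) : ℕ∞)) atTop)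
    (fun _ _ h => liminf_congr (h.mono fun _ hn => by rw [hn]))

variable {B}

/-- The length `ℓ_B(w)`. -/
def WElem.length (w : B.WElem) : ℕ∞ := ∑ᶠ t, B.germLength (w.comp t)

/-- The sequence `x` represents `(w(n))` for large `n`: for an enumeration `t^1, …, t^l` of the
support of `w` and sequences `a` representing the components, `x_n` is eventually the product
of the `w^{t^i}` in `W_n`. -/
def WElem.IsRealizedBy (w : B.WElem) (x : ∀ n, G.hDual n ≃ₗ[K] G.hDual n) : Prop :=
  ∃ (l : List G.Tails) (a : G.Tails → ∀ n, G.hDual n ≃ₗ[K] G.hDual n),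
    l.Nodup ∧ (∀ t, t ∈ l ↔ w.comp t ≠ 1) ∧ (∀ t, AutGerm.mk G (a t) = w.comp t) ∧
    ∀ᶠ n in atTop, x n = (l.map fun t => a t n).prod

variable (B)

/-- `W_B`: the elements of `W` of finite length. -/
def WB : Set B.WElem := {w | w.length ≠ ⊤}

/-- `𝒫_B^+`: the `B`-dominant weights. -/
def dominantWeights : Set G.Weight :=
  {μ | ∀ n, CartanPair.IsDominant (G.cartan n) (B.b n) (μ.1 n)}

/-- The dot action `w · μ = w (μ + ρ_n) - ρ_n` on `𝔥_n^*`. -/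
def dot (n : ℕ) (w : G.hDual n ≃ₗ[K] G.hDual n) (μ : G.hDual n) : G.hDual n :=
  CartanPair.dot (G.cartan n) (B.b n) w μ

end Borel

end DiagonalIndGroup

end

/-! Write γ for an inversion of u ∈ W_n, that is, a positive root γ such that u⁻¹γ is negative.
Three facts about finite Weyl groups carry the proof: the number of inversions is at most the
length; u(ρ) - ρ is minus the sum of the inversions; and u fixes every weight that vanishes on the
coroots of the inversions (`apply_eq_self_of_forall_inversions`, via the deletion condition).

Let (x_n) represent a component w^t. The component map of index t_n, transported by the trace forms
of the natural representations, gives a linear map `push` from 𝔥_n^* to 𝔥_{n+1}^*. It is a section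
of restriction, it intertwines x_n and x_{n+1}, and it sends the relevant roots to roots, preserving
and reflecting positivity and matching coroots. Hence it embeds the inversions of x_n into those of
x_{n+1}. Since the length stays bounded along infinitely many n, the number of inversions is
eventually constant, and from then on `push` is a bijection between inversion sets. So
x_{n+1}(ρ_{n+1}) - ρ_{n+1} is the `push` of x_n(ρ_n) - ρ_n and restricts to it.

For dominant λ, the value λ_n(γ^∨) is the sum, over all components j, of the values of λ_{n+1} on
the coroots of the images of γ. These are natural numbers, so the sum of λ_n(γ^∨) over the
inversions γ of x_n eventually does not increase, and is therefore eventually constant. Then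
λ_n(γ^∨) equals the value of λ_{n+1} on the coroot of `push` γ for each inversion γ, and the third
fact shows that x_{n+1}(λ_{n+1}) - λ_{n+1} is the `push` of x_n(λ_n) - λ_n.

Components w^s and w^t with s ≠ t act on complementary directions: x^s fixes x^t(ν) - ν for large n.
So w(n)(ν) - ν is the sum of the contributions of the components, and each contribution forms an
inverse system for ν = ρ and ν = λ; the dot action is the sum of these two cases. The contributions
lie in the root lattice, which gives integrality for large n, and integrality of the remaining terms
follows by restriction along images of sl₂-triples.

Two preparations are needed. A Borel subalgebra is only given as a maximal solvable subalgebra, so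
its roots must be shown to be the positive roots of a base. And in type B zero is a weight of the
natural representation, so a component need not map root spaces into root spaces; it does so for
roots whose root spaces kill the zero weight space, and outside the root reductive case the
inversions that occur are of this kind. -/

set_option linter.unusedSectionVars false

open scoped Matrix

/-! ### Words, inversions and positive systems of a root system -/

namespace RootPairing

open Module Set

variable {ι K M N : Type*} [Finite ι] [Field K] [CharZero K] [AddCommGroup M] [Module K M]
  [AddCommGroup N] [Module K N] {P : RootPairing ι K M N}

namespace Base

variable (b : P.Base)

/-- The inversions of `w⁻¹`: the positive roots which `w⁻¹` maps to non-positive roots. -/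
def inversions (w : M ≃ₗ[K] M) : Set ι :=
  {i | b.IsPos i ∧ ∃ j, ¬ b.IsPos j ∧ w (P.root j) = P.root i}

omit [CharZero K] [Finite ι] in
lemma isPos_reflectionPerm_self_iff [CharZero K] [Finite ι] (i : ι) :
    b.IsPos (P.reflectionPerm i i) ↔ ¬ b.IsPos i :=
  IsPos.neg_iff_not b i

variable [P.IsCrystallographic] [P.IsReduced]

/-- Every root is obtained from a simple one by simple reflections, and the reflection along s_j(i)
is s_j s_i s_j; so each reflection is a product of simple ones. -/
lemma exists_word {w : M ≃ₗ[K] M} (hw : w ∈ Subgroup.closure (range P.reflection)) :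
    ∃ l : List ι, (∀ i ∈ l, i ∈ b.support) ∧ w = (l.map P.reflection).prod := by
  have refl (i : ι) : ∃ l : List ι, (∀ i ∈ l, i ∈ b.support) ∧
      P.reflection i = (l.map P.reflection).prod := by
    refine b.induction_reflect (p := fun i ↦ ∃ l : List ι, (∀ i ∈ l, i ∈ b.support) ∧
      P.reflection i = (l.map P.reflection).prod) i ?_ (fun i hi ↦ ⟨[i], by simpa, by simp⟩) ?_
    · rintro i ⟨l, hl, h⟩
      refine ⟨l, hl, ?_⟩
      rw [← h, reflection_reflectionPerm]
      ext x
      simp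
    · rintro i j ⟨l, hl, h⟩ hj
      refine ⟨j :: l ++ [j], ?_, ?_⟩
      · simpa [or_imp, forall_and, hj] using hl
      · rw [reflection_reflectionPerm, h]
        simp [mul_assoc]
  induction hw using Subgroup.closure_induction'' with
  | one => exact ⟨[], by simp, by simp⟩
  | mem w hw => obtain ⟨i, rfl⟩ := hw; exact refl i
  | inv_mem w hw => obtain ⟨i, rfl⟩ := hw; simpa using refl i
  | mul x y _ _ hx hy =>
    obtain ⟨l, hl, rfl⟩ := hx
    obtain ⟨m, hm, rfl⟩ := hy
    exact ⟨l ++ m, by simpa [or_imp, forall_and] using ⟨hl, hm⟩, by simp⟩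

omit [CharZero K] [Finite ι] [P.IsCrystallographic] [P.IsReduced] in
variable (P) in
lemma exists_perm_of_mem_closure [Finite ι] {w : M ≃ₗ[K] M}
    (hw : w ∈ Subgroup.closure (range P.reflection)) :
    ∃ σ : Equiv.Perm ι, ∀ i, P.root (σ i) = w (P.root i) := by
  induction hw using Subgroup.closure_induction'' with
  | one => exact ⟨1, by simp⟩
  | mem w hw => obtain ⟨i, rfl⟩ := hw; exact ⟨P.reflectionPerm i, by simp⟩
  | inv_mem w hw => obtain ⟨i, rfl⟩ := hw; exact ⟨P.reflectionPerm i, by simp⟩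
  | mul x y _ _ hx hy =>
    obtain ⟨σ, hσ⟩ := hx
    obtain ⟨τ, hτ⟩ := hy
    exact ⟨σ * τ, fun i ↦ by simp [hσ, hτ]⟩

variable {b}

/-- A simple reflection s_a permutes the positive roots other than a, so multiplying by it can
create at most the new inversion a. -/
lemma inversions_mul_subset {a : ι} (ha : a ∈ b.support) (w : M ≃ₗ[K] M) :
    b.inversions (P.reflection a * w) ⊆ insert a (P.reflectionPerm a '' b.inversions w) := by
  rintro i ⟨hi, j, hj, hij⟩
  rcases eq_or_ne i a with rfl | hia
  · exact mem_insert _ _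
  refine mem_insert_of_mem _ ⟨P.reflectionPerm a i, ⟨hi.reflectionPerm ha hia, j, hj, ?_⟩, by simp⟩
  rw [root_reflectionPerm, ← hij]
  simp

lemma ncard_inversions_le {l : List ι} (hl : ∀ i ∈ l, i ∈ b.support) :
    (b.inversions (l.map P.reflection).prod).ncard ≤ l.length := by
  induction l with
  | nil =>
    suffices b.inversions (1 : M ≃ₗ[K] M) = ∅ by simp [this]
    ext i
    simp only [inversions, mem_ofPred_eq, LinearEquiv.coe_one, id_eq, EmbeddingLike.apply_eq_iff_eq,
      mem_empty_iff_false, iff_false, not_and, not_exists]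
    rintro hi j hj rfl
    exact hj hi
  | cons a l ih =>
    simp only [List.map_cons, List.prod_cons, List.length_cons]
    refine (ncard_le_ncard (inversions_mul_subset (hl a (by simp)) _) (toFinite _)).trans ?_
    refine (ncard_insert_le _ _).trans ?_
    gcongr
    exact (ncard_image_le (toFinite _)).trans (ih fun i hi ↦ hl i (by simp [hi]))

/-- A set of roots that is stable under the reflections in a word and contains the corresponding
simple roots contains all inversions. -/
lemma inversions_subset_of_stable {l : List ι} (hl : ∀ i ∈ l, i ∈ b.support) {C : Set ι}
    (hC : ∀ a ∈ l, a ∈ C) (hC' : ∀ a ∈ l, ∀ i ∈ C, P.reflectionPerm a i ∈ C) :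
    b.inversions (l.map P.reflection).prod ⊆ C := by
  induction l with
  | nil =>
    rintro i ⟨hi, j, hj, hij⟩
    obtain rfl : j = i := by simpa using hij
    exact absurd hi hj
  | cons a l ih =>
    refine (inversions_mul_subset (hl a (by simp)) _).trans ?_
    refine insert_subset (hC a (by simp)) ?_
    rintro - ⟨i, hi, rfl⟩
    exact hC' a (by simp) i (ih (fun i hi ↦ hl i (by simp [hi])) (fun i hi ↦ hC i (by simp [hi]))
      (fun i hi ↦ hC' i (by simp [hi])) hi)

/-- The deletion condition. -/
lemma exists_word_reflection_mul {l : List ι} (hl : ∀ i ∈ l, i ∈ b.support) {i : ι}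
    (hi : i ∈ b.inversions (l.map P.reflection).prod) :
    ∃ m : List ι, (∀ i ∈ m, i ∈ b.support) ∧ m.length + 1 = l.length ∧
      P.reflection i * (l.map P.reflection).prod = (m.map P.reflection).prod := by
  induction l generalizing i with
  | nil =>
    obtain ⟨hi, j, hj, hij⟩ := hi
    obtain rfl : j = i := by simpa using hij
    exact absurd hi hj
  | cons a l ih =>
    rcases eq_or_ne i a with rfl | hia
    · refine ⟨l, fun i hi ↦ hl i (by simp [hi]), by simp, ?_⟩
      ext x
      simp
    obtain ⟨hi, j, hj, hij⟩ := hi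
    -- For i ≠ a, the root s_a(i) is an inversion of the tail, and s_i s_a = s_a s_{s_a(i)} moves
    -- the deletion into the tail.
    obtain ⟨m, hm, hlen, h⟩ := ih (fun i hi ↦ hl i (by simp [hi]))
      (i := P.reflectionPerm a i) ⟨hi.reflectionPerm (hl a (by simp)) hia, j, hj, by
        rw [root_reflectionPerm, ← hij]; simp⟩
    refine ⟨a :: m, ?_, by simp [hlen], ?_⟩
    · simpa using ⟨hl a (by simp), hm⟩
    · simp only [List.map_cons, List.prod_cons, ← h, reflection_reflectionPerm]
      ext x
      simp

/-- Induction on the length of a word s_a w'. If a is an inversion of w', the deletion condition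
shortens the word. Otherwise a is an inversion of s_a w', so ν is fixed by s_a; and s_a maps the
inversions of w' to inversions of s_a w', so the hypothesis passes to w'. -/
lemma apply_eq_self_of_forall_inversions {l : List ι} (hl : ∀ i ∈ l, i ∈ b.support) {ν : M}
    (hν : ∀ i ∈ b.inversions (l.map P.reflection).prod, P.coroot' i ν = 0) :
    (l.map P.reflection).prod ν = ν := by
  induction hn : l.length using Nat.strong_induction_on generalizing l with
  | _ n ih =>
  match l, hl, hν, hn with
  | [], _, _, _ => simp
  | a :: l, hl, hν, hn =>
    have ha := hl a (by simp)
    have hl' : ∀ i ∈ l, i ∈ b.support := fun i hi ↦ hl i (by simp [hi])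
    simp only [List.map_cons, List.prod_cons, List.length_cons] at hν hn ⊢
    by_cases h : a ∈ b.inversions (l.map P.reflection).prod
    · obtain ⟨m, hm, hlen, h⟩ := exists_word_reflection_mul hl' h
      rw [h] at hν ⊢
      exact ih m.length (by lia) hm hν rfl
    · obtain ⟨σ, hσ⟩ := exists_perm_of_mem_closure P (w := (l.map P.reflection).prod) (by
        refine list_prod_mem fun x hx ↦ ?_
        obtain ⟨i, -, rfl⟩ := List.mem_map.mp hx
        exact Subgroup.subset_closure (mem_range_self i))
      have hpa := isPos_of_mem_support ha
      have hinv : a ∈ b.inversions (P.reflection a * (l.map P.reflection).prod) := by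
        have hpos : b.IsPos (σ.symm a) := by
          by_contra hneg
          exact h ⟨hpa, σ.symm a, hneg, by rw [← hσ]; simp⟩
        refine ⟨hpa, P.reflectionPerm (σ.symm a) (σ.symm a), ?_, ?_⟩
        · rw [isPos_reflectionPerm_self_iff]
          simpa
        · simp [← hσ]
      have hfix : P.reflection a ν = ν := by
        rw [reflection_apply, hν a hinv, zero_smul, sub_zero]
      have key : (l.map P.reflection).prod ν = ν := by
        refine ih l.length (by lia) hl' (fun i hi ↦ ?_) rfl
        have hia : i ≠ a := by rintro rfl; exact h hi
        obtain ⟨hi, j, hj, hij⟩ := hi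
        rw [← hfix, coroot'_reflection]
        refine hν _ ⟨hi.reflectionPerm ha hia, j, hj, ?_⟩
        rw [root_reflectionPerm, ← hij]
        simp
      simp [key, hfix]

omit [P.IsCrystallographic] [P.IsReduced] in
open Classical in
-- With A the set of positive roots, w changes the sum over A into the sum over wA. The roots lost,
-- A \ wA, are the inversions, and the roots gained, wA \ A, are their negatives; the factor 1/2
-- then leaves each inversion once.
lemma apply_half_sum_sub [Fintype ι] {w : M ≃ₗ[K] M}
    (hw : w ∈ Subgroup.closure (range P.reflection)) :
    w ((2 : K)⁻¹ • ∑ i with b.IsPos i, P.root i) - (2 : K)⁻¹ • ∑ i with b.IsPos i, P.root i =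
      - ∑ i with i ∈ b.inversions w, P.root i := by
  obtain ⟨σ, hσ⟩ := exists_perm_of_mem_closure P hw
  set A : Finset ι := {i | b.IsPos i} with hA
  have memA (i : ι) : i ∈ A ↔ b.IsPos i := by simp [hA]
  have hinv : ({i | i ∈ b.inversions w} : Finset ι) = A \ A.map σ.toEmbedding := by
    ext i
    simp only [Finset.mem_filter, Finset.mem_univ, true_and, Finset.mem_sdiff, memA,
      Finset.mem_map_equiv]
    change b.IsPos i ∧ _ ↔ _
    refine and_congr_right fun _ ↦ ⟨?_, fun h ↦ ⟨σ.symm i, h, by rw [← hσ]; simp⟩⟩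
    rintro ⟨j, hj, hij⟩
    rw [← hσ, EmbeddingLike.apply_eq_iff_eq] at hij
    simpa [← hij]
  have h1 : w (∑ i ∈ A, P.root i) = ∑ i ∈ A.map σ.toEmbedding, P.root i := by
    simp [map_sum, hσ]
  have h2 : ∑ i ∈ A.map σ.toEmbedding \ A, P.root i = - ∑ i ∈ A \ A.map σ.toEmbedding, P.root i := by
    rw [← Finset.sum_neg_distrib]
    -- The permutation of roots induced by w commutes with negation, which therefore exchanges wA \
    -- A and A \ wA.
    have hneg (i : ι) : b.IsPos (σ.symm (P.reflectionPerm i i)) ↔ ¬ b.IsPos (σ.symm i) := by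
      rw [← isPos_reflectionPerm_self_iff]
      suffices σ.symm (P.reflectionPerm i i) = P.reflectionPerm (σ.symm i) (σ.symm i) by rw [this]
      rw [Equiv.symm_apply_eq]
      apply P.root.injective
      rw [hσ, root_reflectionPerm, root_reflectionPerm, reflection_apply_self,
        reflection_apply_self, map_neg, ← hσ]
      simp
    refine Finset.sum_bij' (fun i _ ↦ P.reflectionPerm i i) (fun i _ ↦ P.reflectionPerm i i)
      ?_ ?_ ?_ ?_ ?_
    · intro i hi
      simp only [Finset.mem_sdiff, Finset.mem_map_equiv, memA, hneg,
        isPos_reflectionPerm_self_iff] at hi ⊢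
      tauto
    · intro i hi
      simp only [Finset.mem_sdiff, Finset.mem_map_equiv, memA, hneg,
        isPos_reflectionPerm_self_iff] at hi ⊢
      tauto
    · intro i _
      apply P.root.injective
      simp only [root_reflectionPerm, reflection_apply_self]
      rw [reflection_reflectionPerm]
      simp
    · intro i _
      apply P.root.injective
      simp only [root_reflectionPerm, reflection_apply_self]
      rw [reflection_reflectionPerm]
      simp
    · intro i _
      simp
  rw [map_smul, ← smul_sub, h1, hinv, ← Finset.sum_sdiff_sub_sum_sdiff, h2, smul_sub, smul_neg,
    ← neg_add', ← add_smul, ← two_mul, mul_inv_cancel₀ two_ne_zero, one_smul]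

end Base

variable (P) [P.IsCrystallographic] [P.IsReduced] [P.IsRootSystem]

/-- The base attached to an additive function which does not vanish on roots. -/
lemma exists_base_of_addMonoidHom (f : M →+ ℚ) (hf : ∀ i, f (P.root i) ≠ 0) :
    ∃ b : P.Base, (∀ i, b.IsPos i ↔ 0 < f (P.root i)) ∧
      ∀ i, i ∈ b.support ↔ 0 < f (P.root i) ∧ ∀ j k, 0 < f (P.root j) → 0 < f (P.root k) →
        P.root i ≠ P.root j + P.root k := by
  let := P.indexNeg
  let s := IsAddIndecomposable.baseOf P.root f
  let b : P.Base := Base.mk' P s (P.linearIndepOn_root_baseOf f hf) fun i ↦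
    IsAddIndecomposable.mem_or_neg_mem_closure_baseOf P.root f i (hf i) (by simp)
  have hs (i : ι) : i ∈ b.support ↔ i ∈ s := by simp [b, Base.mk']
  have key (i : ι) (hi : b.IsPos i) : 0 < f (P.root i) := by
    refine hi.induction_on_add (p := fun i ↦ 0 < f (P.root i)) (fun i hi ↦ ?_)
      fun i j k hk hi hj ↦ ?_
    · exact ((hs i).1 hi).1
    · rw [hk, map_add]
      exact add_pos hi ((hs j).1 hj).1
  refine ⟨b, fun i ↦ ⟨key i, fun hi ↦ ?_⟩, fun i ↦ ?_⟩
  · by_contra h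
    have := key _ ((Base.isPos_reflectionPerm_self_iff b i).2 h)
    simp at this
    exact lt_asymm hi this
  · rw [hs]
    refine and_congr_right fun _ ↦ ⟨fun h j k hj hk e ↦ ?_, fun h j hj k hk e ↦ absurd e (h j k hj hk)⟩
    rcases h j hj k hk e with h | h <;> exact P.ne_zero _ h

omit [P.IsReduced] [P.IsRootSystem] in
/-- A set of roots which contains no pair of opposite roots and is closed under raising
reflections lies on the positive side of a regular additive function. -/
lemma exists_addMonoidHom_pos_of_isClosed (S : Set ι)
    (hneg : ∀ i ∈ S, P.reflectionPerm i i ∉ S)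
    (hrefl : ∀ i ∈ S, ∀ j ∈ S, P.pairingIn ℤ j i < 0 → P.reflectionPerm i j ∈ S) :
    ∃ f : M →+ ℚ, (∀ i, f (P.root i) ≠ 0) ∧ ∀ i ∈ S, 0 < f (P.root i) := by
  classical
  have := Fintype.ofFinite ι
  let : Module ℚ M := Module.compHom M (algebraMap ℚ K)
  -- The sum of S pairs positively with every coroot of S. The reflection s_i sends each j ∈ S of
  -- negative pairing to an element of S with the opposite pairing, and never to i because -i ∉ S.
  -- The negative terms are thus compensated without using j = i, which contributes 2.
  have hsum (i : ι) (hi : i ∈ S) : 0 < ∑ j with j ∈ S, P.pairingIn ℤ j i := by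
    have hinj : ∑ j with j ∈ S ∧ P.pairingIn ℤ j i < 0, - P.pairingIn ℤ j i ≤
        ∑ j with (j ∈ S ∧ 0 ≤ P.pairingIn ℤ j i) ∧ j ≠ i, P.pairingIn ℤ j i := by
      have hp (j : ι) : P.pairingIn ℤ (P.reflectionPerm i j) i = - P.pairingIn ℤ j i := by
        apply FaithfulSMul.algebraMap_injective ℤ K
        rw [map_neg, algebraMap_pairingIn, algebraMap_pairingIn, ← pairing_reflectionPerm,
          pairing_reflectionPerm_self_right]
      calc _ = ∑ j ∈ ({j | j ∈ S ∧ P.pairingIn ℤ j i < 0} : Finset ι).map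
            (P.reflectionPerm i).toEmbedding, P.pairingIn ℤ j i := by
              simp [hp]
        _ ≤ _ := by
          refine Finset.sum_le_sum_of_subset_of_nonneg (fun j hj ↦ ?_) fun j hj _ ↦ ?_
          · obtain ⟨k, hk, rfl⟩ := Finset.mem_map.mp hj
            simp only [Finset.mem_filter, Finset.mem_univ, true_and, Equiv.coe_toEmbedding] at hk ⊢
            refine ⟨⟨hrefl i hi k hk.1 hk.2, by rw [hp]; lia⟩, fun h ↦ hneg i hi ?_⟩
            have : P.reflectionPerm i i = k := by
              have := congrArg (P.reflectionPerm i) h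
              rw [reflectionPerm_self] at this
              exact this.symm
            rw [this]
            exact hk.1
          · simp only [Finset.mem_filter, Finset.mem_univ, true_and] at hj
            exact hj.1.2
    have hi0 : i ∈ ({j | j ∈ S ∧ 0 ≤ P.pairingIn ℤ j i} : Finset ι) := by simp [hi]
    have hsplit := Finset.sum_filter_add_sum_filter_not ({j | j ∈ S} : Finset ι)
      (fun j ↦ P.pairingIn ℤ j i < 0) (fun j ↦ P.pairingIn ℤ j i)
    simp only [Finset.filter_filter, not_lt] at hsplit
    rw [← Finset.add_sum_erase _ _ hi0, ← Finset.filter_ne', Finset.filter_filter] at hsplit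
    rw [Finset.sum_neg_distrib] at hinj
    have : P.pairingIn ℤ i i = 2 := by simp
    lia
  -- A ℚ-linear retraction of K onto ℚ makes the K-valued root form into a ℚ-valued function; its
  -- values on the pairs used here are already rational.
  obtain ⟨π, hπ⟩ : ∃ π : Dual ℚ K, π 1 = 1 := by
    obtain ⟨π, hπ⟩ := exists_dual_forall_apply_eq_one (K := ℚ) (v := fun _ : Unit ↦ (1 : K))
      (s := univ) (by simp)
    exact ⟨π, hπ () (by simp)⟩
  let σ : M := ∑ j with j ∈ S, P.root j
  let f₁ : M →+ ℚ := (π : K →+ ℚ).comp ((P.RootForm σ : M →ₗ[K] K) : M →+ K)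
  have hf₁ (i : ι) (hi : i ∈ S) : 0 < f₁ (P.root i) := by
    obtain ⟨r, hr, hri⟩ : ∃ r : ℤ, 0 < r ∧ P.RootForm (P.root i) (P.root i) = r := by
      refine ⟨∑ j, P.pairingIn ℤ i j * P.pairingIn ℤ i j, ?_, ?_⟩
      · refine Finset.sum_pos' (fun j _ ↦ mul_self_nonneg _) ⟨i, by simp, by simp⟩
      · rw [rootForm_apply_apply]
        simp [← P.algebraMap_pairingIn ℤ]
    have h2 : 2 * P.RootForm σ (P.root i) = ((∑ j with j ∈ S, P.pairingIn ℤ j i) * r : ℤ) := by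
      simp only [σ, map_sum, LinearMap.sum_apply, Finset.mul_sum, Int.cast_mul, Int.cast_sum,
        Finset.sum_mul]
      refine Finset.sum_congr rfl fun j _ ↦ ?_
      rw [← hri]
      have := P.toInvariantForm.two_mul_apply_root_root j i
      rw [← P.algebraMap_pairingIn ℤ] at this
      exact this
    have h3 : P.RootForm σ (P.root i) =
        (((∑ j with j ∈ S, P.pairingIn ℤ j i) * r : ℤ) / 2 : ℚ) • (1 : K) := by
      rw [Rat.smul_one_eq_cast]
      push_cast at h2 ⊢
      rw [← h2]
      simp
    have h4 : f₁ (P.root i) = ((∑ j with j ∈ S, P.pairingIn ℤ j i) * r : ℤ) / 2 := by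
      change π (P.RootForm σ (P.root i)) = _
      rw [h3, map_smul, hπ, smul_eq_mul, mul_one]
    rw [h4]
    have := mul_pos (hsum i hi) hr
    positivity
  -- The function `f₁` is positive on S but may vanish on other roots. Adding a function `f₀` with
  -- no zeros among the roots to a multiple n·`f₁` repairs this; n is chosen so large that n|`f₁`|
  -- exceeds |`f₀`| wherever `f₁` is nonzero.
  obtain ⟨f₀, hf₀⟩ : ∃ f : Dual ℚ M, ∀ i, f (P.root i) ≠ 0 :=
    exists_dual_forall_apply_ne_zero P.root <| by simp [P.ne_zero]
  let n : ℚ := 1 + ∑ i, |f₀ (P.root i)| / |f₁ (P.root i)|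
  have hn (i : ι) (hi : f₁ (P.root i) ≠ 0) : |f₀ (P.root i)| < n * |f₁ (P.root i)| := by
    rw [← div_lt_iff₀ (by positivity)]
    have : |f₀ (P.root i)| / |f₁ (P.root i)| ≤ ∑ i, |f₀ (P.root i)| / |f₁ (P.root i)| :=
      Finset.single_le_sum (f := fun i ↦ |f₀ (P.root i)| / |f₁ (P.root i)|)
        (fun _ _ ↦ by positivity) (Finset.mem_univ i)
    simp only [n]
    linarith
  have hn0 : 0 < n := by positivity
  refine ⟨(AddMonoidHom.mulLeft n).comp f₁ + (f₀ : M →+ ℚ), fun i ↦ ?_, fun i hi ↦ ?_⟩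
  · change n * f₁ (P.root i) + f₀ (P.root i) ≠ 0
    by_cases h : f₁ (P.root i) = 0
    · simpa [h] using hf₀ i
    · intro h0
      have := hn i h
      rw [← abs_of_pos hn0, ← abs_mul, eq_neg_of_add_eq_zero_left h0, abs_neg] at this
      exact lt_irrefl _ this
  · change 0 < n * f₁ (P.root i) + f₀ (P.root i)
    have := hn i (hf₁ i hi).ne'
    rw [abs_of_pos (hf₁ i hi)] at this
    linarith [neg_abs_le (f₀ (P.root i))]

end RootPairing

/-! ### The root system of a Cartan pair -/

namespace CartanPair

open LieAlgebra LieAlgebra.IsKilling LieModule Module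

variable {K L : Type*} [Field K] [CharZero K] [IsAlgClosed K] [LieRing L] [LieAlgebra K L]
  [FiniteDimensional K L] [LieAlgebra.IsKilling K L]
variable {H : LieSubalgebra K L} [H.IsCartanSubalgebra]

/-- This and the next lemmas translate the elementary notions of root, coroot and reflection into
`rootSystem H`. -/
lemma isRoot_iff {α : Dual K H} : IsRoot H α ↔ ∃ i, (rootSystem H).root i = α := by
  constructor
  · rintro ⟨h0, h⟩
    let χ : Weight K H L := ⟨α, h⟩
    have hχ : χ.IsNonZero := fun h ↦ h0 (by ext x; exact congrFun h x)
    refine ⟨⟨χ, by simpa [LieSubalgebra.root] using hχ⟩, ?_⟩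
    ext x
    rfl
  · rintro ⟨i, rfl⟩
    exact ⟨(rootSystem H).ne_zero i, i.1.genWeightSpace_ne_bot⟩

lemma isRoot_root (i) : IsRoot H ((rootSystem H).root i) := isRoot_iff.2 ⟨i, rfl⟩

lemma isNonZero_of_mem_root (i : H.root) : i.1.IsNonZero :=
  LieSubalgebra.isNonZero_coe_root i

lemma isCoroot_iff {i : H.root} {c : H} :
    IsCoroot H ((rootSystem H).root i) c ↔ c = (rootSystem H).coroot i := by
  constructor
  · rintro ⟨h1, h2⟩
    exact eq_coroot_of_mem_corootSpace_of_two i.1 h1 h2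
  · rintro rfl
    exact ⟨coroot_mem_corootSpace i.1, root_apply_coroot (isNonZero_of_mem_root i)⟩

lemma isReflectionAlong_iff {i : H.root} {s : Dual K H ≃ₗ[K] Dual K H} :
    IsReflectionAlong H ((rootSystem H).root i) s ↔ s = (rootSystem H).reflection i := by
  constructor
  · rintro ⟨-, c, hc, h⟩
    rw [isCoroot_iff] at hc
    subst hc
    ext1 μ
    rw [h, RootPairing.reflection_apply]
    rfl
  · rintro rfl
    refine ⟨isRoot_root i, _, isCoroot_iff.2 rfl, fun μ ↦ ?_⟩
    rw [RootPairing.reflection_apply]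
    rfl

lemma IsRoot.exists_isCoroot {α : Dual K H} (hα : IsRoot H α) : ∃ c, IsCoroot H α c := by
  obtain ⟨i, rfl⟩ := isRoot_iff.1 hα
  exact ⟨_, isCoroot_iff.2 rfl⟩

lemma IsCoroot.unique {α : Dual K H} (hα : IsRoot H α) {c d : H} (hc : IsCoroot H α c)
    (hd : IsCoroot H α d) : c = d := by
  obtain ⟨i, rfl⟩ := isRoot_iff.1 hα
  rw [isCoroot_iff.1 hc, isCoroot_iff.1 hd]

lemma root_neg (i : H.root) :
    (rootSystem H).root ((rootSystem H).reflectionPerm i i) = -(rootSystem H).root i := by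
  rw [RootPairing.root_reflectionPerm, RootPairing.reflection_apply_self]

lemma IsRoot.neg {α : Dual K H} (hα : IsRoot H α) : IsRoot H (-α) := by
  obtain ⟨i, rfl⟩ := isRoot_iff.1 hα
  rw [← root_neg]
  exact isRoot_root _

lemma finite_setOf_isRoot : {α : Dual K H | IsRoot H α}.Finite := by
  refine (Set.finite_range (rootSystem H).root).subset fun α hα ↦ ?_
  exact isRoot_iff.1 hα

/-- An `sl₂`-triple attached to a root. -/
lemma IsRoot.exists_isSl2Triple {α : Dual K H} (hα : IsRoot H α) :
    ∃ (c : H) (e f : L), IsCoroot H α c ∧ IsSl2Triple (c : L) e f ∧ e ∈ rootSpace H α ∧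
      f ∈ rootSpace H (-α) := by
  obtain ⟨i, rfl⟩ := isRoot_iff.1 hα
  obtain ⟨h, e, f, ht, he, hf⟩ := exists_isSl2Triple_of_weight_isNonZero (isNonZero_of_mem_root i)
  obtain rfl := ht.h_eq_coroot (isNonZero_of_mem_root i) he hf
  exact ⟨coroot i.1, e, f, isCoroot_iff.2 rfl, ht, he, hf⟩

/-- Root spaces are one-dimensional, so one nonzero vector decides. -/
lemma IsRoot.rootSpace_le_of_ne_zero {α : Dual K H} (hα : IsRoot H α) {x : L}
    (hx : x ∈ rootSpace H α) (h0 : x ≠ 0) {V : Submodule K L} (hxV : x ∈ V) :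
    ∀ y ∈ rootSpace H α, y ∈ V := by
  obtain ⟨i, rfl⟩ := isRoot_iff.1 hα
  intro y hy
  obtain ⟨c, hc⟩ := (finrank_eq_one_iff_of_nonzero' (⟨x, hx⟩ : rootSpace H i.1)
    (fun h ↦ h0 (congrArg Subtype.val h))).1 (finrank_rootSpace_eq_one i.1 (isNonZero_of_mem_root i)) ⟨y, hy⟩
  obtain rfl : c • x = y := congrArg Subtype.val hc
  exact V.smul_mem c hxV

lemma IsRoot.exists_ne_zero {α : Dual K H} (hα : IsRoot H α) :
    ∃ x ∈ rootSpace H α, x ≠ 0 := by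
  simpa [LieSubmodule.eq_bot_iff] using hα.2

lemma lie_eq_smul {α : Dual K H} {x : L} (hx : x ∈ rootSpace H α) (h : H) :
    ⁅(h : L), x⁆ = α h • x :=
  lie_eq_smul_of_mem_rootSpace hx h

lemma mem_rootSpace_of_forall_lie {α : Dual K H} {x : L} (hx : ∀ h : H, ⁅(h : L), x⁆ = α h • x) :
    x ∈ rootSpace H α :=
  LieModule.weightSpace_le_genWeightSpace L _ ((LieModule.mem_weightSpace _ _).2 hx)

/-- A subalgebra which contains the root spaces of `β` and `γ`, where `⟨γ, β^∨⟩ ≤ 0`, contains that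
of the reflection of `γ` along `β`. -/
lemma rootSpace_reflectionPerm_le (k : LieSubalgebra K L) {i j : H.root}
    (hi : ∀ x ∈ rootSpace H ((rootSystem H).root i), x ∈ k)
    (hj : ∀ x ∈ rootSpace H ((rootSystem H).root j), x ∈ k)
    (hneg : (rootSystem H).pairingIn ℤ j i ≤ 0) :
    ∀ x ∈ rootSpace H ((rootSystem H).root ((rootSystem H).reflectionPerm i j)), x ∈ k := by
  have hi0 := isNonZero_of_mem_root i
  -- Take x at the top of the β-chain through γ and descend by f. In this string of length l, γ
  -- stands at position m and its reflection at position l - m. Since ⟨γ, β^∨⟩ = l - 2m ≤ 0, the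
  -- reflection is reached from γ by raising with e ∈ 𝔤_β, with nonzero coefficients.
  obtain ⟨x, hx, x_ne0⟩ := (chainTop i.1 j.1).exists_ne_zero
  obtain ⟨h, e, f, isSl2, he, hf⟩ := exists_isSl2Triple_of_weight_isNonZero hi0
  obtain rfl := isSl2.h_eq_coroot hi0 he hf
  have prim : isSl2.HasPrimitiveVectorWith x (chainLength i.1 j.1 : K) :=
    have := lie_mem_genWeightSpace_of_mem_genWeightSpace he hx
    ⟨x_ne0, (chainLength_smul _ _ hx).symm, by rwa [genWeightSpace_add_chainTop _ _ hi0] at this⟩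
  set l := chainLength i.1 j.1 with hl
  set m := chainTopCoeff i.1 j.1 with hm
  have hml : m ≤ l := chainTopCoeff_le_chainLength _ _
  set ψ : ℕ → L := fun n ↦ ((toEnd K L L f) ^ n) x with hψ
  have hψ0 {n : ℕ} (hn : n ≤ l) : ψ n ≠ 0 := prim.pow_toEnd_f_ne_zero_of_eq_nat rfl hn
  have hpair : (rootSystem H).pairingIn ℤ j i = l - 2 * m := by
    have h1 := apply_coroot_eq_cast' i.1 j.1
    have h2 := (rootSystem H).algebraMap_pairingIn ℤ j i
    rw [rootSystem_pairing_apply, h1] at h2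
    exact FaithfulSMul.algebraMap_injective ℤ K h2
  have hψmem (n : ℕ) : ψ n ∈ rootSpace H (n • (-(i.1 : H → K)) + chainTop i.1 j.1) :=
    toEnd_pow_apply_mem hf hx n
  have key (r : ℕ) (hr : r ≤ m) : ψ (m - r) ∈ k := by
    induction r with
    | zero =>
      refine hj _ ?_
      have := hψmem m
      rw [coe_chainTop, ← hm] at this
      simpa using this
    | succ r ih =>
      obtain ⟨s, hs⟩ : ∃ s, m - r = s + 1 := ⟨m - r - 1, by lia⟩
      have h1 := ih (by lia)
      rw [hs] at h1
      have h2 := k.lie_mem (hi e he) h1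
      rw [show ⁅e, ψ (s + 1)⁆ = _ from prim.lie_e_pow_succ_toEnd_f s] at h2
      have h3 : ((s : K) + 1) * (l - s) ≠ 0 := by
        have h4 : ((s + 1 : ℕ) : K) ≠ 0 := by exact_mod_cast s.succ_ne_zero
        have h5 : ((l - s : ℕ) : K) ≠ 0 := by exact_mod_cast (by lia : l - s ≠ 0)
        rw [Nat.cast_sub (by lia)] at h5
        exact mul_ne_zero (by simpa using h4) h5
      rw [show m - (r + 1) = s by lia]
      have h4 := k.smul_mem (((s : K) + 1) * (l - s))⁻¹ h2
      rwa [smul_smul, inv_mul_cancel₀ h3, one_smul] at h4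
  have hlm : (l : ℤ) - m ≤ m := by lia
  have h1 := key (m - (l - m)) (by lia)
  rw [show m - (m - (l - m)) = l - m by lia] at h1
  refine (isRoot_root _).rootSpace_le_of_ne_zero ?_ (hψ0 (by lia : l - m ≤ l)) h1
  have h2 := hψmem (l - m)
  convert h2 using 2
  ext y
  have h3 : (rootSystem H).pairing j i = l - 2 * m := by
    rw [← (rootSystem H).algebraMap_pairingIn ℤ, hpair]
    simp
  rw [RootPairing.root_reflectionPerm, RootPairing.reflection_apply_root, h3]
  rw [coe_chainTop, ← hm]
  simp [Nat.cast_sub hml]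
  ring

/-- A subalgebra which contains the root spaces of `β`, `-β` and `γ` contains that of the
reflection of `γ` along `β`. -/
lemma rootSpace_reflectionPerm_le_of_neg (k : LieSubalgebra K L) {i j : H.root}
    (hi : ∀ x ∈ rootSpace H ((rootSystem H).root i), x ∈ k)
    (hi' : ∀ x ∈ rootSpace H (-(rootSystem H).root i), x ∈ k)
    (hj : ∀ x ∈ rootSpace H ((rootSystem H).root j), x ∈ k) :
    ∀ x ∈ rootSpace H ((rootSystem H).root ((rootSystem H).reflectionPerm i j)), x ∈ k := by
  rcases le_total ((rootSystem H).pairingIn ℤ j i) 0 with h | h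
  · exact rootSpace_reflectionPerm_le k hi hj h
  · have := rootSpace_reflectionPerm_le k (i := (rootSystem H).reflectionPerm i i) (j := j)
      (by rwa [root_neg]) hj (by simpa using h)
    have hr : (rootSystem H).reflectionPerm ((rootSystem H).reflectionPerm i i) j =
        (rootSystem H).reflectionPerm i j := by
      apply (rootSystem H).root.injective
      rw [RootPairing.root_reflectionPerm, RootPairing.root_reflectionPerm,
        RootPairing.reflection_reflectionPerm]
      simp
    rwa [hr] at this

end CartanPair

/-! ### Borel subalgebras and bases -/

/-- A solvable Lie algebra contains no `sl₂`-triple. -/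
lemma LieAlgebra.not_isSolvable_of_isSl2Triple {K L : Type*} [Field K] [CharZero K] [LieRing L]
    [LieAlgebra K L] {h e f : L} (t : IsSl2Triple h e f) : ¬ LieAlgebra.IsSolvable L := by
  intro hs
  have key (k : ℕ) : h ∈ derivedSeries K L k ∧ e ∈ derivedSeries K L k ∧
      f ∈ derivedSeries K L k := by
    induction k with
    | zero => simp
    | succ k ih =>
      obtain ⟨h1, h2, h3⟩ := ih
      rw [derivedSeries_def, derivedSeriesOfIdeal_succ]
      refine ⟨?_, ?_, ?_⟩
      · rw [← t.lie_e_f]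
        exact LieSubmodule.lie_mem_lie h2 h3
      · have := LieSubmodule.lie_mem_lie h1 h2
        rw [t.lie_h_e_smul K] at this
        simpa using Submodule.smul_mem _ (2 : K)⁻¹ this
      · have := LieSubmodule.lie_mem_lie h1 h3
        rw [t.lie_lie_smul_f K] at this
        simpa using Submodule.smul_mem _ (-(2 : K)⁻¹) this
  obtain ⟨k, hk⟩ := LieAlgebra.IsSolvable.solvable K L
  have := (key k).1
  rw [hk] at this
  exact t.h_ne_zero (by simpa using this)

namespace CartanPair

open LieAlgebra LieAlgebra.IsKilling LieModule Module

variable {K L : Type*} [Field K] [CharZero K] [IsAlgClosed K] [LieRing L] [LieAlgebra K L]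
  [FiniteDimensional K L] [LieAlgebra.IsKilling K L]
variable {H : LieSubalgebra K L} [H.IsCartanSubalgebra]

/-- The sum of the root spaces `𝔤_χ` (including `χ = 0`) with `f χ ≥ c`. -/
def heightFiltration (H : LieSubalgebra K L) [H.IsCartanSubalgebra] (f : Dual K H →+ ℚ) (c : ℚ) :
    Submodule K L :=
  ⨆ χ : {χ : Weight K H L // c ≤ f χ.toLinear}, (rootSpace H χ.1).toSubmodule

lemma mem_heightFiltration {f : Dual K H →+ ℚ} {c : ℚ} (α : Dual K H) (hα : c ≤ f α)
    {x : L} (hx : x ∈ rootSpace H α) : x ∈ heightFiltration H f c := by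
  by_cases h : rootSpace H α = ⊥
  · rw [h, LieSubmodule.mem_bot] at hx
    rw [hx]
    exact zero_mem _
  · have : (Weight.toLinear K H L ⟨α, h⟩) = α := by ext; rfl
    exact Submodule.mem_iSup_of_mem (p := fun χ : {χ : Weight K H L // c ≤ f χ.toLinear} ↦
      (rootSpace H χ.1).toSubmodule) ⟨⟨α, h⟩, by rwa [this]⟩ hx

lemma lie_mem_of_mem_heightFiltration {f : Dual K H →+ ℚ} {V : Submodule K L} {a b : ℚ}
    (hV : ∀ χ ψ : Weight K H L, a ≤ f χ.toLinear → b ≤ f ψ.toLinear → ∀ x ∈ rootSpace H χ,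
      ∀ y ∈ rootSpace H ψ, ⁅x, y⁆ ∈ V) {x y : L} (hx : x ∈ heightFiltration H f a)
    (hy : y ∈ heightFiltration H f b) : ⁅x, y⁆ ∈ V := by
  induction hx using Submodule.iSup_induction' with
  | zero => simp
  | add u v _ _ hu hv => rw [add_lie]; exact add_mem hu hv
  | mem χ u hu =>
    induction hy using Submodule.iSup_induction' with
    | zero => simp
    | add u v _ _ hu hv => rw [lie_add]; exact add_mem hu hv
    | mem ψ v hv => exact hV χ.1 ψ.1 χ.2 ψ.2 u hu v hv

lemma lie_mem_heightFiltration {f : Dual K H →+ ℚ} {a b : ℚ} {x y : L}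
    (hx : x ∈ heightFiltration H f a) (hy : y ∈ heightFiltration H f b) :
    ⁅x, y⁆ ∈ heightFiltration H f (a + b) := by
  refine lie_mem_of_mem_heightFiltration (fun χ ψ hχ hψ x hx y hy ↦ ?_) hx hy
  exact mem_heightFiltration (χ.toLinear + ψ.toLinear) (by rw [map_add]; exact add_le_add hχ hψ)
    (lie_mem_genWeightSpace_of_mem_genWeightSpace hx hy)

lemma toLinear_eq_zero_or (χ : Weight K H L) :
    χ.toLinear = 0 ∨ ∃ i, (rootSystem H).root i = χ.toLinear := by
  by_cases h : χ.toLinear = 0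
  · exact .inl h
  · exact .inr (isRoot_iff.1 ⟨h, χ.genWeightSpace_ne_bot⟩)

/-- The subalgebra spanned by the root spaces on which a function is nonnegative. -/
def nonnegSubalgebra (H : LieSubalgebra K L) [H.IsCartanSubalgebra] (f : Dual K H →+ ℚ) :
    LieSubalgebra K L where
  __ := heightFiltration H f 0
  lie_mem' hx hy := by simpa using lie_mem_heightFiltration hx hy

/-- Let ε be the least positive value of f on roots. A bracket of two elements of nonnegative height
has height at least ε, because the Cartan subalgebra is abelian; each further derived algebra gains
at least another ε, and only finitely many heights occur. -/
lemma isSolvable_nonnegSubalgebra {f : Dual K H →+ ℚ}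
    (hf : ∀ i, f ((rootSystem H).root i) ≠ 0) : IsSolvable (nonnegSubalgebra H f) := by
  obtain ⟨ε, hε, hfε⟩ : ∃ ε : ℚ, 0 < ε ∧ ∀ i, 0 < f ((rootSystem H).root i) →
      ε ≤ f ((rootSystem H).root i) := by
    rcases isEmpty_or_nonempty H.root with h | h
    · exact ⟨1, one_pos, fun i ↦ h.elim i⟩
    · obtain ⟨i, hi⟩ := Finite.exists_min fun i ↦ |f ((rootSystem H).root i)|
      exact ⟨_, abs_pos.2 (hf i), fun j hj ↦ (hi j).trans_eq (abs_of_pos hj)⟩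
  have hpos (χ : Weight K H L) (h : 0 ≤ f χ.toLinear) : χ.toLinear = 0 ∨ ε ≤ f χ.toLinear := by
    rcases toLinear_eq_zero_or χ with h' | ⟨i, hi⟩
    · exact .inl h'
    · rw [← hi] at h ⊢
      exact .inr (hfε i (lt_of_le_of_ne h (hf i).symm))
  have h1 {x y : L} (hx : x ∈ heightFiltration H f 0) (hy : y ∈ heightFiltration H f 0) :
      ⁅x, y⁆ ∈ heightFiltration H f ε := by
    refine lie_mem_of_mem_heightFiltration (fun χ ψ hχ hψ x hx y hy ↦ ?_) hx hy
    have hxy := lie_mem_genWeightSpace_of_mem_genWeightSpace hx hy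
    have hle (h : ε ≤ f χ.toLinear + f ψ.toLinear) : ⁅x, y⁆ ∈ heightFiltration H f ε :=
      mem_heightFiltration (χ.toLinear + ψ.toLinear) (by rwa [map_add]) hxy
    rcases hpos χ hχ with h | h
    · rcases hpos ψ hψ with h' | h'
      · have hx' : x ∈ rootSpace H ((0 : Dual K H)) := by rwa [← h]
        have hy' : y ∈ rootSpace H ((0 : Dual K H)) := by rwa [← h']
        have hx' : x ∈ H := by
          rw [← LieAlgebra.zeroRootSubalgebra_eq_of_is_cartan K L H]
          exact hx'
        have := lie_eq_smul hy' ⟨x, hx'⟩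
        simp only [LinearMap.zero_apply, zero_smul] at this
        rw [this]
        exact zero_mem _
      · exact hle (by linarith)
    · exact hle (by linarith)
  -- The bound for two factors is 2(k + 1)ε, of which only (k + 2)ε is needed.
  have hD (k : ℕ) : ∀ x : nonnegSubalgebra H f,
      x ∈ derivedSeries K (nonnegSubalgebra H f) (k + 1) →
      (x : L) ∈ heightFiltration H f ((k + 1) * ε) := by
    induction k with
    | zero =>
      intro x hx
      rw [derivedSeries_def, derivedSeriesOfIdeal_succ, ← LieSubmodule.mem_toSubmodule,
        LieSubmodule.lieIdeal_oper_eq_linear_span'] at hx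
      induction hx using Submodule.span_induction with
      | mem x hx =>
        obtain ⟨y, -, z, -, rfl⟩ := hx
        simpa using h1 y.2 z.2
      | zero => exact zero_mem _
      | add x y _ _ hx hy => exact add_mem hx hy
      | smul c x _ hx => exact Submodule.smul_mem _ c hx
    | succ k ih =>
      intro x hx
      rw [derivedSeries_def, derivedSeriesOfIdeal_succ, ← LieSubmodule.mem_toSubmodule,
        LieSubmodule.lieIdeal_oper_eq_linear_span'] at hx
      induction hx using Submodule.span_induction with
      | mem x hx =>
        obtain ⟨y, hy, z, hz, rfl⟩ := hx
        refine lie_mem_of_mem_heightFiltration (fun χ ψ hχ hψ x hx y hy ↦ ?_) (ih y hy) (ih z hz)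
        refine mem_heightFiltration (χ.toLinear + ψ.toLinear) ?_
          (lie_mem_genWeightSpace_of_mem_genWeightSpace hx hy)
        rw [map_add]
        have : 0 ≤ k * ε := by positivity
        push_cast
        linarith
      | zero => exact zero_mem _
      | add x y _ _ hx hy => exact add_mem hx hy
      | smul c x _ hx => exact Submodule.smul_mem _ c hx
  obtain ⟨m, hm⟩ : ∃ m : ℚ, 0 < m ∧ ∀ χ : Weight K H L, f χ.toLinear < m := by
    obtain ⟨m, hm⟩ := (Set.finite_range fun χ : Weight K H L ↦ f χ.toLinear).bddAbove
    exact ⟨max m 0 + 1, by positivity, fun χ ↦ lt_of_le_of_lt ((hm ⟨χ, rfl⟩).trans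
      (le_max_left _ _)) (lt_add_one _)⟩
  obtain ⟨k, hk⟩ := exists_nat_gt (m / ε)
  rw [div_lt_iff₀ hε] at hk
  refine (isSolvable_iff K _).2 ⟨k + 1, ?_⟩
  rw [LieSubmodule.eq_bot_iff]
  intro x hx
  have h2 := hD k x hx
  have h3 : heightFiltration H f ((k + 1) * ε) = ⊥ := by
    have : IsEmpty {χ : Weight K H L // (k + 1) * ε ≤ f χ.toLinear} :=
      ⟨fun χ ↦ by linarith [χ.2, hm.2 χ.1]⟩
    exact iSup_of_empty _
  rw [h3, Submodule.mem_bot] at h2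
  exact Subtype.ext h2

/-- Otherwise 𝔟 would contain an sl₂-triple and could not be solvable. -/
lemma not_mem_posRoots_neg {b : LieSubalgebra K L} (hb : IsSolvable b) {α : Dual K H}
    (hα : α ∈ posRoots H b) : -α ∉ posRoots H b := by
  intro hα'
  obtain ⟨c, e, f, -, t, he, hf⟩ := hα.1.exists_isSl2Triple
  have heb := hα.2 e he
  have hfb := hα'.2 f hf
  have hcb : (c : L) ∈ b := by
    rw [← t.lie_e_f]
    exact b.lie_mem heb hfb
  refine LieAlgebra.not_isSolvable_of_isSl2Triple (K := K) (L := b) (h := ⟨c, hcb⟩) (e := ⟨e, heb⟩)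
    (f := ⟨f, hfb⟩) ⟨fun h ↦ t.h_ne_zero (congrArg Subtype.val h), Subtype.ext t.lie_e_f,
      Subtype.ext t.lie_h_e_nsmul, Subtype.ext t.lie_h_f_nsmul⟩ hb

/-- A subalgebra containing the Cartan subalgebra is spanned by its weight components. -/
lemma mem_iSup_inf_rootSpace {b : LieSubalgebra K L} (hHb : H ≤ b) {x : L} (hx : x ∈ b) :
    x ∈ ⨆ χ : Weight K H L, b.toSubmodule ⊓ (rootSpace H χ).toSubmodule := by
  let N : LieSubmodule K H L :=
    { b.toSubmodule with
      lie_mem := fun {h y} hy ↦ b.lie_mem (hHb h.2) hy }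
  have h1 : x ∈ N := hx
  have h2 := eq_iSup_inf_genWeightSpace K H L N
  rw [h2, ← LieSubmodule.mem_toSubmodule, LieSubmodule.iSup_toSubmodule] at h1
  exact h1

/-- The positive roots and the simple roots of a Borel subalgebra are those of a base. -/
theorem IsBorel.exists_base {b : LieSubalgebra K L} (hb : IsBorel b) (hHb : H ≤ b) :
    ∃ Δ : (rootSystem H).Base, (∀ i, Δ.IsPos i ↔ (rootSystem H).root i ∈ posRoots H b) ∧
      ∀ i, i ∈ Δ.support ↔ (rootSystem H).root i ∈ simpleRoots H b := by
  have hsolv : IsSolvable b := hb.prop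
  -- The roots of 𝔟 satisfy the hypotheses because 𝔟 is solvable and closed under brackets.
  obtain ⟨f, hf0, hf⟩ := (rootSystem H).exists_addMonoidHom_pos_of_isClosed
    {i | (rootSystem H).root i ∈ posRoots H b}
    (fun i hi h ↦ not_mem_posRoots_neg hsolv hi (by rw [← root_neg]; exact h))
    (fun i hi j hj h ↦ ⟨isRoot_root _, rootSpace_reflectionPerm_le b hi.2 hj.2 h.le⟩)
  have hle : b ≤ nonnegSubalgebra H f := by
    intro x hx
    have h1 := mem_iSup_inf_rootSpace hHb hx
    refine (iSup_le fun χ ↦ ?_ : (⨆ χ : Weight K H L, b.toSubmodule ⊓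
      (rootSpace H χ).toSubmodule) ≤ heightFiltration H f 0) h1
    rintro y ⟨hyb, hy⟩
    rcases toLinear_eq_zero_or χ with h | ⟨i, hi⟩
    · exact mem_heightFiltration χ.toLinear (by simp [h]) hy
    · rcases eq_or_ne y 0 with rfl | hy0
      · exact zero_mem _
      · refine mem_heightFiltration χ.toLinear ?_ hy
        rw [← hi]
        refine (hf i ⟨isRoot_root i, ?_⟩).le
        refine (isRoot_root i).rootSpace_le_of_ne_zero (x := y) ?_ hy0 hyb
        rw [hi]
        exact hy
  -- Maximality of 𝔟 among solvable subalgebras enters here; it shows that every root with f > 0 is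
  -- a root of 𝔟.
  have hbeq : b = nonnegSubalgebra H f := hb.eq_of_le (isSolvable_nonnegSubalgebra hf0) hle
  have hmem (i) (hi : 0 < f ((rootSystem H).root i)) : (rootSystem H).root i ∈ posRoots H b := by
    refine ⟨isRoot_root i, fun x hx ↦ ?_⟩
    rw [hbeq]
    exact mem_heightFiltration _ hi.le hx
  have hpos (i) : 0 < f ((rootSystem H).root i) ↔ (rootSystem H).root i ∈ posRoots H b :=
    ⟨hmem i, hf i⟩
  obtain ⟨Δ, h1, h2⟩ := (rootSystem H).exists_base_of_addMonoidHom f hf0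
  refine ⟨Δ, fun i ↦ (h1 i).trans (hpos i), fun i ↦ (h2 i).trans ?_⟩
  rw [hpos]
  refine and_congr_right fun _ ↦ ⟨fun h β hβ γ hγ ↦ ?_, fun h j k hj hk ↦ ?_⟩
  · obtain ⟨j, rfl⟩ := isRoot_iff.1 hβ.1
    obtain ⟨k, rfl⟩ := isRoot_iff.1 hγ.1
    exact h j k ((hpos j).2 hβ) ((hpos k).2 hγ)
  · exact h _ ((hpos j).1 hj) _ ((hpos k).1 hk)

/-! ### The Weyl group -/

/-- The positive roots which are images under `w` of negative roots. -/
def inversions (H : LieSubalgebra K L) [H.IsCartanSubalgebra] (b : LieSubalgebra K L)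
    (w : Dual K H ≃ₗ[K] Dual K H) : Set (Dual K H) :=
  {γ | γ ∈ posRoots H b ∧ ∃ β, IsRoot H β ∧ β ∉ posRoots H b ∧ w β = γ}

lemma finite_inversions (b : LieSubalgebra K L) (w : Dual K H ≃ₗ[K] Dual K H) :
    (inversions H b w).Finite :=
  finite_setOf_isRoot.subset fun _ h ↦ h.1.1

lemma reflectionGroup_le_closure (S : Set (Dual K H)) :
    reflectionGroup H S ≤ Subgroup.closure (Set.range (rootSystem H).reflection) := by
  refine Subgroup.closure_mono ?_
  rintro s ⟨α, -, hs⟩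
  obtain ⟨i, rfl⟩ := isRoot_iff.1 hs.1
  exact ⟨i, (isReflectionAlong_iff.1 hs).symm⟩

lemma reflectionGroup_le_weylGroup (S : Set (Dual K H)) :
    reflectionGroup H S ≤ weylGroup H :=
  Subgroup.closure_mono fun _ ⟨α, _, hs⟩ ↦ ⟨α, hs.1, hs⟩

/-- Elements of a reflection group move an integral weight by integral combinations of roots. -/
lemma apply_sub_mem_closure {w : Dual K H ≃ₗ[K] Dual K H} (hw : w ∈ weylGroup H) {μ : Dual K H}
    (hμ : IsIntegral H μ) : w μ - μ ∈ AddSubgroup.closure {α | IsRoot H α} := by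
  have hroot (w : Dual K H ≃ₗ[K] Dual K H) (hw : w ∈ weylGroup H) (ν : Dual K H)
      (hν : ν ∈ AddSubgroup.closure {α | IsRoot H α}) :
      w ν ∈ AddSubgroup.closure {α | IsRoot H α} := by
    obtain ⟨σ, hσ⟩ := RootPairing.Base.exists_perm_of_mem_closure (rootSystem H)
      (reflectionGroup_le_closure _ hw)
    induction hν using AddSubgroup.closure_induction with
    | mem α hα =>
      obtain ⟨i, rfl⟩ := isRoot_iff.1 hα
      rw [← hσ]
      exact AddSubgroup.subset_closure (isRoot_root _)
    | zero => simp [zero_mem]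
    | add x y _ _ hx hy => rw [map_add]; exact add_mem hx hy
    | neg x _ hx => rw [map_neg]; exact neg_mem hx
  induction hw using Subgroup.closure_induction with
  | mem s hs =>
    obtain ⟨α, hα, -, c, hc, h⟩ := hs
    obtain ⟨k, hk⟩ := hμ α c hα hc
    rw [h, hk, sub_sub_cancel_left, Int.cast_smul_eq_zsmul K k α]
    exact neg_mem (AddSubgroup.zsmul_mem _ (AddSubgroup.subset_closure hα) k)
  | one => simp [zero_mem]
  | mul x y hx hy hxm hym =>
    have : (x * y) μ - μ = x (y μ - μ) + (x μ - μ) := by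
      rw [map_sub, LinearEquiv.mul_apply]; abel
    rw [this]
    exact add_mem (hroot x hx _ hym) hxm
  | inv x hx hxm =>
    have : x⁻¹ μ - μ = - x⁻¹ (x μ - μ) := by
      rw [map_sub, ← LinearEquiv.mul_apply, inv_mul_cancel, LinearEquiv.coe_one, id_eq]; abel
    rw [this]
    exact neg_mem (hroot _ (inv_mem hx) _ hxm)

section Borel

variable {b : LieSubalgebra K L}

lemma length_one : length H b 1 = 0 := by
  refine Nat.sInf_eq_zero.2 (.inl ⟨[], rfl, by simp, rfl⟩)

lemma mem_posRoots_or_neg (hb : IsBorel b) (hHb : H ≤ b) {α : Dual K H} (hα : IsRoot H α) :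
    α ∈ posRoots H b ∨ -α ∈ posRoots H b := by
  obtain ⟨Δ, h1, -⟩ := hb.exists_base hHb
  obtain ⟨i, rfl⟩ := isRoot_iff.1 hα
  rw [← root_neg, ← h1, ← h1, RootPairing.Base.isPos_reflectionPerm_self_iff]
  tauto

/-- Inversions in terms of a base. -/
lemma image_root_inversions {Δ : (rootSystem H).Base}
    (h1 : ∀ i, Δ.IsPos i ↔ (rootSystem H).root i ∈ posRoots H b) (w : Dual K H ≃ₗ[K] Dual K H) :
    (rootSystem H).root '' Δ.inversions w = inversions H b w := by
  ext γ
  constructor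
  · rintro ⟨i, ⟨hi, j, hj, hij⟩, rfl⟩
    exact ⟨(h1 i).1 hi, _, isRoot_root j, fun h ↦ hj ((h1 j).2 h), hij⟩
  · rintro ⟨hγ, β, hβ, hβ', h⟩
    obtain ⟨i, rfl⟩ := isRoot_iff.1 hγ.1
    obtain ⟨j, rfl⟩ := isRoot_iff.1 hβ
    exact ⟨i, ⟨(h1 i).2 hγ, j, fun h ↦ hβ' ((h1 j).1 h), h⟩, rfl⟩

lemma exists_list_of_forall_mem {Δ : (rootSystem H).Base}
    (h2 : ∀ i, i ∈ Δ.support ↔ (rootSystem H).root i ∈ simpleRoots H b)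
    {S : Set (Dual K H)} (hS : S ⊆ simpleRoots H b)
    (l : List (Dual K H ≃ₗ[K] Dual K H)) (hl : ∀ s ∈ l, ∃ α ∈ S, IsReflectionAlong H α s) :
    ∃ m : List H.root, m.length = l.length ∧
      (∀ i ∈ m, i ∈ Δ.support ∧ (rootSystem H).root i ∈ S) ∧
      (m.map (rootSystem H).reflection).prod = l.prod := by
  induction l with
  | nil => exact ⟨[], by simp⟩
  | cons s l ih =>
    obtain ⟨m, h, h', h''⟩ := ih fun s hs ↦ hl s (by simp [hs])
    obtain ⟨α, hα, hs⟩ := hl s (by simp)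
    obtain ⟨i, rfl⟩ := isRoot_iff.1 hs.1
    rw [isReflectionAlong_iff] at hs
    refine ⟨i :: m, by simp [h], ?_, by simp [h'', hs]⟩
    simp only [List.mem_cons, forall_eq_or_imp]
    exact ⟨⟨(h2 i).2 (hS hα), hα⟩, h'⟩

lemma ncard_inversions_le_length (hb : IsBorel b) (hHb : H ≤ b) {w : Dual K H ≃ₗ[K] Dual K H}
    (hw : w ∈ weylGroup H) : (inversions H b w).ncard ≤ length H b w := by
  obtain ⟨Δ, h1, h2⟩ := hb.exists_base hHb
  -- The set defining the length must be nonempty, as otherwise `sInf` would take its default value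
  -- 0 and the bound could fail.
  have hne : {k | ∃ l : List (Module.Dual K H ≃ₗ[K] Module.Dual K H), l.length = k ∧
    (∀ s ∈ l, ∃ α ∈ simpleRoots H b, IsReflectionAlong H α s) ∧ l.prod = w}.Nonempty := by
    obtain ⟨l, hl, rfl⟩ := Δ.exists_word (reflectionGroup_le_closure _ hw)
    refine ⟨_, l.map (rootSystem H).reflection, rfl, fun s hs ↦ ?_, rfl⟩
    obtain ⟨i, hi, rfl⟩ := List.mem_map.1 hs
    exact ⟨_, (h2 i).1 (hl i hi), isReflectionAlong_iff.2 rfl⟩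
  obtain ⟨l, hl, hl', rfl⟩ := Nat.sInf_mem hne
  obtain ⟨m, hm, hm', h⟩ := exists_list_of_forall_mem h2 subset_rfl l hl'
  rw [← image_root_inversions h1, Set.ncard_image_of_injective _ (rootSystem H).root.injective,
    ← h]
  refine (RootPairing.Base.ncard_inversions_le fun i hi ↦ (hm' i hi).1).trans ?_
  rw [h]
  exact (hm.trans hl).le

lemma apply_rho_sub (hb : IsBorel b) (hHb : H ≤ b) {w : Dual K H ≃ₗ[K] Dual K H}
    (hw : w ∈ weylGroup H) : w (rho H b) - rho H b = -∑ᶠ γ ∈ inversions H b w, γ := by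
  classical
  obtain ⟨Δ, h1, h2⟩ := hb.exists_base hHb
  have hrho : rho H b = (2 : K)⁻¹ • ∑ i with Δ.IsPos i, (rootSystem H).root i := by
    have : posRoots H b = (rootSystem H).root '' {i | Δ.IsPos i} := by
      ext α
      constructor
      · intro h
        obtain ⟨i, rfl⟩ := isRoot_iff.1 h.1
        exact ⟨i, (h1 i).2 h, rfl⟩
      · rintro ⟨i, hi, rfl⟩
        exact (h1 i).1 hi
    rw [rho, this, finsum_mem_image (rootSystem H).root.injective.injOn]
    congr 1
    rw [finsum_mem_eq_finite_toFinset_sum _ (Set.toFinite _)]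
    refine Finset.sum_congr ?_ fun _ _ ↦ rfl
    ext
    simp
  rw [hrho, RootPairing.Base.apply_half_sum_sub (reflectionGroup_le_closure _ hw),
    ← image_root_inversions h1, finsum_mem_image (rootSystem H).root.injective.injOn,
    finsum_mem_eq_finite_toFinset_sum _ (Set.toFinite _)]
  congr 1
  refine Finset.sum_congr ?_ fun _ _ ↦ rfl
  ext
  simp

lemma apply_eq_self_of_forall_inversions (hb : IsBorel b) (hHb : H ≤ b)
    {w : Dual K H ≃ₗ[K] Dual K H} (hw : w ∈ weylGroup H) {ν : Dual K H}
    (hν : ∀ γ ∈ inversions H b w, ∀ c, IsCoroot H γ c → ν c = 0) : w ν = ν := by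
  obtain ⟨Δ, h1, h2⟩ := hb.exists_base hHb
  obtain ⟨l, hl, rfl⟩ := Δ.exists_word (reflectionGroup_le_closure _ hw)
  refine RootPairing.Base.apply_eq_self_of_forall_inversions hl fun i hi ↦ ?_
  refine hν ((rootSystem H).root i) ?_ _ (isCoroot_iff.2 rfl)
  rw [← image_root_inversions h1]
  exact ⟨i, hi, rfl⟩

/-- The inversions of a product of simple reflections lie in any set of roots which contains
the simple roots in question and is stable under their reflections. -/
lemma inversions_subset_of_stable (hb : IsBorel b) (hHb : H ≤ b) {S C : Set (Dual K H)}
    (hS : S ⊆ simpleRoots H b) (hSC : S ⊆ C)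
    (hC : ∀ α ∈ S, ∀ s, IsReflectionAlong H α s → ∀ β ∈ C, IsRoot H β → s β ∈ C)
    {w : Dual K H ≃ₗ[K] Dual K H} (hw : w ∈ reflectionGroup H S) : inversions H b w ⊆ C := by
  obtain ⟨Δ, h1, h2⟩ := hb.exists_base hHb
  rw [reflectionGroup, ← Subgroup.mem_toSubmonoid, Subgroup.closure_toSubmonoid] at hw
  obtain ⟨l, hl, rfl⟩ := Submonoid.exists_list_of_mem_closure hw
  -- Reflections are involutions, so inverses of generators are again generators and every element
  -- of the group is a plain word.
  obtain ⟨m, -, hm', h⟩ := exists_list_of_forall_mem h2 hS l fun s hs ↦ by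
    rcases hl s hs with ⟨α, hα, h⟩ | ⟨α, hα, h⟩
    · exact ⟨α, hα, h⟩
    · refine ⟨α, hα, ?_⟩
      obtain ⟨i, rfl⟩ := isRoot_iff.1 h.1
      rw [isReflectionAlong_iff] at h ⊢
      rw [← inv_inv s, h, RootPairing.reflection_inv]
  rw [← image_root_inversions h1, ← h, Set.image_subset_iff]
  refine RootPairing.Base.inversions_subset_of_stable (fun i hi ↦ (hm' i hi).1)
    (fun i hi ↦ hSC (hm' i hi).2) fun i hi j hj ↦ ?_
  rw [Set.mem_preimage, RootPairing.root_reflectionPerm]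
  exact hC _ (hm' i hi).2 _ (isReflectionAlong_iff.2 rfl) _ hj (isRoot_root j)

end Borel

end CartanPair

/-! ### The natural representation of a classical Lie algebra -/

namespace Matrix

open _root_.Module

variable {K ι : Type*} [Field K] [Fintype ι] [DecidableEq ι]

lemma exists_dotProduct_of_notMem_span {a w : ι → K} (h : w ∉ Submodule.span K {a}) :
    ∃ b : ι → K, b ⬝ᵥ a = 0 ∧ b ⬝ᵥ w ≠ 0 := by
  obtain ⟨f, hf, hle⟩ := Submodule.exists_le_ker_of_notMem h
  obtain ⟨b, rfl⟩ := (dotProductEquiv K ι).surjective f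
  exact ⟨b, hle (Submodule.mem_span_singleton_self a), hf⟩

lemma exists_dotProduct_eq_one {y : ι → K} (hy : y ≠ 0) : ∃ a : ι → K, a ⬝ᵥ y = 1 := by
  obtain ⟨i, hi⟩ := Function.ne_iff.1 hy
  refine ⟨Pi.single i (y i)⁻¹, ?_⟩
  simpa using inv_mul_cancel₀ hi

/-- The rank one matrix a bᵀ is traceless when b ⊥ a. If w ∈ W is not a multiple of a, some such b
has b · w ≠ 0, and a bᵀ then carries w to a nonzero multiple of a. -/
lemma eq_bot_or_eq_top_of_forall_traceless {W : Submodule K (ι → K)}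
    (hW : ∀ x : Matrix ι ι K, x.trace = 0 → ∀ v ∈ W, x *ᵥ v ∈ W) : W = ⊥ ∨ W = ⊤ := by
  refine or_iff_not_imp_left.2 fun hbot ↦ ?_
  obtain ⟨w, hw, hw0⟩ := W.ne_bot_iff.1 hbot
  refine Submodule.eq_top_iff'.2 fun a ↦ ?_
  by_cases h : w ∈ Submodule.span K {a}
  · obtain ⟨c, rfl⟩ := Submodule.mem_span_singleton.1 h
    have hc : c ≠ 0 := by rintro rfl; simp at hw0
    simpa [smul_smul, inv_mul_cancel₀ hc] using W.smul_mem c⁻¹ hw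
  · obtain ⟨b, hba, hbw⟩ := exists_dotProduct_of_notMem_span h
    have := hW (vecMulVec a b) (by rw [trace_vecMulVec, dotProduct_comm, hba]) w hw
    rw [vecMulVec_mulVec] at this
    simpa [smul_smul, inv_mul_cancel₀ hbw] using W.smul_mem (b ⬝ᵥ w)⁻¹ this

variable [CharZero K]

/-- Taking z = a aᵀ yields a multiple of a, so W contains every a that is not orthogonal to Fw;
every other vector is a difference of two of these. -/
lemma eq_bot_or_eq_top_of_forall_symm {F : Matrix ι ι K} (hF : IsUnit F) {W : Submodule K (ι → K)}
    (hW : ∀ z : Matrix ι ι K, ∀ v ∈ W, (z + zᵀ) *ᵥ (F *ᵥ v) ∈ W) : W = ⊥ ∨ W = ⊤ := by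
  refine or_iff_not_imp_left.2 fun hbot ↦ ?_
  obtain ⟨w, hw, hw0⟩ := W.ne_bot_iff.1 hbot
  have hy : F *ᵥ w ≠ 0 := fun h ↦ hw0 (mulVec_injective_of_isUnit hF (by simpa using h))
  have key (a : ι → K) (ha : a ⬝ᵥ (F *ᵥ w) ≠ 0) : a ∈ W := by
    have := hW (vecMulVec a a) w hw
    rw [transpose_vecMulVec, ← two_smul K, smul_mulVec, vecMulVec_mulVec] at this
    have h2 := W.smul_mem (2 * (a ⬝ᵥ (F *ᵥ w)))⁻¹ this
    rw [smul_smul] at h2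
    simp only [op_smul_eq_smul, smul_smul] at h2
    rwa [show (2 * (a ⬝ᵥ (F *ᵥ w)))⁻¹ * 2 * (a ⬝ᵥ (F *ᵥ w)) = 1 by field_simp, one_smul] at h2
  obtain ⟨a₀, ha₀⟩ := exists_dotProduct_eq_one hy
  refine Submodule.eq_top_iff'.2 fun a ↦ ?_
  by_cases ha : a ⬝ᵥ (F *ᵥ w) = 0
  · have h1 := key (a + a₀) (by rw [add_dotProduct, ha, ha₀]; simp)
    have h2 := key a₀ (by rw [ha₀]; simp)
    simpa using W.sub_mem h1 h2
  · exact key a ha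

/-- Taking z = a a₀ᵀ with a ⊥ Fw and a₀ · Fw = 1 yields a, so W contains the hyperplane orthogonal
to Fw. In dimension at least 3 this hyperplane is not contained in the line of w, so W contains a
second hyperplane of this kind, and the two span. -/
lemma eq_bot_or_eq_top_of_forall_skew {F : Matrix ι ι K} (hF : IsUnit F)
    (hι : 3 ≤ Fintype.card ι) {W : Submodule K (ι → K)}
    (hW : ∀ z : Matrix ι ι K, ∀ v ∈ W, (z - zᵀ) *ᵥ (F *ᵥ v) ∈ W) : W = ⊥ ∨ W = ⊤ := by
  refine or_iff_not_imp_left.2 fun hbot ↦ ?_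
  have key {w : ι → K} (hw : w ∈ W) (hw0 : w ≠ 0) {a : ι → K} (ha : a ⬝ᵥ (F *ᵥ w) = 0) :
      a ∈ W := by
    have hy : F *ᵥ w ≠ 0 := fun h ↦ hw0 (mulVec_injective_of_isUnit hF (by simpa using h))
    obtain ⟨a₀, ha₀⟩ := exists_dotProduct_eq_one hy
    have := hW (vecMulVec a a₀) w hw
    rwa [transpose_vecMulVec, sub_mulVec, vecMulVec_mulVec, vecMulVec_mulVec, ha, ha₀,
      MulOpposite.op_one, one_smul, MulOpposite.op_zero, zero_smul, sub_zero] at this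
  obtain ⟨w, hw, hw0⟩ := W.ne_bot_iff.1 hbot
  obtain ⟨w', hw', hne⟩ : ∃ w' ∈ W, w' ∉ Submodule.span K {w} := by
    by_contra! h
    have h1 : LinearMap.ker (dotProductEquiv K ι (F *ᵥ w)) ≤ Submodule.span K {w} := by
      intro a ha
      refine h a (key hw hw0 ?_)
      rw [dotProduct_comm]
      simpa using ha
    have h2 := Submodule.finrank_mono h1
    have h3 := (dotProductEquiv K ι (F *ᵥ w)).finrank_range_add_finrank_ker
    have h4 := finrank_span_singleton (K := K) hw0
    have h5 := (LinearMap.range (dotProductEquiv K ι (F *ᵥ w))).finrank_le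
    simp only [finrank_fintype_fun_eq_card, finrank_self] at h3 h5
    lia
  have hw'0 : w' ≠ 0 := by rintro rfl; exact hne (zero_mem _)
  have hne' : F *ᵥ w' ∉ Submodule.span K {F *ᵥ w} := by
    intro h
    obtain ⟨c, hc⟩ := Submodule.mem_span_singleton.1 h
    rw [← mulVec_smul] at hc
    exact hne (Submodule.mem_span_singleton.2 ⟨c, mulVec_injective_of_isUnit hF hc⟩)
  obtain ⟨b, hb, hb'⟩ := exists_dotProduct_of_notMem_span hne'
  have hbW : b ∈ W := key hw hw0 hb
  refine Submodule.eq_top_iff'.2 fun a ↦ ?_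
  have := key hw' hw'0 (a := a - ((a ⬝ᵥ (F *ᵥ w')) / (b ⬝ᵥ (F *ᵥ w'))) • b) (by
    rw [sub_dotProduct, smul_dotProduct, smul_eq_mul, div_mul_cancel₀ _ hb', sub_self])
  simpa using W.add_mem this (W.smul_mem ((a ⬝ᵥ (F *ᵥ w')) / (b ⬝ᵥ (F *ᵥ w'))) hbW)

end Matrix

namespace ClassicalType

open Matrix _root_.Module

variable {K : Type*} [Field K] {X : ClassicalType} {r : ℕ}

lemma mem_lieAlg_A (hX : X = A) {x : Matrix (X.Idx r) (X.Idx r) K} :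
    x ∈ X.lieAlg K r ↔ x.trace = 0 := by
  subst hX
  exact LinearMap.mem_ker

lemma mem_lieAlg (hX : X ≠ A) {x : Matrix (X.Idx r) (X.Idx r) K} :
    x ∈ X.lieAlg K r ↔ xᵀ * X.form K r = -(X.form K r * x) := by
  have key {ι : Type} [Fintype ι] [DecidableEq ι] (F x : Matrix ι ι K) :
      x ∈ skewAdjointMatricesLieSubalgebra F ↔ xᵀ * F = -(F * x) := by
    rw [mem_skewAdjointMatricesLieSubalgebra, mem_skewAdjointMatricesSubmodule,
      Matrix.IsSkewAdjoint, Matrix.IsAdjointPair, Matrix.mul_neg]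
  cases X with
  | A => exact absurd rfl hX
  | B => exact key _ _
  | C => exact key _ _
  | D => exact key _ _

/-- The sign of the invariant form. -/
def sign (K : Type*) [Field K] : ClassicalType → K
  | C => -1
  | _ => 1

lemma sign_mul_self (X : ClassicalType) : X.sign K * X.sign K = 1 := by
  cases X <;> simp [sign]

lemma form_transpose (hX : X ≠ A) : (X.form K r)ᵀ = X.sign K • X.form K r := by
  cases X with
  | A => exact absurd rfl hX
  | B =>
    simp only [form, sign, one_smul, LieAlgebra.Orthogonal.JB, LieAlgebra.Orthogonal.JD]
    exact (fromBlocks_transpose _ _ _ _).trans (by simp [fromBlocks_transpose])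
  | C =>
    simp only [form, sign, Matrix.J]
    exact (fromBlocks_transpose _ _ _ _).trans (by simp [fromBlocks_neg])
  | D =>
    simp only [form, sign, one_smul, LieAlgebra.Orthogonal.JD]
    exact (fromBlocks_transpose _ _ _ _).trans (by simp)

lemma isUnit_form [CharZero K] (hX : X ≠ A) : IsUnit (X.form K r) := by
  have hD : (LieAlgebra.Orthogonal.JD (Fin r) K) * (LieAlgebra.Orthogonal.JD (Fin r) K) = 1 := by
    simp [LieAlgebra.Orthogonal.JD, fromBlocks_multiply]
  cases X with
  | A => exact absurd rfl hX
  | B =>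
    refine IsUnit.of_mul_eq_one (fromBlocks ((2 : K)⁻¹ • (1 : Matrix Unit Unit K)) 0 0
      (LieAlgebra.Orthogonal.JD (Fin r) K)) ?_
    refine (fromBlocks_multiply _ _ _ _ _ _ _ _).trans ?_
    rw [hD]
    simp only [smul_mul_assoc, Matrix.mul_smul, Matrix.mul_one, Matrix.mul_zero, add_zero,
      Matrix.zero_mul, zero_add, smul_smul]
    rw [mul_inv_cancel₀ two_ne_zero, one_smul, smul_zero]
    exact fromBlocks_one (l := Unit) (m := Fin r ⊕ Fin r) (α := K)
  | C =>
    refine (Matrix.isUnit_iff_isUnit_det _).2 ?_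
    exact Matrix.isUnit_det_J (Fin r) K
  | D => exact IsUnit.of_mul_eq_one (LieAlgebra.Orthogonal.JD (Fin r) K) hD

/-- The elements of an orthogonal or symplectic Lie algebra. -/
lemma mem_lieAlg_of_matrix (hX : X ≠ A) (z : Matrix (X.Idx r) (X.Idx r) K) :
    (z - X.sign K • zᵀ) * X.form K r ∈ X.lieAlg K r := by
  have h : (z - X.sign K • zᵀ)ᵀ = -(X.sign K • (z - X.sign K • zᵀ)) := by
    rw [smul_sub, smul_smul, sign_mul_self, one_smul, transpose_sub, transpose_smul,
      transpose_transpose, neg_sub]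
  rw [mem_lieAlg hX, transpose_mul, h, form_transpose hX]
  simp [smul_smul, sign_mul_self, mul_assoc]

variable [CharZero K]

lemma trace_eq_zero {x : Matrix (X.Idx r) (X.Idx r) K} (hx : x ∈ X.lieAlg K r) : x.trace = 0 := by
  by_cases hX : X = A
  · exact (mem_lieAlg_A hX).1 hx
  · rw [mem_lieAlg hX] at hx
    obtain ⟨u, hu⟩ := isUnit_form (K := K) (r := r) hX
    have h1 : xᵀ = -(u * x * (↑u⁻¹ : Matrix (X.Idx r) (X.Idx r) K)) := by
      rw [← hu] at hx
      rw [← neg_mul, ← hx, mul_assoc, Units.mul_inv, mul_one]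
    have h2 := congrArg Matrix.trace h1
    rw [trace_transpose, trace_neg, trace_mul_comm, ← mul_assoc, Units.inv_mul, one_mul] at h2
    exact self_eq_neg.1 h2

/-- Irreducibility of the natural representation. In the orthogonal types the bound on the rank
guarantees dimension at least 3. -/
lemma eq_bot_or_eq_top_of_invariant (hr : X.minRank ≤ r) {W : Submodule K (X.NatRep K r)}
    (hW : ∀ x ∈ X.lieAlg K r, ∀ v ∈ W, x *ᵥ v ∈ W) : W = ⊥ ∨ W = ⊤ := by
  by_cases hX : X = A
  · exact eq_bot_or_eq_top_of_forall_traceless fun x hx ↦ hW x ((mem_lieAlg_A hX).2 hx)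
  by_cases hC : X = C
  · refine eq_bot_or_eq_top_of_forall_symm (isUnit_form hX) fun z v hv ↦ ?_
    have := hW _ (mem_lieAlg_of_matrix hX z) v hv
    rw [← mulVec_mulVec] at this
    have hs : X.sign K = -1 := by subst hC; rfl
    simpa [hs] using this
  · refine eq_bot_or_eq_top_of_forall_skew (isUnit_form hX) ?_ fun z v hv ↦ ?_
    · cases X with
      | A => exact absurd rfl hX
      | B =>
        change 1 ≤ r at hr
        change 3 ≤ Fintype.card (Unit ⊕ (Fin r ⊕ Fin r))
        simp
        lia
      | C => exact absurd rfl hC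
      | D =>
        change 3 ≤ r at hr
        change 3 ≤ Fintype.card (Fin r ⊕ Fin r)
        simp
        lia
    · have := hW _ (mem_lieAlg_of_matrix hX z) v hv
      rw [← mulVec_mulVec] at this
      have hs : X.sign K = 1 := by cases X <;> first | rfl | exact absurd rfl hC
      simpa [hs] using this

lemma two_le_card (hr : X.minRank ≤ r) : 2 ≤ Fintype.card (X.Idx r) := by
  cases X with
  | A =>
    change 1 ≤ r at hr
    change 2 ≤ Fintype.card (Fin (r + 1))
    simp
    lia
  | B =>
    change 1 ≤ r at hr
    change 2 ≤ Fintype.card (Unit ⊕ (Fin r ⊕ Fin r))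
    simp
    lia
  | C =>
    change 1 ≤ r at hr
    change 2 ≤ Fintype.card (Fin r ⊕ Fin r)
    simp
    lia
  | D =>
    change 3 ≤ r at hr
    change 2 ≤ Fintype.card (Fin r ⊕ Fin r)
    simp
    lia

lemma nontrivial_natRep (hr : X.minRank ≤ r) : Nontrivial (X.NatRep K r) := by
  have : Nonempty (X.Idx r) := Fintype.card_pos_iff.1 (by have := two_le_card hr; lia)
  infer_instance

/-- The trace form is nondegenerate. -/
lemma eq_zero_of_forall_trace_mul (hr : X.minRank ≤ r) {x : Matrix (X.Idx r) (X.Idx r) K}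
    (hx : x ∈ X.lieAlg K r) (h : ∀ y ∈ X.lieAlg K r, (x * y).trace = 0) : x = 0 := by
  by_cases hX : X = A
  · refine ext_iff_trace_mul_right.2 fun z ↦ ?_
    have hn : (Fintype.card (X.Idx r) : K) ≠ 0 := by
      have := two_le_card hr
      exact_mod_cast (by lia : Fintype.card (X.Idx r) ≠ 0)
    have := h (z - (z.trace / Fintype.card (X.Idx r)) • 1) ((mem_lieAlg_A hX).2 (by
      rw [trace_sub, trace_smul, trace_one, smul_eq_mul, div_mul_cancel₀ _ hn, sub_self]))
    rw [mul_sub, trace_sub, Matrix.mul_smul, trace_smul, mul_one, trace_eq_zero hx, smul_zero,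
      sub_zero] at this
    simpa using this
  · have h1 : X.form K r * x = 0 := by
      refine ext_iff_trace_mul_right.2 fun z ↦ ?_
      -- By the skew-adjointness of x both halves of this test element contribute the same, and the
      -- trace is 2 tr(F x z).
      have h2 := h _ (mem_lieAlg_of_matrix hX z)
      have h3 : (x * (zᵀ * X.form K r)).trace = - X.sign K * (X.form K r * x * z).trace := by
        rw [← trace_transpose, transpose_mul, transpose_mul, transpose_transpose,
          form_transpose hX, smul_mul_assoc, smul_mul_assoc, trace_smul, mul_assoc,
          trace_mul_comm, mul_assoc, (mem_lieAlg hX).1 hx, mul_neg, trace_neg, trace_mul_comm]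
        simp
      have h4 : (x * (z * X.form K r)).trace = (X.form K r * x * z).trace := by
        rw [← mul_assoc, trace_mul_comm, mul_assoc]
      rw [sub_mul, mul_sub, trace_sub, smul_mul_assoc, Matrix.mul_smul, trace_smul, h3, h4,
        smul_eq_mul, ← mul_assoc, mul_neg, sign_mul_self, neg_mul, one_mul, sub_neg_eq_add,
        ← two_mul] at h2
      simpa using (mul_eq_zero.1 h2).resolve_left two_ne_zero
    obtain ⟨u, hu⟩ := isUnit_form (K := K) (r := r) hX
    rw [← hu] at h1
    simpa using congrArg (fun y ↦ (↑u⁻¹ : Matrix (X.Idx r) (X.Idx r) K) * y) h1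

variable [IsAlgClosed K]

/-- Schur's lemma. -/
lemma exists_eq_smul_one_of_commute (hr : X.minRank ≤ r) {M : Matrix (X.Idx r) (X.Idx r) K}
    (hM : ∀ x ∈ X.lieAlg K r, M * x = x * M) : ∃ c : K, M = c • 1 := by
  have := nontrivial_natRep (K := K) hr
  obtain ⟨c, hc⟩ := Module.End.exists_eigenvalue (Matrix.toLin' M)
  refine ⟨c, ?_⟩
  rcases eq_bot_or_eq_top_of_invariant hr (W := Module.End.eigenspace (Matrix.toLin' M) c)
    (fun x hx v hv ↦ by
      rw [Module.End.mem_eigenspace_iff, toLin'_apply] at hv ⊢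
      rw [mulVec_mulVec, hM x hx, ← mulVec_mulVec, hv, mulVec_smul]) with h | h
  · exact absurd h hc
  · apply Matrix.toLin'.injective
    ext1 i
    ext1
    have := Submodule.eq_top_iff'.1 h (Pi.single i 1)
    rw [Module.End.mem_eigenspace_iff] at this
    simpa using this

/-- A Lie algebra with a faithful irreducible representation by traceless endomorphisms has trivial
radical; in characteristic 0 the Killing form is then nondegenerate. -/
theorem isKilling (hr : X.minRank ≤ r) : LieAlgebra.IsKilling K (X.lieAlg K r) := by
  have := nontrivial_natRep (K := K) hr
  have : LieModule.IsIrreducible K (X.lieAlg K r) (X.NatRep K r) := by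
    refine LieModule.IsIrreducible.mk fun N hN ↦ ?_
    rw [ne_eq, ← LieSubmodule.toSubmodule_inj] at hN
    rw [← LieSubmodule.toSubmodule_inj]
    refine (eq_bot_or_eq_top_of_invariant hr (W := N.toSubmodule) fun x hx v hv ↦ ?_).resolve_left
      (by simpa using hN)
    exact N.lie_mem (x := ⟨x, hx⟩) hv
  have := LieAlgebra.hasTrivialRadical_of_isIrreducible_of_isFaithful K (X.lieAlg K r)
    (X.NatRep K r) fun x ↦ by
      have h : LieModule.toEnd K (X.lieAlg K r) (X.NatRep K r) x = Matrix.toLin' x.1 := by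
        ext1 i
        ext1
        rfl
      rw [h, Matrix.trace_toLin'_eq]
      exact trace_eq_zero x.2
  infer_instance

end ClassicalType

/-! ### Cartan subalgebras of classical Lie algebras -/

lemma Matrix.aeval_mulVec_of_eigenvector {K ι : Type*} [Field K] [Fintype ι] [DecidableEq ι]
    {M : Matrix ι ι K} {v : ι → K} {t : K} (h : M *ᵥ v = t • v) (a : Polynomial K) :
    Polynomial.aeval M a *ᵥ v = a.eval t • v := by
  induction a using Polynomial.induction_on' with
  | add p q hp hq => rw [map_add, add_mulVec, hp, hq, Polynomial.eval_add, add_smul]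
  | monomial n c =>
    rw [Polynomial.aeval_monomial, Polynomial.eval_monomial, ← Algebra.smul_def, smul_mulVec,
      mul_smul]
    congr 1
    induction n with
    | zero => simp
    | succ n ih => rw [pow_succ, ← mulVec_mulVec, h, mulVec_smul, ih, smul_smul, pow_succ']

namespace ClassicalType

open Matrix _root_.Module LieAlgebra CartanPair

variable {K : Type*} [Field K] [CharZero K] [IsAlgClosed K] {X : ClassicalType} {r : ℕ}
  {H : LieSubalgebra K (X.lieAlg K r)}

/-- The weight spaces of the natural representation. -/
def weightSubspace (H : LieSubalgebra K (X.lieAlg K r)) (χ : Dual K H) :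
    Submodule K (X.NatRep K r) where
  carrier := {v | ∀ h : H, h.1.1 *ᵥ v = χ h • v}
  add_mem' hv hw h := by rw [mulVec_add, hv h, hw h, smul_add]
  zero_mem' h := by simp
  smul_mem' c v hv h := by rw [mulVec_smul, hv h, smul_comm]

variable [H.IsCartanSubalgebra]

lemma rootSpace_induction {p : X.lieAlg K r → Prop} (hr : X.minRank ≤ r)
    (hmem : ∀ β : Dual K H, ∀ y ∈ rootSpace H β, p y) (h0 : p 0)
    (hadd : ∀ x y, p x → p y → p (x + y)) (x : X.lieAlg K r) : p x := by
  have := isKilling (K := K) hr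
  have h1 : x ∈ (⊤ : LieSubmodule K H (X.lieAlg K r)) := LieSubmodule.mem_top x
  rw [← LieModule.iSup_genWeightSpace_eq_top' K H (X.lieAlg K r), ← LieSubmodule.mem_toSubmodule,
    LieSubmodule.iSup_toSubmodule] at h1
  induction h1 using Submodule.iSup_induction' with
  | mem χ y hy => exact hmem χ.toLinear y hy
  | zero => exact h0
  | add x y _ _ hx hy => exact hadd x y hx hy

lemma mulVec_mem_weightSubspace (hr : X.minRank ≤ r) {α χ : Dual K H} {x : X.lieAlg K r}
    (hx : x ∈ rootSpace H α) {v : X.NatRep K r} (hv : v ∈ weightSubspace H χ) :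
    x.1 *ᵥ v ∈ weightSubspace H (α + χ) := by
  have := isKilling (K := K) hr
  intro h
  have h1 := congrArg Subtype.val (lie_eq_smul hx h)
  have h2 : h.1.1 * x.1 = x.1 * h.1.1 + α h • x.1 := by
    rw [← sub_eq_iff_eq_add']
    exact h1
  rw [mulVec_mulVec, h2, add_mulVec, ← mulVec_mulVec, hv h, mulVec_smul, smul_mulVec,
    LinearMap.add_apply, add_smul, add_comm]

/-- The Cartan subalgebra acts diagonalizably: root vectors shift weights, so the sum of the weight
spaces is a submodule; it is nonzero by Lie's theorem, and the representation is irreducible. -/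
lemma iSup_weightSubspace (hr : X.minRank ≤ r) : ⨆ χ, weightSubspace H χ = ⊤ := by
  have := isKilling (K := K) hr
  have := nontrivial_natRep (K := K) hr
  refine (eq_bot_or_eq_top_of_invariant hr fun x hx v hv ↦ ?_).resolve_left ?_
  · refine rootSpace_induction (H := H) hr (p := fun x ↦ x.1 *ᵥ v ∈ ⨆ χ, weightSubspace H χ)
      (fun β y hy ↦ ?_) (by simp) (fun x y hx hy ↦ ?_) ⟨x, hx⟩
    · induction hv using Submodule.iSup_induction' with
      | mem χ v hv => exact Submodule.mem_iSup_of_mem _ (mulVec_mem_weightSubspace hr hy hv)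
      | zero => simp
      | add v w _ _ hv hw => rw [mulVec_add]; exact add_mem hv hw
    · change (x.1 + y.1) *ᵥ v ∈ _
      rw [add_mulVec]
      exact add_mem hx hy
  · obtain ⟨χ, hχ⟩ := LieModule.exists_nontrivial_weightSpace_of_isSolvable K H (X.NatRep K r)
    obtain ⟨⟨v, hv⟩, hv0⟩ := exists_ne (0 : LieModule.weightSpace (X.NatRep K r) χ)
    intro h
    have h1 : v ∈ ⨆ χ, weightSubspace H χ :=
      Submodule.mem_iSup_of_mem χ ((LieModule.mem_weightSpace _ _).1 hv)
    rw [h, Submodule.mem_bot] at h1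
    exact hv0 (Subtype.ext h1)

lemma finite_setOf_weightSubspace_ne_bot (hr : X.minRank ≤ r) :
    {χ : Dual K H | weightSubspace H χ ≠ ⊥}.Finite := by
  have := isKilling (K := K) hr
  refine Set.Finite.of_finite_image ((LieModule.finite_genWeightSpace_ne_bot K H
    (X.NatRep K r)).subset ?_) (f := fun χ : Dual K H ↦ (χ : H → K)) DFunLike.coe_injective.injOn
  rintro - ⟨χ, hχ, rfl⟩
  obtain ⟨v, hv, hv0⟩ := (Submodule.ne_bot_iff _).1 hχ
  intro h
  have h1 : v ∈ LieModule.genWeightSpace (X.NatRep K r) χ :=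
    LieModule.weightSpace_le_genWeightSpace _ _ ((LieModule.mem_weightSpace _ _).2 hv)
  rw [h] at h1
  exact hv0 (by simpa using h1)

lemma matrix_eq_of_forall_weightSubspace (hr : X.minRank ≤ r)
    {m : Type*} {M N : Matrix m (X.Idx r) K}
    (h : ∀ χ, ∀ v ∈ weightSubspace H χ, M *ᵥ v = N *ᵥ v) : M = N := by
  refine Matrix.ext_iff_mulVec.2 fun v ↦ ?_
  have hv : v ∈ ⨆ χ, weightSubspace H χ := by rw [iSup_weightSubspace hr]; trivial
  induction hv using Submodule.iSup_induction' with
  | mem χ v hv => exact h χ v hv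
  | zero => simp
  | add v w _ _ hv hw => rw [mulVec_add, hv, hw, mulVec_add]

lemma cartan_mul_comm (hr : X.minRank ≤ r) (h h' : H) : h.1.1 * h'.1.1 = h'.1.1 * h.1.1 := by
  refine matrix_eq_of_forall_weightSubspace (H := H) hr fun χ v hv ↦ ?_
  rw [← mulVec_mulVec, ← mulVec_mulVec, hv h', hv h, mulVec_smul, mulVec_smul, hv h, hv h',
    smul_comm]

/-- An element of the Lie algebra which commutes with the Cartan subalgebra belongs to it. -/
lemma mem_cartan_of_commute {x : X.lieAlg K r} (hx : ∀ h : H, h.1.1 * x.1 = x.1 * h.1.1) :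
    x ∈ H := by
  rw [← LieSubalgebra.IsCartanSubalgebra.self_normalizing (H := H),
    LieSubalgebra.mem_normalizer_iff]
  intro y hy
  have : ⁅x, y⁆ = 0 := Subtype.ext (by
    change x.1 * y.1 - y.1 * x.1 = 0
    rw [hx ⟨y, hy⟩, sub_self])
  rw [this]
  exact zero_mem _

/-- Choose h₀ on which no nonzero weight vanishes and a polynomial a with a(t) = t⁻¹ at the
eigenvalues of h₀; then h₀ · a(h₀) is the projection. The factorization through h₀ on either side
lets properties of elements of 𝔥 pass to the projection. -/
lemma exists_projection (hr : X.minRank ≤ r) (H : LieSubalgebra K (X.lieAlg K r))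
    [H.IsCartanSubalgebra] : ∃ (h₀ : H) (q : Matrix (X.Idx r) (X.Idx r) K),
    h₀.1.1 * q = q * h₀.1.1 ∧ (∀ χ ≠ 0, ∀ v ∈ weightSubspace H χ, (h₀.1.1 * q) *ᵥ v = v) ∧
      ∀ v ∈ weightSubspace H 0, (h₀.1.1 * q) *ᵥ v = 0 := by
  classical
  have hfin := finite_setOf_weightSubspace_ne_bot (H := H) hr
  have : Finite {χ : Dual K H // weightSubspace H χ ≠ ⊥ ∧ χ ≠ 0} :=
    (hfin.subset fun χ hχ ↦ hχ.1 : {χ : Dual K H | weightSubspace H χ ≠ ⊥ ∧ χ ≠ 0}.Finite)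
  obtain ⟨h₀, hh₀⟩ := Module.Dual.exists_forall_ne_zero_of_forall_exists
    (fun χ : {χ : Dual K H // weightSubspace H χ ≠ ⊥ ∧ χ ≠ 0} ↦ χ.1) fun χ ↦ by
      by_contra! h
      exact χ.2.2 (LinearMap.ext h)
  set s : Finset K := hfin.toFinset.image (fun χ ↦ χ h₀)
  set a : Polynomial K := Lagrange.interpolate s id (fun t ↦ t⁻¹)
  have ha {χ : Dual K H} {v : X.NatRep K r} (hv : v ∈ weightSubspace H χ) :
      (h₀.1.1 * Polynomial.aeval h₀.1.1 a) *ᵥ v = ((χ h₀)⁻¹ * χ h₀) • v := by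
    rcases eq_or_ne v 0 with rfl | hv0
    · simp
    have hs : χ h₀ ∈ s := Finset.mem_image_of_mem (fun χ : Dual K H ↦ χ h₀)
      (hfin.mem_toFinset.2 ((Submodule.ne_bot_iff _).2 ⟨v, hv, hv0⟩))
    rw [← mulVec_mulVec, aeval_mulVec_of_eigenvector (hv h₀), mulVec_smul, hv h₀, smul_smul]
    congr 2
    exact Lagrange.eval_interpolate_at_node (v := id) _ Function.injective_id.injOn hs
  refine ⟨h₀, Polynomial.aeval h₀.1.1 a, ?_, fun χ hχ v hv ↦ ?_, fun v hv ↦ ?_⟩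
  · have := (Commute.all Polynomial.X a).map (Polynomial.aeval h₀.1.1)
    rw [Polynomial.aeval_X] at this
    exact this.eq
  · rcases eq_or_ne v 0 with rfl | hv0
    · simp
    · rw [ha hv, inv_mul_cancel₀ (hh₀ ⟨χ, (Submodule.ne_bot_iff _).2 ⟨v, hv, hv0⟩, hχ⟩), one_smul]
  · rw [ha hv]
    simp

/-- The projection of the natural representation onto the sum of its nonzero weight spaces along
the zero weight space. -/
noncomputable def cartanProj (hr : X.minRank ≤ r) (H : LieSubalgebra K (X.lieAlg K r))
    [H.IsCartanSubalgebra] : Matrix (X.Idx r) (X.Idx r) K :=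
  (exists_projection hr H).choose.1.1 * (exists_projection hr H).choose_spec.choose

section cartanProj

variable (hr : X.minRank ≤ r)
include hr

lemma exists_cartanProj_eq : ∃ (h₀ : H) (q : Matrix (X.Idx r) (X.Idx r) K),
    cartanProj hr H = h₀.1.1 * q ∧ cartanProj hr H = q * h₀.1.1 :=
  ⟨_, _, rfl, (exists_projection hr H).choose_spec.choose_spec.1⟩

lemma cartanProj_mulVec_of_ne {χ : Dual K H} (hχ : χ ≠ 0) {v : X.NatRep K r}
    (hv : v ∈ weightSubspace H χ) : cartanProj hr H *ᵥ v = v :=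
  (exists_projection hr H).choose_spec.choose_spec.2.1 χ hχ v hv

lemma cartanProj_mulVec_zero {v : X.NatRep K r} (hv : v ∈ weightSubspace H 0) :
    cartanProj hr H *ᵥ v = 0 :=
  (exists_projection hr H).choose_spec.choose_spec.2.2 v hv

lemma mul_cartanProj_comm {M : Matrix (X.Idx r) (X.Idx r) K}
    (hM : ∀ h : H, M * h.1.1 = h.1.1 * M) :
    M * cartanProj hr H = cartanProj hr H * M := by
  have hMW {χ : Dual K H} {v : X.NatRep K r} (hv : v ∈ weightSubspace H χ) :
      M *ᵥ v ∈ weightSubspace H χ := fun h ↦ by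
    rw [mulVec_mulVec, ← hM h, ← mulVec_mulVec, hv h, mulVec_smul]
  refine matrix_eq_of_forall_weightSubspace (H := H) hr fun χ v hv ↦ ?_
  rw [← mulVec_mulVec, ← mulVec_mulVec]
  rcases eq_or_ne χ 0 with rfl | hχ
  · rw [cartanProj_mulVec_zero hr hv, cartanProj_mulVec_zero hr (hMW hv), mulVec_zero]
  · rw [cartanProj_mulVec_of_ne hr hχ hv, cartanProj_mulVec_of_ne hr hχ (hMW hv)]

lemma mul_cartanProj (h : H) : h.1.1 * cartanProj hr H = h.1.1 := by
  refine matrix_eq_of_forall_weightSubspace (H := H) hr fun χ v hv ↦ ?_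
  rw [← mulVec_mulVec]
  rcases eq_or_ne χ 0 with rfl | hχ
  · rw [cartanProj_mulVec_zero hr hv, hv h]
    simp
  · rw [cartanProj_mulVec_of_ne hr hχ hv]

lemma cartanProj_mul (h : H) : cartanProj hr H * h.1.1 = h.1.1 := by
  rw [← mul_cartanProj_comm hr fun h' ↦ cartan_mul_comm hr h h', mul_cartanProj]

lemma cartanProj_mul_self : cartanProj hr H * cartanProj hr H = cartanProj hr H := by
  obtain ⟨h₀, q, h, -⟩ := exists_cartanProj_eq (H := H) hr
  conv_lhs =>
    enter [2]
    rw [h]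
  rw [← mul_assoc, cartanProj_mul, h]

lemma mem_weightSubspace_zero_iff {v : X.NatRep K r} :
    v ∈ weightSubspace H 0 ↔ cartanProj hr H *ᵥ v = 0 := by
  refine ⟨cartanProj_mulVec_zero hr, fun hv h ↦ ?_⟩
  rw [← mul_cartanProj hr h, ← mulVec_mulVec, hv]
  simp

lemma mulVec_sub_mem_weightSubspace_zero (v : X.NatRep K r) :
    (1 - cartanProj hr H) *ᵥ v ∈ weightSubspace H 0 := by
  rw [mem_weightSubspace_zero_iff hr, mulVec_mulVec, mul_sub, mul_one, cartanProj_mul_self,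
    sub_self, zero_mulVec]

/-- The projection p is self-adjoint. Writing p = h₀ q and using that h₀ is skew with h₀ p = h₀
gives pᵀ F p = pᵀ F; transposing, with F symmetric up to sign, gives pᵀ F p = F p. -/
lemma transpose_cartanProj_mul_form (hX : X ≠ A) :
    (cartanProj hr H)ᵀ * X.form K r = X.form K r * cartanProj hr H := by
  obtain ⟨h₀, q, h, -⟩ := exists_cartanProj_eq (H := H) hr
  set p := cartanProj hr H with hp
  have h1 : pᵀ * X.form K r * p = pᵀ * X.form K r := by
    conv_lhs => rw [h, transpose_mul, mul_assoc qᵀ, (mem_lieAlg hX).1 h₀.1.2]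
    conv_rhs => rw [h, transpose_mul, mul_assoc qᵀ, (mem_lieAlg hX).1 h₀.1.2]
    rw [mul_assoc, neg_mul, mul_assoc (X.form K r), ← h, mul_cartanProj hr h₀]
  have h2 := congrArg Matrix.transpose h1
  simp only [transpose_mul, transpose_transpose, form_transpose hX, smul_mul_assoc,
    Matrix.mul_smul, ← mul_assoc] at h2
  have h3 := smul_right_injective (M := Matrix (X.Idx r) (X.Idx r) K)
    (left_ne_zero_of_mul_eq_one (sign_mul_self (K := K) X)) h2
  rw [← h1, h3]

/-- If 𝔥 acted by zero, everything would commute with 𝔥 and hence lie in it, so the whole algebra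
would vanish; Schur's lemma would then make every matrix scalar. -/
lemma exists_cartan_ne_zero : ∃ h : H, h.1.1 ≠ 0 := by
  by_contra! h
  have h0 (x : X.lieAlg K r) : x.1 = 0 := by
    have : x ∈ H := mem_cartan_of_commute fun h' ↦ by rw [h h', zero_mul, mul_zero]
    exact h ⟨x, this⟩
  obtain ⟨i, j, hij⟩ := Fintype.exists_pair_of_one_lt_card (two_le_card hr)
  obtain ⟨c, hc⟩ := exists_eq_smul_one_of_commute (M := Matrix.single i j (1 : K)) hr
    fun x hx ↦ by rw [show x = 0 from h0 ⟨x, hx⟩, zero_mul, mul_zero]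
  have := congrFun (congrFun hc i) j
  simp [hij] at this

lemma cartanProj_ne_zero : cartanProj hr H ≠ 0 := by
  obtain ⟨h, hh⟩ := exists_cartan_ne_zero (H := H) hr
  intro h0
  rw [← mul_cartanProj hr h, h0, mul_zero] at hh
  exact hh rfl

/-- The traceless part p - c of the projection commutes with 𝔥, hence lies in 𝔥. On a zero weight
vector it acts by -c, so c = 0; an idempotent of trace 0 in characteristic 0 vanishes, which p does
not. -/
lemma weightSubspace_zero_eq_bot_A (hX : X = A) : weightSubspace H 0 = ⊥ := by
  by_contra hbot
  obtain ⟨v, hv, hv0⟩ := (Submodule.ne_bot_iff _).1 hbot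
  have hn : (Fintype.card (X.Idx r) : K) ≠ 0 := by
    have := two_le_card hr
    exact_mod_cast (by lia : Fintype.card (X.Idx r) ≠ 0)
  set p := cartanProj hr H with hp
  set c : K := p.trace / Fintype.card (X.Idx r)
  have hx : p - c • 1 ∈ X.lieAlg K r := (mem_lieAlg_A hX).2 (by
    rw [trace_sub, trace_smul, trace_one, smul_eq_mul, div_mul_cancel₀ _ hn, sub_self])
  have hxH : (⟨p - c • 1, hx⟩ : X.lieAlg K r) ∈ H := mem_cartan_of_commute fun h ↦ by
    rw [mul_sub, sub_mul, mul_cartanProj, cartanProj_mul]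
    simp
  have h1 := hv ⟨_, hxH⟩
  simp only [sub_mulVec, smul_mulVec, one_mulVec, LinearMap.zero_apply, zero_smul] at h1
  rw [cartanProj_mulVec_zero hr hv, zero_sub, neg_eq_zero, smul_eq_zero] at h1
  have hc : c = 0 := h1.resolve_right hv0
  have htr : p.trace = 0 := by
    rw [div_eq_zero_iff] at hc
    exact hc.resolve_right hn
  have hid : IsIdempotentElem (Matrix.toLin' p) := by
    rw [IsIdempotentElem, Module.End.mul_eq_comp, ← Matrix.toLin'_mul, cartanProj_mul_self]
  have h0 := (LinearMap.IsIdempotentElem.trace_eq_zero_iff hid).1 (by rwa [Matrix.trace_toLin'_eq])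
  exact cartanProj_ne_zero hr ((LinearEquiv.map_eq_zero_iff _).1 h0)

lemma matrix_mem_cartan (hX : X ≠ A) {z : Matrix (X.Idx r) (X.Idx r) K}
    (hz : ∀ h : H, h.1.1 * z = 0) (hz' : ∀ h : H, z * h.1.1ᵀ = 0) :
    (⟨_, mem_lieAlg_of_matrix hX z⟩ : X.lieAlg K r) ∈ H := by
  refine mem_cartan_of_commute fun h ↦ ?_
  have h1 : h.1.1 * zᵀ = 0 := by
    rw [← transpose_transpose h.1.1, ← transpose_mul, hz' h, transpose_zero]
  have h2 : zᵀ * h.1.1ᵀ = 0 := by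
    rw [← transpose_mul, hz h, transpose_zero]
  have h3 : X.form K r * h.1.1 = -(h.1.1ᵀ * X.form K r) := by
    rw [(mem_lieAlg hX).1 h.1.2, neg_neg]
  change h.1.1 * ((z - X.sign K • zᵀ) * X.form K r) = (z - X.sign K • zᵀ) * X.form K r * h.1.1
  rw [mul_assoc _ _ h.1.1, h3, ← mul_assoc, mul_sub, hz h, Matrix.mul_smul, h1, mul_neg,
    ← mul_assoc, sub_mul _ _ h.1.1ᵀ, hz' h, smul_mul_assoc, h2]
  simp

/-- The form is nondegenerate on the zero weight space, since the projection onto the nonzero weight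
spaces is self-adjoint. -/
lemma exists_dotProduct_form_eq_one (hX : X ≠ A) {v : X.NatRep K r} (hv : v ∈ weightSubspace H 0)
    (hv0 : v ≠ 0) : ∃ u ∈ weightSubspace H 0, v ⬝ᵥ (X.form K r *ᵥ u) = 1 := by
  have h1 : v ᵥ* X.form K r ≠ 0 := by
    intro h
    rw [← mulVec_transpose, form_transpose hX, smul_mulVec, smul_eq_zero] at h
    have h2 := h.resolve_left (left_ne_zero_of_mul_eq_one (sign_mul_self (K := K) X))
    exact hv0 (mulVec_injective_of_isUnit (isUnit_form hX) (by rw [h2, mulVec_zero]))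
  obtain ⟨u, hu⟩ := exists_dotProduct_eq_one h1
  refine ⟨_, mulVec_sub_mem_weightSubspace_zero hr u, ?_⟩
  rw [dotProduct_mulVec, sub_mulVec, one_mulVec, dotProduct_sub, dotProduct_comm, hu,
    dotProduct_mulVec, vecMul_vecMul, ← transpose_cartanProj_mul_form hr hX, ← vecMul_vecMul,
    vecMul_transpose, cartanProj_mulVec_zero hr hv, zero_vecMul, zero_dotProduct, sub_zero]

/-- The element of the Lie algebra built from two zero weight vectors v, w commutes with 𝔥, hence
lies in 𝔥 and kills the zero weight space. This forces that space to be zero in type C and at most a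
line in the orthogonal types. -/
lemma vecMulVec_sub_mulVec_eq_zero (hX : X ≠ A) {v w u : X.NatRep K r}
    (hv : v ∈ weightSubspace H 0) (hw : w ∈ weightSubspace H 0) (hu : u ∈ weightSubspace H 0) :
    (v ⬝ᵥ (X.form K r *ᵥ u)) • w - X.sign K • (w ⬝ᵥ (X.form K r *ᵥ u)) • v = 0 := by
  have hz {v w : X.NatRep K r} (hw : w ∈ weightSubspace H 0) (h : H) :
      h.1.1 * vecMulVec w v = 0 := by
    rw [mul_vecMulVec, hw h]
    simp
  have hz' {v w : X.NatRep K r} (hv : v ∈ weightSubspace H 0) (h : H) :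
      vecMulVec w v * h.1.1ᵀ = 0 := by
    rw [vecMulVec_mul, vecMul_transpose, hv h]
    simp
  have := hu ⟨_, matrix_mem_cartan hr hX (z := vecMulVec w v) (hz hw) (hz' hv)⟩
  simp only [LinearMap.zero_apply, zero_smul] at this
  rw [← mulVec_mulVec, transpose_vecMulVec, sub_mulVec, smul_mulVec, vecMulVec_mulVec,
    vecMulVec_mulVec] at this
  simpa using this

lemma weightSubspace_zero_eq_bot_C (hX : X = C) : weightSubspace H 0 = ⊥ := by
  by_contra hbot
  obtain ⟨v, hv, hv0⟩ := (Submodule.ne_bot_iff _).1 hbot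
  have hA : X ≠ A := by rw [hX]; exact fun h ↦ by cases h
  have hs : X.sign K = -1 := by rw [hX]; rfl
  obtain ⟨u, hu, h1⟩ := exists_dotProduct_form_eq_one hr hA hv hv0
  have := vecMulVec_sub_mulVec_eq_zero hr hA hv hv hu
  rw [h1, hs, one_smul, neg_one_smul, sub_neg_eq_add, ← two_smul K, smul_eq_zero] at this
  exact this.elim two_ne_zero hv0

/-- A parity argument. If the zero weight space is a line, e = 1 - p has rank one and h₀ + e is
invertible. Then h₀ - e = (h₀ + e)(1 - 2e), where 1 - 2e is a reflection of determinant -1; but the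
adjoint of h₀ + e is -(h₀ - e), so in even dimension the two determinants agree. -/
lemma weightSubspace_zero_eq_bot_D (hX : X = D) : weightSubspace H 0 = ⊥ := by
  by_contra hbot
  obtain ⟨v, hv, hv0⟩ := (Submodule.ne_bot_iff _).1 hbot
  have hA : X ≠ A := by rw [hX]; exact fun h ↦ by cases h
  have hs : X.sign K = 1 := by rw [hX]; rfl
  obtain ⟨u, hu, h1⟩ := exists_dotProduct_form_eq_one hr hA hv hv0
  have hspan {w : X.NatRep K r} (hw : w ∈ weightSubspace H 0) :
      w = (w ⬝ᵥ (X.form K r *ᵥ u)) • v := by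
    have := vecMulVec_sub_mulVec_eq_zero hr hA hv hw hu
    rwa [h1, hs, one_smul, one_smul, sub_eq_zero] at this
  obtain ⟨h₀, q, hq, hq'⟩ := exists_cartanProj_eq (H := H) hr
  set p := cartanProj hr H with hp
  set F := X.form K r with hF
  set e := 1 - p with he
  have heT : eᵀ * F = F * e := by
    rw [he, transpose_sub, transpose_one, sub_mul, mul_sub, one_mul, mul_one,
      transpose_cartanProj_mul_form hr hA]
  have hpu : p *ᵥ u = 0 := cartanProj_mulVec_zero hr hu
  have he1 : e = vecMulVec v (F *ᵥ u) := by
    refine ext_iff_mulVec.2 fun y ↦ ?_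
    rw [hspan (mulVec_sub_mem_weightSubspace_zero hr y), vecMulVec_mulVec, op_smul_eq_smul]
    congr 1
    rw [dotProduct_comm, dotProduct_mulVec, ← mulVec_transpose, mulVec_mulVec, heT,
      ← mulVec_mulVec, he, sub_mulVec, one_mulVec, hpu, sub_zero]
  have hh₀e : h₀.1.1 * e = 0 := by rw [he, mul_sub, mul_cartanProj, mul_one, sub_self]
  have hee : e * e = e := by
    rw [he, mul_sub, sub_mul, sub_mul, hp, cartanProj_mul_self]
    simp
  have hdet : (h₀.1.1 + e).det ≠ 0 := by
    intro h
    obtain ⟨y, hy0, hy⟩ := exists_mulVec_eq_zero_iff.2 h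
    have h2 : e * (h₀.1.1 + e) = e := by
      rw [mul_add, hee, he, sub_mul, cartanProj_mul]
      simp
    have h3 : e *ᵥ y = 0 := by rw [← h2, ← mulVec_mulVec, hy, mulVec_zero]
    have h4 : h₀.1.1 *ᵥ y = 0 := by rwa [add_mulVec, h3, add_zero] at hy
    have h5 : p *ᵥ y = 0 := by rw [hq', ← mulVec_mulVec, h4, mulVec_zero]
    rw [he, sub_mulVec, one_mulVec, h5, sub_zero] at h3
    exact hy0 h3
  have hd1 : (h₀.1.1 - e).det = -(h₀.1.1 + e).det := by
    have h2 : h₀.1.1 - e = (h₀.1.1 + e) * (1 + vecMulVec (-(2 : K) • v) (F *ᵥ u)) := by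
      rw [smul_vecMulVec, ← he1, mul_add, mul_one, Matrix.mul_smul, add_mul, hh₀e, hee, zero_add,
        neg_smul, two_smul]
      abel
    rw [h2, det_mul, vecMulVec_eq Unit, det_one_add_replicateCol_mul_replicateRow, dotProduct_smul,
      dotProduct_comm, h1, smul_eq_mul]
    ring
  have hd2 : (h₀.1.1 - e).det = (h₀.1.1 + e).det := by
    have h2 : (h₀.1.1 + e)ᵀ * F = F * (-(h₀.1.1 - e)) := by
      rw [transpose_add, add_mul, heT, (mem_lieAlg hA).1 h₀.1.2, neg_sub, mul_sub F e]
      abel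
    have h3 := congrArg Matrix.det h2
    have hcard : Even (Fintype.card (X.Idx r)) := by
      subst hX
      change Even (Fintype.card (Fin r ⊕ Fin r))
      simp
    rw [det_mul, det_mul, det_transpose, det_neg, hcard.neg_one_pow, one_mul, mul_comm] at h3
    exact (mul_left_cancel₀ ((isUnit_iff_isUnit_det _).1 (isUnit_form hA)).ne_zero h3).symm
  rw [hd1] at hd2
  exact hdet (self_eq_neg.1 hd2.symm)

/-- Zero is not a weight of the natural representation, except in type `B`. -/
lemma cartanProj_eq_one (hX : X ≠ B) : cartanProj hr H = 1 := by
  have h0 : weightSubspace H 0 = ⊥ := by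
    have hcases : X = A ∨ X = C ∨ X = D := by cases X <;> simp_all
    rcases hcases with h | h | h
    · exact weightSubspace_zero_eq_bot_A hr h
    · exact weightSubspace_zero_eq_bot_C hr h
    · exact weightSubspace_zero_eq_bot_D hr h
  refine ext_iff_mulVec.2 fun v ↦ ?_
  have := mulVec_sub_mem_weightSubspace_zero (H := H) hr v
  rw [h0, Submodule.mem_bot, sub_mulVec, sub_eq_zero] at this
  exact this.symm

end cartanProj

end ClassicalType

/-! ### Integrality of roots on sl₂-triples -/

namespace CartanPair

open LieAlgebra LieAlgebra.IsKilling LieModule _root_.Module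

variable {K L : Type*} [Field K] [CharZero K] [IsAlgClosed K] [LieRing L] [LieAlgebra K L]
  [FiniteDimensional K L] [LieAlgebra.IsKilling K L]
variable {H : LieSubalgebra K L} [H.IsCartanSubalgebra]

lemma mem_rootSpace_zero_iff {x : L} : x ∈ rootSpace H ((0 : Dual K H) : H → K) ↔ x ∈ H := by
  conv_rhs => rw [← LieAlgebra.zeroRootSubalgebra_eq_of_is_cartan K L H]
  rfl

/-- Roots take integral values on the neutral elements of `sl₂`-triples. -/
lemma IsRoot.exists_int_of_isSl2Triple {α : Dual K H} (hα : IsRoot H α) {h : H} {e f : L}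
    (t : IsSl2Triple (h : L) e f) : ∃ k : ℤ, α h = k := by
  obtain ⟨x, hx, hx0⟩ := hα.exists_ne_zero
  have hx1 : ⁅(h : L), x⁆ = α h • x := lie_eq_smul hx h
  -- The vectors e and f need not be root vectors, so nilpotency is obtained by counting: the powers
  -- of e would give infinitely many eigenvalues α(h) + 2n of ad h. The last nonzero eⁿx is
  -- primitive, and its eigenvalue is a natural number.
  have hnil : ∃ n : ℕ, ((toEnd K L L e) ^ n) x = 0 := by
    by_contra! hne
    have hinj : Function.Injective fun n : ℕ ↦ α h + 2 * (n : K) := fun m n hmn ↦ by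
      simpa using hmn
    refine Set.not_infinite.2 (Module.End.finite_hasEigenvalue (toEnd K L L (h : L)))
      ((Set.infinite_range_of_injective hinj).mono ?_)
    rintro - ⟨n, rfl⟩
    exact Module.End.hasEigenvalue_of_hasEigenvector (x := ((toEnd K L L e) ^ n) x)
      ⟨Module.End.mem_eigenspace_iff.2 (t.lie_h_pow_toEnd_e hx1 n), hne n⟩
  obtain ⟨n, hn, hn'⟩ := Nat.exists_not_and_succ_of_not_zero_of_exists
    (p := fun n ↦ ((toEnd K L L e) ^ n) x = 0) (by simpa using hx0) hnil
  have prim : t.HasPrimitiveVectorWith (((toEnd K L L e) ^ n) x) (α h + 2 * (n : K)) :=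
    ⟨hn, t.lie_h_pow_toEnd_e hx1 n, by rw [pow_succ'] at hn'; exact hn'⟩
  obtain ⟨m, hm⟩ := prim.exists_nat
  refine ⟨m - 2 * n, ?_⟩
  push_cast
  rw [← hm]
  ring

end CartanPair

namespace ClassicalType

open Matrix _root_.Module LieAlgebra CartanPair

variable {K : Type*} [Field K] [CharZero K] [IsAlgClosed K] {X : ClassicalType} {r : ℕ}
  {H : LieSubalgebra K (X.lieAlg K r)} [H.IsCartanSubalgebra] (hr : X.minRank ≤ r)

/-! ### The trace form -/

omit [CharZero K] [IsAlgClosed K] in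
lemma trace_lie_mul {ι : Type*} [Fintype ι] (a b c : Matrix ι ι K) :
    ((a * b - b * a) * c).trace = (a * (b * c - c * b)).trace := by
  rw [sub_mul, mul_sub, trace_sub, trace_sub, mul_assoc, ← mul_assoc a c b, trace_mul_comm (a * c),
    mul_assoc b a c]

section
include hr

lemma lie_cartan_eq {α : Dual K H} {x : X.lieAlg K r} (hx : x ∈ rootSpace H α) (h : H) :
    h.1.1 * x.1 - x.1 * h.1.1 = α h • x.1 := by
  have := isKilling (K := K) hr
  exact congrArg Subtype.val (lie_eq_smul hx h)

lemma trace_mul_eq_zero {α β : Dual K H} (hαβ : α + β ≠ 0) {x y : X.lieAlg K r}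
    (hx : x ∈ rootSpace H α) (hy : y ∈ rootSpace H β) : (x.1 * y.1).trace = 0 := by
  obtain ⟨h, hh⟩ : ∃ h, (α + β) h ≠ 0 := by
    by_contra! h
    exact hαβ (LinearMap.ext h)
  have h1 := trace_lie_mul x.1 h.1.1 y.1
  rw [← neg_sub, lie_cartan_eq hr hx, lie_cartan_eq hr hy, neg_mul, smul_mul_assoc, trace_neg,
    trace_smul, Matrix.mul_smul, trace_smul, neg_eq_iff_add_eq_zero, ← add_smul,
    smul_eq_zero] at h1
  exact h1.resolve_left hh

/-- By invariance the trace form pairs the root space of α only with that of -α, and it is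
nondegenerate. -/
lemma exists_trace_mul_ne_zero {α : Dual K H} {x : X.lieAlg K r} (hx : x ∈ rootSpace H α)
    (hx0 : x ≠ 0) : ∃ f ∈ rootSpace H (-α), (x.1 * f.1).trace ≠ 0 := by
  by_contra! h
  refine hx0 (Subtype.ext (eq_zero_of_forall_trace_mul hr x.2 fun y hy ↦ ?_))
  refine rootSpace_induction (H := H) hr (p := fun y ↦ (x.1 * y.1).trace = 0)
    (fun β y hy ↦ ?_) (by simp) (fun y z hy hz ↦ ?_) ⟨y, hy⟩
  · by_cases hαβ : α + β = 0
    · refine h y ?_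
      rw [eq_neg_of_add_eq_zero_right hαβ] at hy
      exact hy
    · exact trace_mul_eq_zero hr hαβ hx hy
  · change (x.1 * (y.1 + z.1)).trace = 0
    rw [mul_add, trace_add, hy, hz, add_zero]

end

/-- The trace form of the natural representation on the Cartan subalgebra. -/
def cartanTraceForm (H : LieSubalgebra K (X.lieAlg K r)) : H →ₗ[K] Dual K H :=
  LinearMap.mk₂ K (fun h h' : H ↦ (h.1.1 * h'.1.1).trace)
    (fun a b c ↦ by change ((a.1.1 + b.1.1) * c.1.1).trace = _; rw [add_mul, trace_add])
    (fun c a b ↦ by change ((c • a.1.1) * b.1.1).trace = _; rw [smul_mul_assoc, trace_smul])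
    (fun a b c ↦ by change (a.1.1 * (b.1.1 + c.1.1)).trace = _; rw [mul_add, trace_add])
    (fun c a b ↦ by change (a.1.1 * (c • b.1.1)).trace = _; rw [Matrix.mul_smul, trace_smul])

lemma cartanTraceForm_apply (h h' : H) : cartanTraceForm H h h' = (h.1.1 * h'.1.1).trace := rfl

include hr in
lemma cartanTraceForm_injective : Function.Injective (cartanTraceForm H) := by
  have := isKilling (K := K) hr
  rw [← LinearMap.ker_eq_bot, LinearMap.ker_eq_bot']
  intro h hh
  by_contra h0
  have hmem : h.1 ∈ rootSpace H ((0 : Dual K H) : H → K) := mem_rootSpace_zero_iff.2 h.2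
  obtain ⟨f, hf, hf0⟩ := exists_trace_mul_ne_zero hr hmem (fun h' ↦ h0 (Subtype.ext h'))
  rw [show -((0 : Dual K H) : H → K) = ((0 : Dual K H) : H → K) by ext; simp,
    mem_rootSpace_zero_iff] at hf
  exact hf0 (LinearMap.congr_fun hh ⟨f, hf⟩)

/-- The identification of the Cartan subalgebra with its dual by the trace form. -/
noncomputable def cartanTraceEquiv (H : LieSubalgebra K (X.lieAlg K r)) [H.IsCartanSubalgebra] :
    H ≃ₗ[K] Dual K H :=
  LinearEquiv.ofInjectiveOfFinrankEq (cartanTraceForm H) (cartanTraceForm_injective hr)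
    (Subspace.dual_finrank_eq).symm

lemma trace_cartanTraceEquiv_symm (μ : Dual K H) (h : H) :
    (((cartanTraceEquiv hr H).symm μ).1.1 * h.1.1).trace = μ h := by
  conv_rhs => rw [← (cartanTraceEquiv hr H).apply_symm_apply μ]
  rfl

/-- Brackets of opposite root vectors. -/
lemma lie_eq_trace_smul {α : Dual K H} {x f : X.lieAlg K r} (hx : x ∈ rootSpace H α)
    (hf : f ∈ rootSpace H (-α)) :
    x.1 * f.1 - f.1 * x.1 = (x.1 * f.1).trace • ((cartanTraceEquiv hr H).symm α).1.1 := by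
  have := isKilling (K := K) hr
  have hxf : ⁅x, f⁆ ∈ H := by
    rw [← mem_rootSpace_zero_iff (H := H)]
    have := LieAlgebra.lie_mem_genWeightSpace_of_mem_genWeightSpace hx hf
    rwa [add_neg_cancel] at this
  have key : (⟨⁅x, f⁆, hxf⟩ : H) = (x.1 * f.1).trace • (cartanTraceEquiv hr H).symm α := by
    apply cartanTraceForm_injective hr
    ext h
    rw [map_smul, LinearMap.smul_apply, cartanTraceForm_apply, cartanTraceForm_apply,
      trace_cartanTraceEquiv_symm]
    change ((x.1 * f.1 - f.1 * x.1) * h.1.1).trace = _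
    have h1 : f.1 * h.1.1 - h.1.1 * f.1 = α h • f.1 := by
      rw [← neg_sub, lie_cartan_eq hr (α := -α) hf h, LinearMap.neg_apply, neg_smul, neg_neg]
    rw [trace_lie_mul, h1, Matrix.mul_smul, trace_smul, smul_eq_mul, smul_eq_mul, mul_comm]
  exact congrArg (fun h : H ↦ h.1.1) key

/-! ### Root vectors killing the zero weight space -/

/-- The subalgebra of the elements which kill the zero weight space of the natural
representation. -/
noncomputable def zeroWeightAnnihilator (H : LieSubalgebra K (X.lieAlg K r))
    [H.IsCartanSubalgebra] : LieSubalgebra K (X.lieAlg K r) where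
  carrier := {x | x.1 * cartanProj hr H = x.1}
  add_mem' {x y} hx hy := by
    change (x.1 + y.1) * _ = x.1 + y.1
    rw [add_mul, hx, hy]
  zero_mem' := zero_mul _
  smul_mem' c x hx := by
    change (c • x.1) * _ = c • x.1
    rw [smul_mul_assoc, hx]
  lie_mem' {x y} hx hy := by
    change (x.1 * y.1 - y.1 * x.1) * _ = x.1 * y.1 - y.1 * x.1
    rw [sub_mul, mul_assoc, mul_assoc, hx, hy]

lemma mem_zeroWeightAnnihilator {x : X.lieAlg K r} :
    x ∈ zeroWeightAnnihilator hr H ↔ x.1 * cartanProj hr H = x.1 := Iff.rfl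

lemma mem_zeroWeightAnnihilator_iff_forall {x : X.lieAlg K r} :
    x ∈ zeroWeightAnnihilator hr H ↔ ∀ v ∈ weightSubspace H 0, x.1 *ᵥ v = 0 := by
  rw [mem_zeroWeightAnnihilator]
  constructor
  · intro h v hv
    rw [← h, ← mulVec_mulVec, cartanProj_mulVec_zero hr hv, mulVec_zero]
  · intro h
    refine ext_iff_mulVec.2 fun v ↦ ?_
    have := h _ (mulVec_sub_mem_weightSubspace_zero hr v)
    rw [mulVec_mulVec, mul_sub, mul_one, sub_mulVec, sub_eq_zero] at this
    exact this.symm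

lemma mem_zeroWeightAnnihilator_of_ne_B (hX : X ≠ B) (x : X.lieAlg K r) :
    x ∈ zeroWeightAnnihilator hr H := by
  rw [mem_zeroWeightAnnihilator, cartanProj_eq_one hr hX, mul_one]

/-- A root vector of α carries the zero weight space into the α-weight space. This applies to the
long roots in type B. -/
lemma mem_zeroWeightAnnihilator_of_weightSubspace_eq_bot {α : Dual K H}
    (hα : weightSubspace H α = ⊥) {x : X.lieAlg K r} (hx : x ∈ rootSpace H α) :
    x ∈ zeroWeightAnnihilator hr H := by
  rw [mem_zeroWeightAnnihilator_iff_forall]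
  intro v hv
  have := mulVec_mem_weightSubspace hr hx hv
  rwa [add_zero, hα, Submodule.mem_bot] at this

/-- Outside type A, self-adjointness of the projection and skew-adjointness of x turn x p = x into p
x = x; in type A the projection is the identity. -/
lemma cartanProj_mul_of_mem {x : X.lieAlg K r} (hx : x ∈ zeroWeightAnnihilator hr H) :
    cartanProj hr H * x.1 = x.1 := by
  by_cases hX : X = A
  · rw [cartanProj_eq_one hr (by rw [hX]; exact fun h ↦ by cases h), one_mul]
  · have h1 : X.form K r * (cartanProj hr H * x.1) = X.form K r * x.1 := by
      rw [← mul_assoc, ← transpose_cartanProj_mul_form hr hX, mul_assoc, ← neg_neg (X.form K r * x.1),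
        ← (mem_lieAlg hX).1 x.2, mul_neg, ← mul_assoc, ← transpose_mul,
        (mem_zeroWeightAnnihilator hr).1 hx]
    exact (isUnit_form hX).mul_left_cancel h1

include hr in
-- A zero weight vector killed by e is primitive of weight 0 for the sl₂-triple of α, hence is also
-- killed by f.
lemma mem_zeroWeightAnnihilator_neg {α : Dual K H} (hα : IsRoot H α)
    (h : ∀ x ∈ rootSpace H α, x ∈ zeroWeightAnnihilator hr H) :
    ∀ x ∈ rootSpace H (-α), x ∈ zeroWeightAnnihilator hr H := by
  have := isKilling (K := K) hr
  obtain ⟨c, e, f, -, t, he, hf⟩ := hα.exists_isSl2Triple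
  refine hα.neg.rootSpace_le_of_ne_zero hf t.f_ne_zero
    (V := (zeroWeightAnnihilator hr H).toSubmodule) ?_
  refine (mem_zeroWeightAnnihilator_iff_forall hr).2 fun v hv ↦ ?_
  rcases eq_or_ne v 0 with rfl | hv0
  · exact mulVec_zero _
  have prim : t.HasPrimitiveVectorWith v (0 : K) := by
    refine ⟨hv0, ?_, (mem_zeroWeightAnnihilator_iff_forall hr).1 (h e he) v hv⟩
    have := hv c
    rw [LinearMap.zero_apply] at this
    exact this
  have := prim.pow_toEnd_f_eq_zero_of_eq_nat (n := 0) (by simp)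
  simpa using this

end ClassicalType

/-! ### Matrix description of a diagonal embedding -/

namespace DiagonalIndGroup

open Matrix _root_.Module ClassicalType

section twist

variable {K ι : Type*} [Field K]

/-- The identity, or the passage to the dual representation. -/
def twist (ε : Bool) : Matrix ι ι K →ₗ[K] Matrix ι ι K :=
  bif ε then -(Matrix.transposeLinearEquiv ι ι K K).toLinearMap else LinearMap.id

lemma twist_true (x : Matrix ι ι K) : twist true x = -xᵀ := rfl

lemma twist_false (x : Matrix ι ι K) : twist false x = x := rfl

variable [Fintype ι]

lemma twist_lie (ε : Bool) (x y : Matrix ι ι K) :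
    twist ε (x * y - y * x) = twist ε x * twist ε y - twist ε y * twist ε x := by
  cases ε
  · rfl
  · simp [twist_true, transpose_sub]

lemma trace_twist_mul (ε : Bool) (x y : Matrix ι ι K) :
    (twist ε x * twist ε y).trace = (x * y).trace := by
  cases ε
  · rfl
  · rw [twist_true, twist_true, neg_mul_neg, ← transpose_mul, trace_transpose, trace_mul_comm]

end twist

variable {K : Type*} [Field K] (G : DiagonalIndGroup K)

/-- A matrix form of the embedding `𝔤_n → 𝔤_{n+1}`: the matrices `φ i` are bases of the
constituents and the matrices `ψ i` are the corresponding coordinate maps. -/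
structure StepData (n : ℕ) where
  /-- The inclusion of a constituent. -/
  φ : Fin (G.s n) → Matrix (G.type.Idx (G.rank (n + 1))) (G.type.Idx (G.rank n)) K
  /-- The projection to a constituent. -/
  ψ : Fin (G.s n) → Matrix (G.type.Idx (G.rank n)) (G.type.Idx (G.rank (n + 1))) K
  /-- Whether the constituent is dual to the natural representation. -/
  ε : Fin (G.s n) → Bool
  ψ_mul_φ : ∀ i, ψ i * φ i = 1
  ψ_mul_φ_of_ne : ∀ i j, i ≠ j → ψ i * φ j = 0
  δ_eq : ∀ x, (G.δ n x).1 = ∑ i, φ i * twist (ε i) x.1 * ψ i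
  isComponent_iff : ∀ i x y, G.IsComponent n i x y ↔ y.1 = φ i * twist (ε i) x.1 * ψ i
  ε_eq : G.type ≠ ClassicalType.A → ∀ i, ε i = false
  transpose_φ_mul : G.type ≠ ClassicalType.A → ∀ i j, i ≠ j →
    (φ i)ᵀ * G.type.form K (G.rank (n + 1)) * φ j = 0
  compat : ∀ i (h : G.cartan n) (h' : G.cartan (n + 1)),
    φ i * ψ i * (h'.1.1 * φ i * twist (ε i) h.1.1) = h'.1.1 * φ i * twist (ε i) h.1.1

variable {G} {n : ℕ}

lemma iSup_constituent : (⨆ o : Option (Fin (G.s n)),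
    o.elim (G.trivialPart n) (G.constituent n)) = ⊤ :=
  (G.isInternal n).submodule_iSup_eq_top

lemma ext_of_constituents {m : Type*}
    {M N : Matrix m (G.type.Idx (G.rank (n + 1))) K}
    (h : ∀ i, ∀ v ∈ G.constituent n i, M *ᵥ v = N *ᵥ v)
    (h' : ∀ v ∈ G.trivialPart n, M *ᵥ v = N *ᵥ v) : M = N := by
  refine ext_iff_mulVec.2 fun v ↦ ?_
  have hv : v ∈ (⨆ o : Option (Fin (G.s n)), o.elim (G.trivialPart n) (G.constituent n)) := by
    rw [iSup_constituent]; trivial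
  induction hv using Submodule.iSup_induction' with
  | mem o v hv =>
    cases o with
    | none => exact h' v hv
    | some i => exact h i v hv
  | zero => simp
  | add v w _ _ hv hw => rw [mulVec_add, hv, hw, mulVec_add]

lemma exists_projections (n : ℕ) : ∃ P : Fin (G.s n) → Matrix (G.type.Idx (G.rank (n + 1)))
    (G.type.Idx (G.rank (n + 1))) K,
    (∀ i, ∀ v ∈ G.constituent n i, P i *ᵥ v = v) ∧ (∀ i v, P i *ᵥ v ∈ G.constituent n i) ∧
    (∀ i j, i ≠ j → ∀ v ∈ G.constituent n j, P i *ᵥ v = 0) ∧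
    ∀ i, ∀ v ∈ G.trivialPart n, P i *ᵥ v = 0 := by
  classical
  let M : Option (Fin (G.s n)) → Submodule K (G.type.NatRep K (G.rank (n + 1))) :=
    fun o ↦ o.elim (G.trivialPart n) (G.constituent n)
  have hM : DirectSum.IsInternal M := by convert! G.isInternal n
  let e : (DirectSum _ fun o ↦ M o) ≃ₗ[K] G.type.NatRep K (G.rank (n + 1)) :=
    LinearEquiv.ofBijective (DirectSum.coeLinearMap M) hM
  let p (o : Option (Fin (G.s n))) : G.type.NatRep K (G.rank (n + 1)) →ₗ[K]
    G.type.NatRep K (G.rank (n + 1)) :=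
    (M o).subtype ∘ₗ DirectSum.component K _ (fun o ↦ M o) o ∘ₗ e.symm.toLinearMap
  have he {o} {v} (hv : v ∈ M o) : e.symm v = DirectSum.lof K _ (fun o ↦ M o) o ⟨v, hv⟩ := by
    rw [LinearEquiv.symm_apply_eq]
    exact (DirectSum.coeLinearMap_lof M o ⟨v, hv⟩).symm
  have h1 {o} {v} (hv : v ∈ M o) : p o v = v := by
    simp only [p, LinearMap.comp_apply, LinearEquiv.coe_coe, he hv, DirectSum.component.lof_self]
    rfl
  have h2 {o o'} (hne : o' ≠ o) {v} (hv : v ∈ M o) : p o' v = 0 := by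
    simp only [p, LinearMap.comp_apply, LinearEquiv.coe_coe, he hv, DirectSum.component.of,
      dif_neg hne.symm]
    rfl
  refine ⟨fun i ↦ LinearMap.toMatrix' (p (some i)), fun i v hv ↦ ?_, fun i v ↦ ?_,
    fun i j hij v hv ↦ ?_, fun i v hv ↦ ?_⟩
  · rw [LinearMap.toMatrix'_mulVec]
    exact h1 (o := some i) hv
  · rw [LinearMap.toMatrix'_mulVec]
    exact (DirectSum.component K _ (fun o ↦ M o) (some i) (e.symm v)).2
  · rw [LinearMap.toMatrix'_mulVec]
    exact h2 (o := some j) (by simpa using hij) hv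
  · rw [LinearMap.toMatrix'_mulVec]
    exact h2 (o := none) (by simp) hv

variable [CharZero K]

/-- A basis matrix of a constituent. -/
lemma exists_constituent_matrix (n : ℕ) (i : Fin (G.s n)) :
    ∃ (φ : Matrix (G.type.Idx (G.rank (n + 1))) (G.type.Idx (G.rank n)) K) (ε : Bool),
      Function.Injective φ.mulVec ∧ (∀ v, v ∈ G.constituent n i ↔ ∃ u, φ *ᵥ u = v) ∧
      (∀ x, (G.δ n x).1 * φ = φ * twist ε x.1) ∧ (G.type ≠ ClassicalType.A → ε = false) := by
  obtain ⟨φ, hinj, hrange, h⟩ := G.constituent_iso n i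
  have hmem (v) : v ∈ G.constituent n i ↔ ∃ u, LinearMap.toMatrix' φ *ᵥ u = v := by
    rw [← hrange]
    simp [LinearMap.mem_range, LinearMap.toMatrix'_mulVec]
  have hinj' : Function.Injective (LinearMap.toMatrix' φ).mulVec := by
    intro u v huv
    exact hinj (by simpa [LinearMap.toMatrix'_mulVec] using huv)
  rcases h with h | h
  · refine ⟨LinearMap.toMatrix' φ, false, hinj', hmem, fun x ↦ ext_iff_mulVec.2 fun v ↦ ?_,
      fun _ ↦ rfl⟩
    rw [← mulVec_mulVec, ← mulVec_mulVec, LinearMap.toMatrix'_mulVec, LinearMap.toMatrix'_mulVec,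
      h x v, twist_false]
  · by_cases hA : G.type = ClassicalType.A
    · refine ⟨LinearMap.toMatrix' φ, true, hinj', hmem, fun x ↦ ext_iff_mulVec.2 fun v ↦ ?_,
        fun h ↦ absurd hA h⟩
      rw [← mulVec_mulVec, ← mulVec_mulVec, LinearMap.toMatrix'_mulVec, LinearMap.toMatrix'_mulVec,
        h x v, twist_true, neg_mulVec]
    -- Outside type A the form identifies the dual of the natural representation with the natural
    -- representation, so the dual case can be rewritten as an untwisted one.
    · have hF := isUnit_form (K := K) (r := G.rank n) hA
      refine ⟨LinearMap.toMatrix' φ * G.type.form K (G.rank n), false, ?_, fun v ↦ ?_,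
        fun x ↦ ext_iff_mulVec.2 fun v ↦ ?_, fun _ ↦ rfl⟩
      · intro u v huv
        change (_ * _) *ᵥ u = (_ * _) *ᵥ v at huv
        rw [← mulVec_mulVec, ← mulVec_mulVec] at huv
        exact mulVec_injective_of_isUnit hF (hinj' huv)
      · rw [hmem]
        constructor
        · rintro ⟨u, rfl⟩
          obtain ⟨w, rfl⟩ := (mulVec_surjective_iff_isUnit.2 hF) u
          exact ⟨w, (mulVec_mulVec _ _ _).symm⟩
        · rintro ⟨u, rfl⟩
          exact ⟨_, mulVec_mulVec _ _ _⟩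
      · have hx := (mem_lieAlg hA).1 x.2
        rw [twist_false, Matrix.mul_assoc, ← neg_neg (G.type.form K (G.rank n) * x.1), ← hx,
          ← mulVec_mulVec, ← mulVec_mulVec, ← mulVec_mulVec, LinearMap.toMatrix'_mulVec,
          LinearMap.toMatrix'_mulVec, h, neg_mulVec, ← mulVec_mulVec]

/-- The coordinate map ψ_i is a left inverse of φ_i composed with the projection to the i-th summand
of the decomposition. -/
lemma nonempty_stepData (G : DiagonalIndGroup K) (n : ℕ) : Nonempty (G.StepData n) := by
  choose φ ε hinj hmem hδ hε using G.exists_constituent_matrix n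
  obtain ⟨P, hP1, hP2, hP3, hP4⟩ := G.exists_projections n
  have hL (i) : ∃ L : Matrix (G.type.Idx (G.rank n)) (G.type.Idx (G.rank (n + 1))) K,
      L * φ i = 1 := by
    obtain ⟨g, hg⟩ := (Matrix.toLin' (φ i)).exists_leftInverse_of_injective
      (LinearMap.ker_eq_bot.2 (hinj i))
    refine ⟨LinearMap.toMatrix' g, ?_⟩
    rw [← LinearMap.toMatrix'_toLin' (φ i), ← LinearMap.toMatrix'_comp, hg,
      LinearMap.toMatrix'_id]
  choose L hL using hL
  have hφ (i u) : φ i *ᵥ u ∈ G.constituent n i := (hmem i _).2 ⟨u, rfl⟩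
  set ψ := fun i ↦ L i * P i with hψ
  have h1 (i) : ψ i * φ i = 1 := by
    refine ext_iff_mulVec.2 fun u ↦ ?_
    rw [← mulVec_mulVec, hψ, ← mulVec_mulVec, hP1 i _ (hφ i u), mulVec_mulVec, hL]
  have h2 (i j) (hij : i ≠ j) : ψ i * φ j = 0 := by
    refine ext_iff_mulVec.2 fun u ↦ ?_
    rw [← mulVec_mulVec, hψ, ← mulVec_mulVec, hP3 i j hij _ (hφ j u), mulVec_zero, zero_mulVec]
  have h3 (i) (v) (hv : v ∈ G.trivialPart n) : ψ i *ᵥ v = 0 := by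
    rw [hψ, ← mulVec_mulVec, hP4 i v hv, mulVec_zero]
  have hκ (i) (x : G.g n) (u) : (φ i * twist (ε i) x.1 * ψ i) *ᵥ (φ i *ᵥ u) =
      (G.δ n x).1 *ᵥ (φ i *ᵥ u) := by
    rw [mulVec_mulVec, mulVec_mulVec, hδ, Matrix.mul_assoc _ (ψ i), h1, Matrix.mul_one]
  have hκ' (i j) (hij : i ≠ j) (x : G.g n) (u) :
      (φ i * twist (ε i) x.1 * ψ i) *ᵥ (φ j *ᵥ u) = 0 := by
    rw [mulVec_mulVec, Matrix.mul_assoc _ (ψ i), h2 i j hij, Matrix.mul_zero, zero_mulVec]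
  refine ⟨⟨φ, ψ, ε, h1, h2, fun x ↦ ?_, fun i x y ↦ ?_, fun h i ↦ hε i h, fun h i j hij ↦ ?_,
    fun i h h' ↦ ?_⟩⟩
  · refine ext_of_constituents (fun i v hv ↦ ?_) fun v hv ↦ ?_
    · obtain ⟨u, rfl⟩ := (hmem i v).1 hv
      rw [sum_mulVec, Finset.sum_eq_single i, hκ]
      · intro j _ hj
        exact hκ' j i hj x u
      · simp
    · rw [G.trivialPart_trivial n x v hv, sum_mulVec, Finset.sum_eq_zero]
      intro i _
      rw [← mulVec_mulVec, h3 i v hv, mulVec_zero]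
  · constructor
    · rintro ⟨h, h', h''⟩
      refine ext_of_constituents (fun j v hv ↦ ?_) fun v hv ↦ ?_
      · rcases eq_or_ne i j with rfl | hij
        · rw [h v hv]
          obtain ⟨u, rfl⟩ := (hmem i v).1 hv
          rw [hκ]
        · rw [h' j hij.symm v hv]
          obtain ⟨u, rfl⟩ := (hmem j v).1 hv
          rw [hκ' i j hij]
      · rw [h'' v hv, ← mulVec_mulVec, h3 i v hv, mulVec_zero]
    · intro h
      rw [IsComponent, h]
      refine ⟨fun v hv ↦ ?_, fun j hij v hv ↦ ?_, fun v hv ↦ ?_⟩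
      · obtain ⟨u, rfl⟩ := (hmem i v).1 hv
        rw [hκ]
      · obtain ⟨u, rfl⟩ := (hmem j v).1 hv
        rw [hκ' i j hij.symm]
      · rw [← mulVec_mulVec, h3 i v hv, mulVec_zero]
  · ext a b
    have := G.constituent_orthogonal n i j hij _ (hφ i (Pi.single a 1)) _ (hφ j (Pi.single b 1))
    rw [mulVec_mulVec, dotProduct_comm, dotProduct_mulVec, ← mulVec_transpose,
      mulVec_mulVec, ← Matrix.mul_assoc] at this
    simpa using this
  · refine ext_iff_mulVec.2 fun u ↦ ?_
    have := G.constituent_compat n i h.1 h.2 h'.1 h'.2 _ (hφ i u)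
    obtain ⟨w, hw⟩ := (hmem i _).1 this
    have h4 : (h'.1.1 * φ i * twist (ε i) h.1.1) *ᵥ u = φ i *ᵥ w := by
      rw [hw, mulVec_mulVec, mulVec_mulVec, Matrix.mul_assoc h'.1.1 (G.δ n h.1).1,
        hδ, ← Matrix.mul_assoc]
    rw [← mulVec_mulVec, h4, mulVec_mulVec, Matrix.mul_assoc, h1, Matrix.mul_one]

end DiagonalIndGroup

/-! ### The components of the embedding -/

namespace DiagonalIndGroup

open Matrix _root_.Module ClassicalType LieAlgebra CartanPair

section twist

variable {K ι : Type*} [Field K]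

lemma twist_twist (ε : Bool) (x : Matrix ι ι K) : twist ε (twist ε x) = x := by
  cases ε
  · rfl
  · simp [twist_true]

lemma twist_one [DecidableEq ι] (ε : Bool) :
    twist ε (1 : Matrix ι ι K) = bif ε then -1 else 1 := by
  cases ε
  · rfl
  · simp [twist_true]

end twist

namespace StepData

variable {K : Type*} [Field K] {G : DiagonalIndGroup K} {n : ℕ} (D : G.StepData n)
  (i j : Fin (G.s n))

/-- The `i`-th component of the embedding, on all matrices. -/
def component : Matrix (G.type.Idx (G.rank n)) (G.type.Idx (G.rank n)) K →ₗ[K]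
    Matrix (G.type.Idx (G.rank (n + 1))) (G.type.Idx (G.rank (n + 1))) K where
  toFun x := D.φ i * twist (D.ε i) x * D.ψ i
  map_add' x y := by rw [map_add, Matrix.mul_add, Matrix.add_mul]
  map_smul' c x := by simp

lemma component_apply (x) : D.component i x = D.φ i * twist (D.ε i) x * D.ψ i := rfl

lemma ψ_mul_component (x) : D.ψ i * D.component i x = twist (D.ε i) x * D.ψ i := by
  rw [component_apply, ← Matrix.mul_assoc, ← Matrix.mul_assoc, D.ψ_mul_φ, Matrix.one_mul]

lemma component_mul_φ (x) : D.component i x * D.φ i = D.φ i * twist (D.ε i) x := by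
  rw [component_apply, Matrix.mul_assoc _ (D.ψ i), D.ψ_mul_φ, Matrix.mul_one]

variable {i j} in
lemma ψ_mul_component_of_ne (hij : i ≠ j) (x) : D.ψ i * D.component j x = 0 := by
  rw [component_apply, ← Matrix.mul_assoc, ← Matrix.mul_assoc, D.ψ_mul_φ_of_ne i j hij,
    Matrix.zero_mul, Matrix.zero_mul]

variable {i j} in
lemma component_mul_φ_of_ne (hij : i ≠ j) (x) : D.component i x * D.φ j = 0 := by
  rw [component_apply, Matrix.mul_assoc _ (D.ψ i), D.ψ_mul_φ_of_ne i j hij, Matrix.mul_zero]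

lemma component_mul_component (x y) : D.component i x * D.component i y =
    D.φ i * (twist (D.ε i) x * twist (D.ε i) y) * D.ψ i := by
  rw [component_apply D i x, Matrix.mul_assoc _ (D.ψ i), ψ_mul_component]
  simp only [Matrix.mul_assoc]

lemma component_lie (x y) : D.component i (x * y - y * x) =
    D.component i x * D.component i y - D.component i y * D.component i x := by
  rw [component_mul_component, component_mul_component, component_apply, twist_lie,
    Matrix.mul_sub, Matrix.sub_mul]

variable {i j} in
lemma component_mul_component_of_ne (hij : i ≠ j) (x y) :
    D.component i x * D.component j y = 0 := by
  rw [component_apply D i x, Matrix.mul_assoc _ (D.ψ i), ψ_mul_component_of_ne D hij,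
    Matrix.mul_zero]

lemma trace_component_mul_component (x y) :
    (D.component i x * D.component i y).trace = (x * y).trace := by
  rw [component_mul_component, Matrix.trace_mul_cycle, D.ψ_mul_φ, Matrix.one_mul,
    trace_twist_mul]

lemma δ_eq_sum (x : G.g n) : (G.δ n x).1 = ∑ j, D.component j x.1 := D.δ_eq x

lemma trace_component_mul_δ (x) (y : G.g n) :
    (D.component i x * (G.δ n y).1).trace = (x * y.1).trace := by
  rw [D.δ_eq_sum, Matrix.mul_sum, Finset.sum_eq_single i, trace_component_mul_component]
  · intro j _ hj
    exact component_mul_component_of_ne D hj.symm _ _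
  · simp

lemma component_eq_zero {x} (h : D.component i x = 0) : x = 0 := by
  have := D.ψ_mul_component i x
  rw [h, Matrix.mul_zero] at this
  rw [← twist_twist (D.ε i) x, ← Matrix.mul_one (twist (D.ε i) x), ← D.ψ_mul_φ i,
    ← Matrix.mul_assoc, ← this, Matrix.zero_mul, map_zero]

lemma isComponent_iff_eq {x : G.g n} {y : G.g (n + 1)} :
    G.IsComponent n i x y ↔ y.1 = D.component i x.1 := D.isComponent_iff i x y

lemma δ_mul_φ (x : G.g n) : (G.δ n x).1 * D.φ i = D.φ i * twist (D.ε i) x.1 := by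
  rw [D.δ_eq_sum, Matrix.sum_mul, Finset.sum_eq_single i, component_mul_φ]
  · intro j _ hj
    exact component_mul_φ_of_ne D hj _
  · simp

lemma ψ_mul_δ (x : G.g n) : D.ψ i * (G.δ n x).1 = twist (D.ε i) x.1 * D.ψ i := by
  rw [D.δ_eq_sum, Matrix.mul_sum, Finset.sum_eq_single i, ψ_mul_component]
  · intro j _ hj
    exact ψ_mul_component_of_ne D hj.symm _
  · simp

variable [CharZero K] [IsAlgClosed K]

lemma twist_eq_self (hX : G.type ≠ ClassicalType.A)
    (x : Matrix (G.type.Idx (G.rank n)) (G.type.Idx (G.rank n)) K) : twist (D.ε i) x = x := by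
  rw [D.ε_eq hX, twist_false]

/-- The form on a constituent is a multiple of the form on the natural representation. -/
lemma exists_form_eq_smul (hX : G.type ≠ ClassicalType.A) : ∃ c : K, c ≠ 0 ∧
    ∀ x : G.g n, x.1ᵀ * ((D.φ i)ᵀ * G.type.form K (G.rank (n + 1))) =
      c • (x.1ᵀ * (G.type.form K (G.rank n) * D.ψ i)) := by
  set F := G.type.form K (G.rank n)
  set F' := G.type.form K (G.rank (n + 1))
  have hδφ (j) (x : G.g n) : (G.δ n x).1 * D.φ j = D.φ j * x.1 := by
    rw [δ_mul_φ, twist_eq_self D j hX]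
  -- Multiplication by xᵀ replaces the form on the whole of V_{n+1} by its composite with δ(x),
  -- which kills the trivial part; no orthogonality to the trivial part is needed.
  have hskew (x : G.g n) : x.1ᵀ * ((D.φ i)ᵀ * F') = -((D.φ i)ᵀ * F' * (G.δ n x).1) := by
    rw [← Matrix.mul_assoc, ← transpose_mul, ← hδφ, transpose_mul, Matrix.mul_assoc,
      (mem_lieAlg hX).1 (G.δ n x).2, Matrix.mul_neg, Matrix.mul_assoc]
  obtain ⟨U, hU⟩ : IsUnit F := isUnit_form hX
  have hU1 : (U⁻¹).1 * F = 1 := by rw [← hU, U.inv_mul]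
  have hU2 : F * (U⁻¹).1 = 1 := by rw [← hU, U.mul_inv]
  -- Schur's lemma: the pulled back form φᵀF'φ is invariant, so F⁻¹φᵀF'φ commutes with 𝔤_n.
  obtain ⟨c, hc⟩ := exists_eq_smul_one_of_commute (G.minRank_le n)
    (M := (U⁻¹).1 * ((D.φ i)ᵀ * F' * D.φ i)) (fun x hx ↦ by
      have h1 := hskew ⟨x, hx⟩
      have h2 : (U⁻¹).1 * xᵀ = -(x * (U⁻¹).1) := by
        calc (U⁻¹).1 * xᵀ = (U⁻¹).1 * (xᵀ * F) * (U⁻¹).1 := by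
              rw [mul_assoc, mul_assoc, hU2, mul_one]
          _ = -(x * (U⁻¹).1) := by
              rw [(mem_lieAlg hX).1 hx, mul_neg, ← mul_assoc, hU1, one_mul, neg_mul]
      have h3 : (D.φ i)ᵀ * F' * D.φ i * x = -(xᵀ * ((D.φ i)ᵀ * F' * D.φ i)) := by
        rw [← Matrix.mul_assoc xᵀ, h1, Matrix.mul_assoc, ← hδφ i ⟨x, hx⟩, Matrix.neg_mul, neg_neg,
          Matrix.mul_assoc _ (G.δ n ⟨x, hx⟩).1]
      rw [mul_assoc, h3, mul_neg, ← mul_assoc, h2, neg_mul, neg_neg, mul_assoc])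
  have hN : (D.φ i)ᵀ * F' * D.φ i = c • F := by
    rw [← Matrix.one_mul ((D.φ i)ᵀ * F' * D.φ i), ← hU2, Matrix.mul_assoc, hc, Matrix.mul_smul,
      Matrix.mul_one]
  have hmain (x : G.g n) : x.1ᵀ * ((D.φ i)ᵀ * F') = c • (x.1ᵀ * (F * D.ψ i)) := by
    rw [hskew, D.δ_eq_sum, Matrix.mul_sum, Finset.sum_eq_single i]
    · rw [component_apply, twist_eq_self D i hX, ← Matrix.mul_assoc, ← Matrix.mul_assoc, hN,
        Matrix.smul_mul, Matrix.smul_mul, ← Matrix.mul_assoc, (mem_lieAlg hX).1 x.2,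
        Matrix.neg_mul, smul_neg]
    · intro j _ hj
      rw [component_apply, ← Matrix.mul_assoc, ← Matrix.mul_assoc,
        D.transpose_φ_mul hX i j hj.symm, Matrix.zero_mul, Matrix.zero_mul]
    · simp
  refine ⟨c, ?_, hmain⟩
  rintro rfl
  obtain ⟨h, hh⟩ := exists_cartan_ne_zero (H := G.cartan n) (G.minRank_le n)
  have h1 := hmain h.1
  rw [zero_smul, ← Matrix.mul_assoc, ← transpose_mul] at h1
  have hF' : IsUnit F' := isUnit_form hX
  obtain ⟨V, hV⟩ := hF'
  have h2 : (D.φ i * h.1.1)ᵀ = 0 := by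
    rw [← Matrix.mul_one (D.φ i * h.1.1)ᵀ, ← V.mul_inv, hV, ← Matrix.mul_assoc, h1,
      Matrix.zero_mul]
  rw [transpose_eq_zero] at h2
  refine hh ?_
  rw [← Matrix.one_mul h.1.1, ← D.ψ_mul_φ i, Matrix.mul_assoc, h2, Matrix.mul_zero]

lemma form_mul_φ_mul {hX : G.type ≠ ClassicalType.A} {c : K}
    (hc : ∀ x : G.g n, x.1ᵀ * ((D.φ i)ᵀ * G.type.form K (G.rank (n + 1))) =
      c • (x.1ᵀ * (G.type.form K (G.rank n) * D.ψ i))) (x : G.g n) :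
    G.type.form K (G.rank (n + 1)) * D.φ i * x.1 =
      c • ((D.ψ i)ᵀ * G.type.form K (G.rank n) * x.1) := by
  have h := congrArg transpose (hc x)
  simp only [transpose_mul, transpose_smul, transpose_transpose, form_transpose hX,
    Matrix.smul_mul, Matrix.mul_smul] at h
  have hs := sign_mul_self (K := K) G.type
  have h' := congrArg (fun z ↦ G.type.sign K • z) h
  simp only [smul_smul, hs, one_smul] at h'
  rw [h', mul_comm c, ← mul_assoc, hs, one_mul]

/-- The components of the embedding take values in `𝔤_{n+1}`. -/
lemma component_mem (x : G.g n) : D.component i x.1 ∈ G.g (n + 1) := by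
  by_cases hX : G.type = ClassicalType.A
  · rw [mem_lieAlg_A hX, component_apply, Matrix.trace_mul_comm, ← Matrix.mul_assoc, D.ψ_mul_φ,
      Matrix.one_mul]
    cases D.ε i
    · exact trace_eq_zero x.2
    · rw [twist_true, trace_neg, trace_transpose, trace_eq_zero x.2, neg_zero]
  · obtain ⟨c, -, hc⟩ := D.exists_form_eq_smul i hX
    rw [mem_lieAlg hX, component_apply, twist_eq_self D i hX, transpose_mul, transpose_mul,
      Matrix.mul_assoc, Matrix.mul_assoc, hc, ← Matrix.mul_assoc _ (D.φ i * x.1),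
      ← Matrix.mul_assoc _ (D.φ i) x.1, D.form_mul_φ_mul (hX := hX) i hc, Matrix.mul_smul,
      Matrix.smul_mul, ← Matrix.mul_assoc x.1ᵀ, (mem_lieAlg hX).1 x.2]
    simp only [Matrix.neg_mul, Matrix.mul_neg, smul_neg, Matrix.mul_assoc]

/-- The components as elements of `𝔤_{n+1}`. -/
def componentMap : G.g n →ₗ[K] G.g (n + 1) :=
  ((D.component i).comp (G.g n).toSubmodule.subtype).codRestrict (G.g (n + 1)).toSubmodule
    (D.component_mem i)

lemma coe_componentMap (x : G.g n) : (D.componentMap i x).1 = D.component i x.1 := rfl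

lemma componentMap_lie (x y : G.g n) :
    D.componentMap i ⁅x, y⁆ = ⁅D.componentMap i x, D.componentMap i y⁆ :=
  Subtype.ext (D.component_lie i x.1 y.1)

lemma δ_eq_sum_componentMap (x : G.g n) : G.δ n x = ∑ j, D.componentMap j x := by
  refine Subtype.ext ?_
  rw [D.δ_eq_sum, AddSubmonoidClass.coe_finsetSum]
  rfl

end StepData

end DiagonalIndGroup

/-! ### The action of 𝔥_{n+1} on a component -/

namespace DiagonalIndGroup

open Matrix _root_.Module ClassicalType LieAlgebra CartanPair

namespace StepData

variable {K : Type*} [Field K] [CharZero K] [IsAlgClosed K] {G : DiagonalIndGroup K} {n : ℕ}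
  (D : G.StepData n) (i : Fin (G.s n))

lemma exists_cartanProj_eq_twist : ∃ (h₀ : G.cartan n) (q : _),
    cartanProj (G.minRank_le n) (G.cartan n) = twist (D.ε i) h₀.1.1 * q ∧
    cartanProj (G.minRank_le n) (G.cartan n) = q * twist (D.ε i) h₀.1.1 := by
  obtain ⟨h₀, q, h1, h2⟩ := exists_cartanProj_eq (H := G.cartan n) (G.minRank_le n)
  by_cases hX : G.type = ClassicalType.A
  · have hp := cartanProj_eq_one (H := G.cartan n) (G.minRank_le n)
      (by rw [hX]; exact fun h ↦ by cases h)
    cases hε : D.ε i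
    · exact ⟨h₀, q, h1, h2⟩
    · rw [hp] at h1 h2
      refine ⟨h₀, -qᵀ, ?_, ?_⟩
      · rw [hp, twist_true, neg_mul_neg, ← transpose_mul, ← h2, transpose_one]
      · rw [hp, twist_true, neg_mul_neg, ← transpose_mul, ← h1, transpose_one]
  · exact ⟨h₀, q, by rwa [twist_eq_self D i hX], by rwa [twist_eq_self D i hX]⟩

lemma twist_mul_cartanProj {x : G.g n}
    (hx : x ∈ zeroWeightAnnihilator (G.minRank_le n) (G.cartan n)) :
    twist (D.ε i) x.1 * cartanProj (G.minRank_le n) (G.cartan n) = twist (D.ε i) x.1 := by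
  by_cases hX : G.type = ClassicalType.A
  · rw [cartanProj_eq_one (H := G.cartan n) (G.minRank_le n)
      (by rw [hX]; exact fun h ↦ by cases h), mul_one]
  · rw [twist_eq_self D i hX]
    exact hx

lemma cartanProj_mul_twist {x : G.g n}
    (hx : x ∈ zeroWeightAnnihilator (G.minRank_le n) (G.cartan n)) :
    cartanProj (G.minRank_le n) (G.cartan n) * twist (D.ε i) x.1 = twist (D.ε i) x.1 := by
  by_cases hX : G.type = ClassicalType.A
  · rw [cartanProj_eq_one (H := G.cartan n) (G.minRank_le n)
      (by rw [hX]; exact fun h ↦ by cases h), one_mul]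
  · rw [twist_eq_self D i hX]
    exact cartanProj_mul_of_mem _ hx

/-- The block of an element of `𝔥_{n+1}` on a constituent commutes with `𝔥_n`. -/
lemma block_mul_twist (h' : G.cartan (n + 1)) (h : G.cartan n) :
    D.ψ i * h'.1.1 * D.φ i * twist (D.ε i) h.1.1 =
      twist (D.ε i) h.1.1 * (D.ψ i * h'.1.1 * D.φ i) := by
  have hcomm : (G.δ n h.1).1 * h'.1.1 = h'.1.1 * (G.δ n h.1).1 :=
    cartan_mul_comm (G.minRank_le (n + 1)) (G.cartanMap n h) h'
  rw [Matrix.mul_assoc _ (D.φ i), ← δ_mul_φ, ← Matrix.mul_assoc, ← Matrix.mul_assoc,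
    ← Matrix.mul_assoc, ← ψ_mul_δ, Matrix.mul_assoc (D.ψ i), ← hcomm, ← Matrix.mul_assoc]

lemma block_mul_cartanProj (h' : G.cartan (n + 1)) :
    D.ψ i * h'.1.1 * D.φ i * cartanProj (G.minRank_le n) (G.cartan n) =
      cartanProj (G.minRank_le n) (G.cartan n) * (D.ψ i * h'.1.1 * D.φ i) := by
  by_cases hX : G.type = ClassicalType.A
  · rw [cartanProj_eq_one (H := G.cartan n) (G.minRank_le n)
      (by rw [hX]; exact fun h ↦ by cases h), mul_one, one_mul]
  · refine mul_cartanProj_comm _ fun h ↦ ?_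
    have := D.block_mul_twist i h' h
    rwa [twist_eq_self D i hX] at this

/-- Only the nonzero weight part of a constituent is assumed stable under 𝔥_{n+1}; therefore the
projection has to appear. -/
lemma mul_φ_mul_cartanProj (h' : G.cartan (n + 1)) :
    h'.1.1 * D.φ i * cartanProj (G.minRank_le n) (G.cartan n) =
      D.φ i * (D.ψ i * h'.1.1 * D.φ i * cartanProj (G.minRank_le n) (G.cartan n)) := by
  obtain ⟨h₀, q, h1, -⟩ := D.exists_cartanProj_eq_twist i
  rw [h1, ← Matrix.mul_assoc, ← D.compat i h₀ h']
  simp only [Matrix.mul_assoc]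

/-- The dual of stability: since δ(h₀) commutes with h' and the nonzero weight parts of the other
constituents are stable, ψ_i h' receives nothing from outside the i-th constituent after projection.
-/
lemma cartanProj_mul_ψ_mul (h' : G.cartan (n + 1)) :
    cartanProj (G.minRank_le n) (G.cartan n) * (D.ψ i * h'.1.1) =
      D.ψ i * h'.1.1 * D.φ i * cartanProj (G.minRank_le n) (G.cartan n) * D.ψ i := by
  obtain ⟨h₀, q, -, h1⟩ := D.exists_cartanProj_eq_twist i
  have hcomm : (G.δ n h₀.1).1 * h'.1.1 = h'.1.1 * (G.δ n h₀.1).1 :=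
    cartan_mul_comm (G.minRank_le (n + 1)) (G.cartanMap n h₀) h'
  have h2 : twist (D.ε i) h₀.1.1 * (D.ψ i * h'.1.1) =
      twist (D.ε i) h₀.1.1 * (D.ψ i * h'.1.1 * D.φ i) * D.ψ i := by
    rw [← Matrix.mul_assoc, ← ψ_mul_δ, Matrix.mul_assoc, hcomm, D.δ_eq_sum, Matrix.mul_sum,
      Matrix.mul_sum, Finset.sum_eq_single i, ← block_mul_twist, component_apply]
    · simp only [Matrix.mul_assoc]
    · intro j _ hj
      rw [component_apply, ← Matrix.mul_assoc h'.1.1, ← Matrix.mul_assoc h'.1.1, ← D.compat j h₀ h',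
        ← Matrix.mul_assoc, ← Matrix.mul_assoc, ← Matrix.mul_assoc,
        ← Matrix.mul_assoc (D.ψ i) (D.φ j), D.ψ_mul_φ_of_ne i j hj.symm]
      simp only [Matrix.zero_mul]
    · simp
  rw [block_mul_cartanProj, h1, Matrix.mul_assoc, h2]
  simp only [Matrix.mul_assoc]

/-- The block of h' commutes with 𝔥_n. In type A its traceless part therefore lies in 𝔥_n, up to the
twist, and a scalar remains. In the other types the projected block is skew for the form, hence lies
in 𝔤_n and so in 𝔥_n, with c = 0. -/
lemma exists_block_eq_twist (h' : G.cartan (n + 1)) : ∃ (T : G.cartan n) (c : K),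
    D.ψ i * h'.1.1 * D.φ i * cartanProj (G.minRank_le n) (G.cartan n) =
      twist (D.ε i) T.1.1 + c • 1 := by
  set M := D.ψ i * h'.1.1 * D.φ i with hM
  set p := cartanProj (G.minRank_le n) (G.cartan n) with hp
  have hMp : M * p = p * M := D.block_mul_cartanProj i h'
  by_cases hX : G.type = ClassicalType.A
  · have hp1 : p = 1 := cartanProj_eq_one (H := G.cartan n) (G.minRank_le n)
      (by rw [hX]; exact fun h ↦ by cases h)
    rw [hp1, mul_one]
    have hcard : (Fintype.card (G.type.Idx (G.rank n)) : K) ≠ 0 := by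
      have := two_le_card (G.minRank_le n)
      exact_mod_cast (by omega)
    obtain ⟨c, hc⟩ : ∃ c : K, (twist (D.ε i) M - c • 1).trace = 0 :=
      ⟨(twist (D.ε i) M).trace / Fintype.card (G.type.Idx (G.rank n)), by
        rw [trace_sub, trace_smul, trace_one, smul_eq_mul, div_mul_cancel₀ _ hcard, sub_self]⟩
    have hcomm (h : G.cartan n) : h.1.1 * twist (D.ε i) M = twist (D.ε i) M * h.1.1 := by
      have := D.block_mul_twist i h' h
      rw [← hM, ← sub_eq_zero] at this
      have := congrArg (twist (D.ε i)) this
      rwa [twist_lie, twist_twist, map_zero, sub_eq_zero, eq_comm] at this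
    have hT : (⟨_, (mem_lieAlg_A hX).2 hc⟩ : G.g n) ∈ G.cartan n :=
      mem_cartan_of_commute fun h ↦ by
        change h.1.1 * (twist (D.ε i) M - c • 1) = (twist (D.ε i) M - c • 1) * h.1.1
        rw [mul_sub, sub_mul, hcomm]
        simp
    refine ⟨⟨_, hT⟩, bif D.ε i then -c else c, ?_⟩
    change M = twist (D.ε i) (twist (D.ε i) M - c • 1) + _
    rw [map_sub, twist_twist, map_smul, twist_one]
    cases D.ε i <;> simp
  · obtain ⟨c, hc0, hc⟩ := D.exists_form_eq_smul i hX
    obtain ⟨h₀, q, h1, -⟩ := exists_cartanProj_eq (H := G.cartan n) (G.minRank_le n)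
    set F := G.type.form K (G.rank n) with hF
    set F' := G.type.form K (G.rank (n + 1)) with hF'
    have hpF : pᵀ * F = F * p := transpose_cartanProj_mul_form _ hX
    have hpp : p * p = p := cartanProj_mul_self _
    have h3 : c • (pᵀ * (F * D.ψ i)) = pᵀ * ((D.φ i)ᵀ * F') := by
      rw [hp, h1, transpose_mul, Matrix.mul_assoc, Matrix.mul_assoc, hc, Matrix.mul_smul]
    have h4 : c • (F * (M * p)) = pᵀ * ((D.φ i)ᵀ * (F' * (h'.1.1 * (D.φ i * p)))) := by
      have : M * p = p * (M * p) := by rw [← mul_assoc, ← hMp, mul_assoc, hpp]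
      rw [this, ← mul_assoc, ← hpF, hM]
      have h5 := congrArg (fun z ↦ z * (h'.1.1 * (D.φ i * p))) h3
      simp only [Matrix.smul_mul, Matrix.mul_assoc] at h5 ⊢
      exact h5
    have hh' := (mem_lieAlg hX).1 h'.1.2
    have h6 : (M * p)ᵀ * F = -(F * (M * p)) := by
      have h7 := congrArg transpose h4
      simp only [transpose_smul, transpose_mul, transpose_transpose, hF, hF',
        form_transpose hX, Matrix.mul_smul, Matrix.smul_mul, Matrix.mul_assoc] at h7
      rw [smul_comm, ← Matrix.mul_assoc h'.1.1ᵀ, hh'] at h7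
      have h8 : c • ((M * p)ᵀ * F) = c • -(F * (M * p)) := by
        have hs : G.type.sign K ≠ 0 := left_ne_zero_of_mul_eq_one (ClassicalType.sign_mul_self _)
        rw [transpose_mul, Matrix.mul_assoc, smul_neg, h4, hF, smul_right_injective _ hs h7]
        simp only [Matrix.neg_mul, Matrix.mul_neg, Matrix.mul_assoc, hF']
      exact smul_right_injective _ hc0 h8
    have hT : (⟨M * p, (mem_lieAlg hX).2 h6⟩ : G.g n) ∈ G.cartan n :=
      mem_cartan_of_commute fun h ↦ by
        have := D.block_mul_twist i h' h
        rw [twist_eq_self D i hX, ← hM] at this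
        change h.1.1 * (M * p) = M * p * h.1.1
        rw [mul_assoc M, cartanProj_mul, this, ← mul_assoc, ← this, mul_assoc, mul_cartanProj,
          this]
    exact ⟨⟨_, hT⟩, 0, by rw [twist_eq_self D i hX, zero_smul, add_zero]⟩

/-- An element of `𝔥_{n+1}` acts on a component through an element of `𝔥_n`. -/
lemma exists_cartan_lie (h' : G.cartan (n + 1)) : ∃ T : G.cartan n,
    ∀ x ∈ zeroWeightAnnihilator (G.minRank_le n) (G.cartan n),
      h'.1.1 * D.component i x.1 - D.component i x.1 * h'.1.1 =
        D.component i (T.1.1 * x.1 - x.1 * T.1.1) := by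
  obtain ⟨T, c, hT⟩ := D.exists_block_eq_twist i h'
  refine ⟨T, fun x hx ↦ ?_⟩
  have h1 := D.mul_φ_mul_cartanProj i h'
  have h2 := D.cartanProj_mul_ψ_mul i h'
  rw [hT] at h1 h2
  have h3 : h'.1.1 * D.component i x.1 =
      D.φ i * ((twist (D.ε i) T.1.1 + c • 1) * twist (D.ε i) x.1) * D.ψ i := by
    rw [component_apply, ← D.cartanProj_mul_twist i hx, ← Matrix.mul_assoc, ← Matrix.mul_assoc,
      ← Matrix.mul_assoc, h1]
    simp only [Matrix.mul_assoc]
    rw [← Matrix.mul_assoc (cartanProj _ _) (twist _ _), D.cartanProj_mul_twist i hx]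
  have h4 : D.component i x.1 * h'.1.1 =
      D.φ i * (twist (D.ε i) x.1 * (twist (D.ε i) T.1.1 + c • 1)) * D.ψ i := by
    rw [component_apply, ← D.twist_mul_cartanProj i hx, Matrix.mul_assoc _ (D.ψ i),
      ← Matrix.mul_assoc (D.φ i), Matrix.mul_assoc _ (cartanProj _ _), h2]
    simp only [Matrix.mul_assoc]
    rw [← Matrix.mul_assoc (twist _ _) (cartanProj _ _), D.twist_mul_cartanProj i hx]
  have h5 (A B : Matrix (G.type.Idx (G.rank n)) (G.type.Idx (G.rank n)) K) :
      (A + c • 1) * B - B * (A + c • 1) = A * B - B * A := by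
    rw [add_mul, mul_add]
    simp
  rw [h3, h4, component_apply, twist_lie, ← Matrix.sub_mul, ← Matrix.mul_sub, h5]

end StepData

end DiagonalIndGroup

/-! ### Transport of weights, roots and coroots along a component -/

namespace DiagonalIndGroup

open Matrix _root_.Module ClassicalType LieAlgebra CartanPair

namespace StepData

variable {K : Type*} [Field K] [CharZero K] [IsAlgClosed K] {G : DiagonalIndGroup K} {n : ℕ}
  (D : G.StepData n) (i j : Fin (G.s n))

/-- The elements of `𝔥_n` as matrices. -/
def cartanMatrix (G : DiagonalIndGroup K) (n : ℕ) :
    G.cartan n →ₗ[K] Matrix (G.type.Idx (G.rank n)) (G.type.Idx (G.rank n)) K :=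
  (G.g n).toSubmodule.subtype ∘ₗ (G.cartan n).toSubmodule.subtype

/-- The map `𝔥_n^* → 𝔥_{n+1}^*` induced by a component of the embedding and the trace forms. -/
noncomputable def push : G.hDual n →ₗ[K] G.hDual (n + 1) :=
  ((LinearMap.mul K _).compr₂ (traceLinearMap _ K K)).compl₁₂
    (D.component i ∘ₗ cartanMatrix G n ∘ₗ
      (cartanTraceEquiv (G.minRank_le n) (G.cartan n)).symm.toLinearMap)
    (cartanMatrix G (n + 1))

lemma push_apply (μ : G.hDual n) (h' : G.cartan (n + 1)) : D.push i μ h' =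
    (D.component i ((cartanTraceEquiv (G.minRank_le n) (G.cartan n)).symm μ).1.1 *
      h'.1.1).trace := rfl

/-- The map `𝔥_{n+1}^* → 𝔥_n^*` induced by a component of the embedding and the trace forms. -/
noncomputable def pull : G.hDual (n + 1) →ₗ[K] G.hDual n :=
  ((LinearMap.mul K _).compr₂ (traceLinearMap _ K K)).compl₁₂
    (cartanMatrix G (n + 1) ∘ₗ
      (cartanTraceEquiv (G.minRank_le (n + 1)) (G.cartan (n + 1))).symm.toLinearMap)
    (D.component i ∘ₗ cartanMatrix G n)

lemma pull_apply_of_eq (ν : G.hDual (n + 1)) {h : G.cartan n} {h' : G.cartan (n + 1)}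
    (hh : h'.1 = D.componentMap i h.1) : D.pull i ν h = ν h' := by
  rw [← trace_cartanTraceEquiv_symm (G.minRank_le (n + 1)) ν h', hh]
  rfl

/-- Products of different components vanish, so pairing the i-th component of one element with δ of
another gives back the trace form of 𝔤_n. -/
lemma restrict_push (μ : G.hDual n) : G.restrict n (D.push i μ) = μ := by
  ext h
  exact (D.trace_component_mul_δ i _ h.1).trans
    (trace_cartanTraceEquiv_symm (G.minRank_le n) μ h)

lemma push_injective : Function.Injective (D.push i) :=
  Function.LeftInverse.injective (D.restrict_push i)

lemma push_apply_of_eq (μ : G.hDual n) {h : G.cartan n} {h' : G.cartan (n + 1)}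
    (hh : h'.1 = D.componentMap i h.1) : D.push i μ h' = μ h := by
  rw [push_apply, hh, coe_componentMap, trace_component_mul_component,
    trace_cartanTraceEquiv_symm]

variable {i j} in
lemma push_apply_of_ne (hij : i ≠ j) (μ : G.hDual n) {h : G.cartan n} {h' : G.cartan (n + 1)}
    (hh : h'.1 = D.componentMap j h.1) : D.push i μ h' = 0 := by
  rw [push_apply, hh, coe_componentMap, component_mul_component_of_ne D hij, trace_zero]

/-- The value of `push` on a root, computed by root vectors. -/
lemma push_apply_mul_trace {α : G.hDual n} {x f : G.g n} (hx : x ∈ rootSpace (G.cartan n) α)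
    (hf : f ∈ rootSpace (G.cartan n) (-α)) (h' : G.cartan (n + 1)) :
    (x.1 * f.1).trace * D.push i α h' = (D.component i f.1 *
      (h'.1.1 * D.component i x.1 - D.component i x.1 * h'.1.1)).trace := by
  have h1 := lie_eq_trace_smul (G.minRank_le n) hx hf
  rw [push_apply, ← smul_eq_mul, ← trace_smul, ← Matrix.smul_mul, ← map_smul, ← h1,
    component_lie, Matrix.trace_mul_comm, ← trace_lie_mul, Matrix.trace_mul_comm]

/-- The target root is determined by the source: both sides are computed from the trace of the image
of f against the commutator of h' with the image of x, where tr(x f) ≠ 0. -/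
lemma eq_push_of_rootMapsTo {α : G.hDual n} {β : G.hDual (n + 1)} (h : G.RootMapsTo n i α β) :
    β = D.push i α := by
  have := isKilling (K := K) (G.minRank_le n)
  obtain ⟨hα, hβ, hαβ⟩ := h
  obtain ⟨x, hx, hx0⟩ := hα.exists_ne_zero
  obtain ⟨f, hf, hxf⟩ := exists_trace_mul_ne_zero (G.minRank_le n) hx hx0
  obtain ⟨y, hy, hxy⟩ := hαβ x hx
  rw [isComponent_iff_eq D] at hxy
  ext h'
  have h1 := D.push_apply_mul_trace i hx hf h'
  rw [Matrix.trace_mul_comm] at hxf h1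
  rw [← hxy, lie_cartan_eq (G.minRank_le (n + 1)) hy h', Matrix.mul_smul, trace_smul, hxy,
    trace_component_mul_component, smul_eq_mul, mul_comm] at h1
  exact (mul_right_cancel₀ hxf h1).symm

lemma push_ne_zero {α : G.hDual n} (hα : α ≠ 0) : D.push i α ≠ 0 := by
  rw [← map_zero (D.push i)]
  exact (D.push_injective i).ne hα

lemma rootMapsTo_of_forall_mem {α : G.hDual n} (hα : IsRoot (G.cartan n) α)
    (h : ∀ x ∈ rootSpace (G.cartan n) α,
      D.componentMap i x ∈ rootSpace (G.cartan (n + 1)) (D.push i α)) :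
    G.RootMapsTo n i α (D.push i α) := by
  have := isKilling (K := K) (G.minRank_le n)
  obtain ⟨x, hx, hx0⟩ := hα.exists_ne_zero
  refine ⟨hα, ⟨D.push_ne_zero i hα.1, fun hbot ↦ hx0 ?_⟩, fun x hx ↦ ⟨_, h x hx,
    (D.isComponent_iff_eq i).2 rfl⟩⟩
  have h1 := h x hx
  rw [hbot, LieSubmodule.mem_bot] at h1
  exact Subtype.ext (D.component_eq_zero i (congrArg Subtype.val h1))

/-- If the root space of `α` kills the zero weight space of the natural representation, then every
component maps it into a root space. -/
lemma rootMapsTo_push {α : G.hDual n} (hα : IsRoot (G.cartan n) α)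
    (h : ∀ x ∈ rootSpace (G.cartan n) α,
      x ∈ zeroWeightAnnihilator (G.minRank_le n) (G.cartan n)) :
    G.RootMapsTo n i α (D.push i α) := by
  have := isKilling (K := K) (G.minRank_le n)
  have := isKilling (K := K) (G.minRank_le (n + 1))
  refine D.rootMapsTo_of_forall_mem i hα fun x hx ↦ mem_rootSpace_of_forall_lie fun h' ↦ ?_
  rcases eq_or_ne x 0 with rfl | hx0
  · simp
  obtain ⟨f, hf, hxf⟩ := exists_trace_mul_ne_zero (G.minRank_le n) hx hx0
  obtain ⟨T, hT⟩ := D.exists_cartan_lie i h'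
  have h1 := D.push_apply_mul_trace i hx hf h'
  have h2 := hT x (h x hx)
  rw [lie_cartan_eq (G.minRank_le n) hx T] at h2
  rw [Matrix.trace_mul_comm] at hxf h1
  rw [h2, trace_component_mul_component, Matrix.mul_smul, trace_smul, smul_eq_mul, mul_comm] at h1
  rw [mul_right_cancel₀ hxf h1]
  refine Subtype.ext ?_
  change _ - _ = α T • D.component i x.1
  rw [← map_smul, ← h2]
  rfl

/-- The `i`-th component maps the root spaces of `α` and `-α` into root spaces. -/
def IsGood (α : G.hDual n) : Prop :=
  G.RootMapsTo n i α (D.push i α) ∧ G.RootMapsTo n i (-α) (-D.push i α)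

variable {D i}

lemma IsGood.neg {α : G.hDual n} (h : D.IsGood i α) : D.IsGood i (-α) := by
  refine ⟨?_, ?_⟩
  · rw [map_neg]
    exact h.2
  · rw [map_neg, neg_neg, neg_neg]
    exact h.1

lemma IsGood.isRoot {α : G.hDual n} (h : D.IsGood i α) : IsRoot (G.cartan n) α := h.1.1

lemma IsGood.isRoot_push {α : G.hDual n} (h : D.IsGood i α) :
    IsRoot (G.cartan (n + 1)) (D.push i α) := h.1.2.1

lemma IsGood.componentMap_mem {α : G.hDual n} (h : D.IsGood i α) {x : G.g n}
    (hx : x ∈ rootSpace (G.cartan n) α) :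
    D.componentMap i x ∈ rootSpace (G.cartan (n + 1)) (D.push i α) := by
  obtain ⟨y, hy, hxy⟩ := h.1.2.2 x hx
  rw [isComponent_iff_eq D] at hxy
  rwa [show D.componentMap i x = y from Subtype.ext hxy.symm]

variable (D i) in
lemma isGood_of_forall_mem {α : G.hDual n} (hα : IsRoot (G.cartan n) α)
    (h : ∀ x ∈ rootSpace (G.cartan n) α,
      x ∈ zeroWeightAnnihilator (G.minRank_le n) (G.cartan n)) : D.IsGood i α := by
  have := isKilling (K := K) (G.minRank_le n)
  refine ⟨D.rootMapsTo_push i hα h, ?_⟩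
  rw [← map_neg]
  exact D.rootMapsTo_push i hα.neg (mem_zeroWeightAnnihilator_neg _ hα h)

/-- The coroot of `α` is mapped to the coroot of its image. -/
lemma IsGood.coroot_eq {α : G.hDual n} (h : D.IsGood i α) {c : G.cartan n}
    {c' : G.cartan (n + 1)} (hc : IsCoroot (G.cartan n) α c)
    (hc' : IsCoroot (G.cartan (n + 1)) (D.push i α) c') : c'.1 = D.componentMap i c.1 := by
  have := isKilling (K := K) (G.minRank_le n)
  have := isKilling (K := K) (G.minRank_le (n + 1))
  obtain ⟨c₀, e, f, hc₀, t, he, hf⟩ := h.isRoot.exists_isSl2Triple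
  obtain rfl := hc.unique h.isRoot hc₀
  have he' := h.componentMap_mem he
  have hf' := h.neg.componentMap_mem hf
  rw [map_neg] at hf'
  have h1 : ⁅D.componentMap i e, D.componentMap i f⁆ = D.componentMap i c.1 := by
    rw [← componentMap_lie, t.lie_e_f]
  have h2 : D.componentMap i c.1 ∈ G.cartan (n + 1) := by
    have h3 := LieAlgebra.lie_mem_genWeightSpace_of_mem_genWeightSpace he' hf'
    rw [h1, show ⇑(D.push i α) + ⇑(-D.push i α) = ⇑(0 : G.hDual (n + 1)) by ext; simp] at h3
    exact mem_rootSpace_zero_iff.1 h3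
  have h4 : IsCoroot (G.cartan (n + 1)) (D.push i α) ⟨_, h2⟩ := by
    refine ⟨?_, ?_⟩
    · rw [LieAlgebra.mem_corootSpace]
      refine Submodule.subset_span ⟨_, he', _, hf', h1⟩
    · rw [D.push_apply_of_eq i α (h := c) rfl, hc.2]
  exact congrArg Subtype.val (hc'.unique h.isRoot_push h4)

end StepData

end DiagonalIndGroup

lemma sub_eq_map_sub_trans {K V V' : Type*} [Semiring K] [AddCommGroup V] [AddCommGroup V']
    [Module K V] [Module K V'] (J : V →ₗ[K] V') {a b c : V'} {a' b' c' : V}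
    (h : a - b = J (a' - b')) (h' : b - c = J (b' - c')) : a - c = J (a' - c') := by
  rw [← sub_add_sub_cancel a b c, h, h', ← map_add, sub_add_sub_cancel]

/-- The inverse case of the induction over the graph of τ: the expected value ν + J(u⁻¹ν' - ν') of
u'⁻¹ν is verified by applying u'. -/
lemma inv_apply_sub_eq_map {K V V' : Type*} [Semiring K] [AddCommGroup V] [AddCommGroup V']
    [Module K V] [Module K V'] (J : V →ₗ[K] V') {u : V ≃ₗ[K] V} {u' : V' ≃ₗ[K] V'} {ν : V'} {ν' : V}
    (h : u' (ν + J (u⁻¹ ν' - ν')) - (ν + J (u⁻¹ ν' - ν')) = J (u (u⁻¹ ν') - u⁻¹ ν')) :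
    u'⁻¹ ν - ν = J (u⁻¹ ν' - ν') := by
  have h1 := sub_eq_map_sub_trans J h (c := ν) (c' := ν') (add_sub_cancel_left ν _)
  rw [show u (u⁻¹ ν') = ν' from u.apply_symm_apply ν', sub_self, map_zero, sub_eq_zero] at h1
  exact sub_eq_iff_eq_add'.2 ((LinearEquiv.symm_apply_eq u').2 h1.symm)

namespace DiagonalIndGroup

open Matrix _root_.Module ClassicalType LieAlgebra CartanPair

namespace StepData

variable {K : Type*} [Field K] [CharZero K] [IsAlgClosed K] {G : DiagonalIndGroup K} {n : ℕ}
  (D : G.StepData n) {i j : Fin (G.s n)} (B : G.Borel)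

/-! ### Positivity -/

variable {D} in
-- The vector δ(x) lies in 𝔟_{n+1}, which is a sum of its weight components. Its trace against the
-- i-th image of f is tr(x f) ≠ 0, so 𝔟_{n+1} has a nonzero component in the root space of `push` α,
-- hence contains that root space.
lemma IsGood.push_mem_posRoots {α : G.hDual n} (h : D.IsGood i α)
    (hα : α ∈ posRoots (G.cartan n) (B.b n)) :
    D.push i α ∈ posRoots (G.cartan (n + 1)) (B.b (n + 1)) := by
  have := isKilling (K := K) (G.minRank_le n)
  have := isKilling (K := K) (G.minRank_le (n + 1))
  obtain ⟨x, hx, hx0⟩ := h.isRoot.exists_ne_zero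
  obtain ⟨f, hf, hxf⟩ := exists_trace_mul_ne_zero (G.minRank_le n) hx hx0
  have hf' := h.neg.componentMap_mem hf
  have hδ := mem_iSup_inf_rootSpace (B.cartan_le (n + 1)) ((B.compat n x).2 (hα.2 x hx))
  obtain ⟨z, hzb, hz, hz0⟩ : ∃ z ∈ B.b (n + 1),
      z ∈ rootSpace (G.cartan (n + 1)) (D.push i α) ∧ z ≠ 0 := by
    by_contra! hcon
    have hall : ∀ w ∈ ⨆ χ : LieModule.Weight K (G.cartan (n + 1)) (G.g (n + 1)),
        (B.b (n + 1)).toSubmodule ⊓ (rootSpace (G.cartan (n + 1)) χ).toSubmodule,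
        (w.1 * (D.componentMap i f).1).trace = 0 := by
      intro w hw
      induction hw using Submodule.iSup_induction' with
      | mem χ z hz =>
        by_cases hχ : χ.toLinear = D.push i α
        · have hz2 : z ∈ rootSpace (G.cartan (n + 1)) (χ.toLinear) := hz.2
          rw [hχ] at hz2
          rw [hcon z hz.1 hz2]
          simp
        · refine trace_mul_eq_zero (G.minRank_le (n + 1)) (α := χ.toLinear) ?_ hz.2 hf'
          rw [map_neg, ← sub_eq_add_neg]
          exact sub_ne_zero.2 hχ
      | zero => simp
      | add a b _ _ ha hb =>
        change ((a.1 + b.1) * (D.componentMap i f).1).trace = 0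
        rw [Matrix.add_mul, trace_add, ha, hb, add_zero]
    have hall := hall _ hδ
    rw [Matrix.trace_mul_comm, coe_componentMap, trace_component_mul_δ,
      Matrix.trace_mul_comm] at hall
    exact hxf hall
  exact ⟨h.isRoot_push, h.isRoot_push.rootSpace_le_of_ne_zero hz hz0
    (V := (B.b (n + 1)).toSubmodule) hzb⟩

variable {D} in
lemma IsGood.push_mem_posRoots_iff {α : G.hDual n} (h : D.IsGood i α) :
    D.push i α ∈ posRoots (G.cartan (n + 1)) (B.b (n + 1)) ↔
      α ∈ posRoots (G.cartan n) (B.b n) := by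
  have := isKilling (K := K) (G.minRank_le n)
  have := isKilling (K := K) (G.minRank_le (n + 1))
  refine ⟨fun hβ ↦ ?_, h.push_mem_posRoots B⟩
  by_contra hα
  have h1 := h.neg.push_mem_posRoots B
    ((mem_posRoots_or_neg (B.isBorel n) (B.cartan_le n) h.isRoot).resolve_left hα)
  rw [map_neg] at h1
  exact not_mem_posRoots_neg (B.isBorel (n + 1)).prop hβ h1

/-! ### Compatible weights -/

variable (i) in
/-- `ν` and `ν'` take the same values on the corresponding coroots of `𝔤_{n+1}` and `𝔤_n`. -/
def Compatible (ν : G.hDual (n + 1)) (ν' : G.hDual n) : Prop :=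
  ∀ α, D.IsGood i α → ∀ c c', IsCoroot (G.cartan n) α c →
    IsCoroot (G.cartan (n + 1)) (D.push i α) c' → ν c' = ν' c

lemma compatible_push (μ : G.hDual n) : D.Compatible i (D.push i μ) μ :=
  fun _ h _ _ hc hc' ↦ D.push_apply_of_eq i μ (h.coroot_eq hc hc')

lemma compatible_pull (ν : G.hDual (n + 1)) : D.Compatible i ν (D.pull i ν) :=
  fun _ h _ _ hc hc' ↦ (D.pull_apply_of_eq i ν (h.coroot_eq hc hc')).symm

lemma compatible_push_of_ne (hij : j ≠ i) (μ : G.hDual n) : D.Compatible i (D.push j μ) 0 :=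
  fun _ h _ _ hc hc' ↦ D.push_apply_of_ne hij μ (h.coroot_eq hc hc')

variable {D} in
lemma Compatible.add {ν μ : G.hDual (n + 1)} {ν' μ' : G.hDual n} (h : D.Compatible i ν ν')
    (h' : D.Compatible i μ μ') : D.Compatible i (ν + μ) (ν' + μ') :=
  fun α hα c c' hc hc' ↦ by
    rw [LinearMap.add_apply, LinearMap.add_apply, h α hα c c' hc hc', h' α hα c c' hc hc']

variable {D} in
set_option maxHeartbeats 600000 in
/-- The graph of `τ` acts compatibly on compatible weights. -/
lemma apply_sub_of_mem_tauGraph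
    (hgood : ∀ α ∈ B.admissibleRoots n, ∀ β, G.RootMapsTo n i α β → D.IsGood i α)
    {p : (G.hDual n ≃ₗ[K] G.hDual n) × (G.hDual (n + 1) ≃ₗ[K] G.hDual (n + 1))}
    (hp : p ∈ B.tauGraph n i) : ∀ {ν ν'}, D.Compatible i ν ν' →
    p.2 ν - ν = D.push i (p.1 ν' - ν') := by
  have := isKilling (K := K) (G.minRank_le n)
  have := isKilling (K := K) (G.minRank_le (n + 1))
  -- The graph is used only through its generators, and all compatible pairs are treated at once
  -- because the product and inverse cases change the pair. Adding `push` μ to ν and μ to ν'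
  -- preserves compatibility.
  induction hp using Subgroup.closure_induction with
  | mem p hp =>
    intro ν ν' h
    obtain ⟨α, hα, β, hαβ, ⟨-, c, hc, h1⟩, ⟨-, c', hc', h2⟩⟩ := hp
    have hg := hgood α hα β hαβ
    obtain rfl := D.eq_push_of_rootMapsTo i hαβ
    rw [h1, h2, sub_sub_cancel_left, sub_sub_cancel_left, map_neg, map_smul, h α hg c c' hc hc']
  | one =>
    intro ν ν' _
    simp
  | mul p q _ _ hp hq =>
    intro ν ν' h
    have h1 : q.2 ν = ν + D.push i (q.1 ν' - ν') := sub_eq_iff_eq_add'.1 (hq h)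
    have h2 : D.Compatible i (q.2 ν) (q.1 ν') := by
      have := h.add (D.compatible_push (i := i) (q.1 ν' - ν'))
      rwa [← h1, add_sub_cancel] at this
    have h3 := hp h2
    exact sub_eq_map_sub_trans (D.push i) h3 (hq h)
  | inv p _ hp =>
    intro ν ν' h
    have h2 : D.Compatible i (ν + D.push i (p.1⁻¹ ν' - ν')) (p.1⁻¹ ν') := by
      have := h.add (D.compatible_push (i := i) (p.1⁻¹ ν' - ν'))
      rwa [add_sub_cancel] at this
    exact inv_apply_sub_eq_map (D.push i) (hp h2)

lemma apply_push_of_mem_tauGraph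
    (hgood : ∀ α ∈ B.admissibleRoots n, ∀ β, G.RootMapsTo n i α β → D.IsGood i α)
    {u : G.hDual n ≃ₗ[K] G.hDual n} {u' : G.hDual (n + 1) ≃ₗ[K] G.hDual (n + 1)}
    (hu : (u, u') ∈ B.tauGraph n i) (μ : G.hDual n) : u' (D.push i μ) = D.push i (u μ) := by
  have := apply_sub_of_mem_tauGraph B hgood hu (D.compatible_push (i := i) μ)
  rw [map_sub] at this
  exact sub_left_injective this

/-! ### Roots which are mapped to roots by all components -/

/-- All components map the root spaces of `α` and `-α` into root spaces. -/
def IsFull (α : G.hDual n) : Prop := ∀ j, D.IsGood j α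

variable {D} in
lemma IsFull.neg {α : G.hDual n} (h : D.IsFull α) : D.IsFull (-α) := fun j ↦ (h j).neg

lemma isFull_of_forall_mem {α : G.hDual n} (hα : IsRoot (G.cartan n) α)
    (h : ∀ x ∈ rootSpace (G.cartan n) α,
      x ∈ zeroWeightAnnihilator (G.minRank_le n) (G.cartan n)) : D.IsFull α :=
  fun j ↦ D.isGood_of_forall_mem j hα h

variable {D} in
/-- The value of a dominant weight on a positive coroot of `𝔤_n` is at least its value on the
corresponding coroot of `𝔤_{n+1}`. -/
lemma IsFull.exists_coroot_le {α : G.hDual n} (h : D.IsFull α)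
    (hα : α ∈ posRoots (G.cartan n) (B.b n)) {ν : G.hDual (n + 1)}
    (hν : IsDominant (G.cartan (n + 1)) (B.b (n + 1)) ν) {c : G.cartan n}
    {c' : G.cartan (n + 1)} (hc : IsCoroot (G.cartan n) α c)
    (hc' : IsCoroot (G.cartan (n + 1)) (D.push i α) c') :
    ∃ k k' : ℕ, G.restrict n ν c = k ∧ ν c' = k' ∧ k' ≤ k := by
  classical
  have := isKilling (K := K) (G.minRank_le n)
  have := isKilling (K := K) (G.minRank_le (n + 1))
  choose d hd using fun j ↦ (h j).isRoot_push.exists_isCoroot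
  choose k hk using fun j ↦ hν.2 _ ((h j).push_mem_posRoots B hα) _ (hd j)
  refine ⟨∑ j, k j, k i, ?_, ?_, Finset.single_le_sum (fun _ _ ↦ Nat.zero_le _)
    (Finset.mem_univ i)⟩
  · have h1 : G.cartanMap n c = ∑ j, d j := by
      refine Subtype.ext ?_
      change G.δ n c.1 = _
      rw [D.δ_eq_sum_componentMap, AddSubmonoidClass.coe_finsetSum]
      exact Finset.sum_congr rfl fun j _ ↦ ((h j).coroot_eq hc (hd j)).symm
    change ν (G.cartanMap n c) = _
    rw [h1, map_sum, Nat.cast_sum]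
    exact Finset.sum_congr rfl fun j _ ↦ hk j
  · rw [hc'.unique (h i).isRoot_push (hd i), hk]

/-- In the root reductive situation, one root mapped to a root by a single component forces s_n = 1,
and then δ is that component. -/
lemma isFull_of_δ_mem (hδ : ∀ α, IsRoot (G.cartan n) α → ∃ β, IsRoot (G.cartan (n + 1)) β ∧
      ∀ x ∈ rootSpace (G.cartan n) α, G.δ n x ∈ rootSpace (G.cartan (n + 1)) β)
    {α₀ : G.hDual n} {β₀ : G.hDual (n + 1)} (h₀ : G.RootMapsTo n i α₀ β₀) {α : G.hDual n}
    (hα : IsRoot (G.cartan n) α) : D.IsFull α := by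
  have := isKilling (K := K) (G.minRank_le n)
  have := isKilling (K := K) (G.minRank_le (n + 1))
  obtain ⟨hα₀, hβ₀, hm⟩ := h₀
  -- Both δ(x) and the i-th image of x pair nontrivially with δ(f), so they lie in the same
  -- one-dimensional root space and δ(x) is a multiple of the i-th image. It then vanishes on any
  -- other constituent, although every constituent is faithful.
  have hsingle : ∀ j, j = i := by
    intro j
    by_contra hji
    obtain ⟨β, hβ, hαβ⟩ := hδ α₀ hα₀
    obtain ⟨γ, hγ, hαγ⟩ := hδ (-α₀) hα₀.neg
    obtain ⟨x, hx, hx0⟩ := hα₀.exists_ne_zero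
    obtain ⟨f, hf, hxf⟩ := exists_trace_mul_ne_zero (G.minRank_le n) hx hx0
    obtain ⟨y, hy, hxy⟩ := hm x hx
    rw [isComponent_iff_eq D] at hxy
    have h1 : β + γ = 0 := by
      by_contra hne
      have h2 := trace_mul_eq_zero (G.minRank_le (n + 1)) hne (hαβ x hx) (hαγ f hf)
      rw [D.δ_eq_sum x, Matrix.sum_mul, trace_sum] at h2
      simp only [trace_component_mul_δ] at h2
      rw [Finset.sum_const, Finset.card_univ, Fintype.card_fin, smul_eq_zero] at h2
      rcases h2 with h2 | h2
      · exact absurd i.2 (by omega)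
      · exact hxf h2
    have h2 : β₀ + γ = 0 := by
      by_contra hne
      have h2 := trace_mul_eq_zero (G.minRank_le (n + 1)) hne hy (hαγ f hf)
      rw [hxy, trace_component_mul_δ] at h2
      exact hxf h2
    obtain rfl : β = β₀ := add_right_cancel (h1.trans h2.symm)
    have hy0 : y ≠ 0 := by
      rintro rfl
      exact hx0 (Subtype.ext (D.component_eq_zero i hxy.symm))
    have h3 := hβ.rootSpace_le_of_ne_zero hy hy0 (V := Submodule.span K {y})
      (Submodule.mem_span_singleton_self y) _ (hαβ x hx)
    obtain ⟨a, ha⟩ := Submodule.mem_span_singleton.1 h3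
    have h4 : (G.δ n x).1 * D.φ j = 0 := by
      have h5 : (a • y).1 = a • y.1 := rfl
      rw [← ha, h5, hxy, Matrix.smul_mul, D.component_mul_φ_of_ne (Ne.symm hji), smul_zero]
    refine hx0 (Subtype.ext (D.component_eq_zero j ?_))
    rw [component_apply, ← δ_mul_φ, h4, Matrix.zero_mul]
  have hcomp (x : G.g n) : G.IsComponent n i x (G.δ n x) := by
    rw [isComponent_iff_eq D, D.δ_eq_sum, Finset.sum_eq_single i]
    · intro j _ hj
      exact absurd (hsingle j) hj
    · simp
  have hmaps {α : G.hDual n} (hα : IsRoot (G.cartan n) α) :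
      G.RootMapsTo n i α (D.push i α) := by
    obtain ⟨β, hβ, h⟩ := hδ α hα
    have h1 : G.RootMapsTo n i α β := ⟨hα, hβ, fun x hx ↦ ⟨_, h x hx, hcomp x⟩⟩
    rwa [D.eq_push_of_rootMapsTo i h1] at h1
  intro j
  rw [hsingle j]
  refine ⟨hmaps hα, ?_⟩
  rw [← map_neg]
  exact hmaps hα.neg

end StepData

namespace Borel

variable {K : Type*} [Field K] [CharZero K] [IsAlgClosed K] {G : DiagonalIndGroup K} (B : G.Borel)

/-- For large `n`, the roots which are relevant for the homomorphisms `τ` and for the inversions of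
elements of `W_n` are mapped to roots by all components. -/
lemma eventually_isFull : ∀ᶠ n in atTop, ∀ (D : G.StepData n) (i : Fin (G.s n)),
    ∀ u ∈ B.W n, ∀ u', (u, u') ∈ B.tauGraph n i →
      (∀ α ∈ B.admissibleRoots n, ∀ β, G.RootMapsTo n i α β → D.IsGood i α) ∧
      ∀ γ ∈ inversions (G.cartan n) (B.b n) u, D.IsFull γ ∧ D.IsFull (u⁻¹ γ) := by
  have hinv {n : ℕ} {D : G.StepData n} {u : G.hDual n ≃ₗ[K] G.hDual n}
      (h : ∀ α, IsRoot (G.cartan n) α → D.IsFull α) :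
      ∀ γ ∈ inversions (G.cartan n) (B.b n) u, D.IsFull γ ∧ D.IsFull (u⁻¹ γ) := by
    rintro γ ⟨hγ, β, hβ, -, rfl⟩
    refine ⟨h _ hγ.1, ?_⟩
    rw [show u⁻¹ (u β) = β from u.symm_apply_apply β]
    exact h β hβ
  by_cases hX : G.type = ClassicalType.B
  swap
  · refine Eventually.of_forall fun n D i u _ u' _ ↦ ?_
    have h (α) (hα : IsRoot (G.cartan n) α) : D.IsFull α :=
      D.isFull_of_forall_mem hα fun x _ ↦ mem_zeroWeightAnnihilator_of_ne_B _ hX x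
    exact ⟨fun α hα _ _ ↦ h α hα.1 i, hinv h⟩
  by_cases hRR : G.IsRootReductive
  · filter_upwards [hRR] with n hn D i u _ u' hu
    by_cases hex : ∃ α ∈ B.admissibleRoots n, ∃ β, G.RootMapsTo n i α β
    · obtain ⟨α₀, -, β₀, h₀⟩ := hex
      have h (α) (hα : IsRoot (G.cartan n) α) : D.IsFull α := D.isFull_of_δ_mem hn h₀ hα
      exact ⟨fun α hα _ _ ↦ h α hα.1 i, hinv h⟩
    -- If no admissible root is mapped to a root, the graph of τ is trivial, so u = 1 and there are
    -- no inversions.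
    · push Not at hex
      refine ⟨fun α hα β hβ ↦ absurd hβ (hex α hα β), ?_⟩
      have h1 : B.tauGraph n i = ⊥ := by
        rw [tauGraph, Subgroup.closure_eq_bot_iff]
        rintro p ⟨α, hα, β, hβ, -⟩
        exact absurd hβ (hex α hα β)
      rw [h1, Subgroup.mem_bot] at hu
      obtain rfl : u = 1 := congrArg Prod.fst hu
      rintro γ ⟨hγ, β, -, hβ, hβγ⟩
      obtain rfl : β = γ := hβγ
      exact absurd hγ hβ
  · refine Eventually.of_forall fun n D i u hu u' _ ↦ ?_
    have := isKilling (K := K) (G.minRank_le n)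
    -- The roots whose root spaces kill the zero weight space contain the long simple roots and are
    -- stable under their reflections, since the annihilator is a subalgebra. So all inversions of
    -- elements of W_n are of this kind.
    set C : Set (G.hDual n) := {α | ∀ x ∈ rootSpace (G.cartan n) α,
      x ∈ zeroWeightAnnihilator (G.minRank_le n) (G.cartan n)} with hC
    have hadm : B.admissibleRoots n ⊆ C := by
      rintro α ⟨-, hα⟩ x hx
      refine mem_zeroWeightAnnihilator_of_weightSubspace_eq_bot _ ?_ hx
      exact (Submodule.eq_bot_iff _).2 fun v hv ↦ (hα hX hRR).2 v hv
    have hsub {w} (hw : w ∈ B.W n) : inversions (G.cartan n) (B.b n) w ⊆ C := by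
      refine inversions_subset_of_stable (B.isBorel n) (B.cartan_le n)
        (fun α hα ↦ (hα.2 hX hRR).1) hadm (fun α hα s hs β hβ hβr ↦ ?_) hw
      obtain ⟨a, rfl⟩ := isRoot_iff.1 hα.1
      obtain ⟨b, rfl⟩ := isRoot_iff.1 hβr
      rw [isReflectionAlong_iff] at hs
      rw [hs, ← RootPairing.root_reflectionPerm]
      exact rootSpace_reflectionPerm_le_of_neg _ (hadm hα)
        (mem_zeroWeightAnnihilator_neg _ hα.1 (hadm hα)) hβ
    refine ⟨fun α hα _ _ ↦ D.isGood_of_forall_mem i hα.1 (hadm hα), ?_⟩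
    intro γ hγ
    refine ⟨D.isFull_of_forall_mem hγ.1.1 (hsub hu hγ), ?_⟩
    obtain ⟨hγ, β, hβ, hβb, rfl⟩ := hγ
    have h1 : u⁻¹ (u β) = β := u.symm_apply_apply β
    rw [h1, ← neg_neg β]
    -- If γ = uβ is an inversion of u, then -β is an inversion of u⁻¹, to which the same argument
    -- applies.
    have h2 : -β ∈ inversions (G.cartan n) (B.b n) u⁻¹ := by
      refine ⟨(mem_posRoots_or_neg (B.isBorel n) (B.cartan_le n) hβ).resolve_left hβb, -u β,
        hγ.1.neg, not_mem_posRoots_neg (B.isBorel n).prop hγ, ?_⟩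
      rw [map_neg, h1]
    exact (D.isFull_of_forall_mem hβ.neg (hsub (inv_mem hu) h2)).neg

end Borel

end DiagonalIndGroup

/-! ### Monotone sequences of natural numbers, and products of operators with independent
displacements -/

lemma Nat.eventually_eq_of_eventually_le {f : ℕ → ℕ} (h : ∀ᶠ n in atTop, f (n + 1) ≤ f n) :
    ∀ᶠ n in atTop, f (n + 1) = f n := by
  obtain ⟨N, hN⟩ := eventually_atTop.1 h
  obtain ⟨n₀, hn₀, hmin⟩ : ∃ n₀ ≥ N, ∀ n ≥ N, f n₀ ≤ f n := by
    have hne : (f '' Set.Ici N).Nonempty := ⟨_, N, Set.self_mem_Ici, rfl⟩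
    obtain ⟨n₀, hn₀, h₀⟩ := Nat.sInf_mem hne
    exact ⟨n₀, hn₀, fun n hn ↦ h₀ ▸ Nat.sInf_le ⟨n, hn, rfl⟩⟩
  have hle (n) (hn : n₀ ≤ n) : f n ≤ f n₀ := by
    induction n, hn using Nat.le_induction with
    | base => rfl
    | succ n hn ih => exact (hN n (hn₀.trans hn)).trans ih
  refine eventually_atTop.2 ⟨n₀, fun n hn ↦ le_antisymm (hN n (hn₀.trans hn)) ?_⟩
  exact (hle n hn).trans (hmin _ (hn₀.trans (hn.trans n.le_succ)))

lemma Nat.eventually_eq_of_frequently_le {f : ℕ → ℕ} (h : ∀ᶠ n in atTop, f n ≤ f (n + 1)) {M : ℕ}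
    (hM : ∃ᶠ n in atTop, f n ≤ M) : ∀ᶠ n in atTop, f (n + 1) = f n := by
  obtain ⟨N, hN⟩ := eventually_atTop.1 h
  have hmono (n) (hn : N ≤ n) (m) (hm : n ≤ m) : f n ≤ f m := by
    induction m, hm using Nat.le_induction with
    | base => rfl
    | succ m hm ih => exact ih.trans (hN m (hn.trans hm))
  have hle (n) (hn : N ≤ n) : f n ≤ M := by
    obtain ⟨m, hm, hfm⟩ := frequently_atTop.1 hM n
    exact (hmono n hn m hm).trans hfm
  have h1 : ∀ᶠ n in atTop, M - f (n + 1) ≤ M - f n := by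
    filter_upwards [h] with n hn
    omega
  filter_upwards [Nat.eventually_eq_of_eventually_le (f := fun n ↦ M - f n) h1, eventually_ge_atTop N] with n hn hNn
  have h2 := hle n hNn
  have h3 := hle (n + 1) (hNn.trans n.le_succ)
  omega

/-- Each factor fixes the displacements vν - ν of the later ones, so displacements add up. The
resulting formula does not depend on the order of the factors. -/
lemma List.prod_apply_sub_eq_sum {K V : Type*} [Semiring K] [AddCommGroup V] [Module K V]
    {l : List (V ≃ₗ[K] V)} (hl : l.Pairwise fun u v ↦ ∀ ν, u (v ν - ν) = v ν - ν) (ν : V) :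
    l.prod ν - ν = (l.map fun u ↦ u ν - ν).sum := by
  induction l with
  | nil => simp
  | cons u l ih =>
    rw [List.pairwise_cons] at hl
    have h1 : ∀ m : List (V ≃ₗ[K] V), (∀ v ∈ m, v ∈ l) →
        u (m.map fun v ↦ v ν - ν).sum = (m.map fun v ↦ v ν - ν).sum := by
      intro m hm
      induction m with
      | nil => simp
      | cons v m ih' =>
        rw [List.map_cons, List.sum_cons, map_add, hl.1 v (hm v List.mem_cons_self),
          ih' fun w hw ↦ hm w (List.mem_cons_of_mem _ hw)]
    rw [List.prod_cons, List.map_cons, List.sum_cons, LinearEquiv.mul_apply,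
      sub_eq_iff_eq_add.1 (ih hl.2), map_add, h1 l fun _ h ↦ h]
    abel

/-! ### One step of a sequence representing an element of W^t -/

namespace DiagonalIndGroup

open Matrix _root_.Module ClassicalType LieAlgebra CartanPair

variable {K : Type*} [Field K] [CharZero K] [IsAlgClosed K] {G : DiagonalIndGroup K} (B : G.Borel)

/-- The data of one step in a sequence which represents an element of a group `W^t`. -/
structure IsStep {n : ℕ} (D : G.StepData n) (i : Fin (G.s n)) (u : G.hDual n ≃ₗ[K] G.hDual n)
    (u' : G.hDual (n + 1) ≃ₗ[K] G.hDual (n + 1)) : Prop where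
  mem : u ∈ B.W n
  mem' : u' ∈ B.W (n + 1)
  graph : (u, u') ∈ B.tauGraph n i
  good : ∀ α ∈ B.admissibleRoots n, ∀ β, G.RootMapsTo n i α β → D.IsGood i α
  full : ∀ γ ∈ inversions (G.cartan n) (B.b n) u, D.IsFull γ ∧ D.IsFull (u⁻¹ γ)

lemma Borel.W_le_weylGroup (n : ℕ) : B.W n ≤ weylGroup (G.cartan n) := by
  have := isKilling (K := K) (G.minRank_le n)
  exact reflectionGroup_le_weylGroup _

namespace IsStep

variable {B} {n : ℕ} {D : G.StepData n} {i j : Fin (G.s n)} {u v : G.hDual n ≃ₗ[K] G.hDual n}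
    {u' v' : G.hDual (n + 1) ≃ₗ[K] G.hDual (n + 1)}

/-- If γ = uβ with γ positive and β not, then `push` γ = u'(`push` β), and `push` preserves and
reflects positivity on the roots concerned. -/
lemma image_inversions_subset (h : IsStep B D i u u') :
    D.push i '' inversions (G.cartan n) (B.b n) u ⊆
      inversions (G.cartan (n + 1)) (B.b (n + 1)) u' := by
  rintro _ ⟨γ, hγ, rfl⟩
  obtain ⟨h1, h2⟩ := h.full γ hγ
  obtain ⟨hγ, β, hβ, hβb, rfl⟩ := hγ
  rw [show u⁻¹ (u β) = β from u.symm_apply_apply β] at h2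
  exact ⟨(h1 i).push_mem_posRoots B hγ, _, (h2 i).isRoot_push,
    fun hcon ↦ hβb (((h2 i).push_mem_posRoots_iff B).1 hcon),
    StepData.apply_push_of_mem_tauGraph D B h.good h.graph β⟩

lemma ncard_inversions_le (h : IsStep B D i u u') :
    (inversions (G.cartan n) (B.b n) u).ncard ≤
      (inversions (G.cartan (n + 1)) (B.b (n + 1)) u').ncard := by
  have := isKilling (K := K) (G.minRank_le (n + 1))
  rw [← Set.ncard_image_of_injective _ (D.push_injective i)]
  exact Set.ncard_le_ncard h.image_inversions_subset (finite_inversions _ _)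

lemma image_inversions_eq (h : IsStep B D i u u')
    (hcard : (inversions (G.cartan (n + 1)) (B.b (n + 1)) u').ncard =
      (inversions (G.cartan n) (B.b n) u).ncard) :
    D.push i '' inversions (G.cartan n) (B.b n) u =
      inversions (G.cartan (n + 1)) (B.b (n + 1)) u' := by
  have := isKilling (K := K) (G.minRank_le (n + 1))
  refine Set.eq_of_subset_of_ncard_le h.image_inversions_subset ?_ (finite_inversions _ _)
  rw [Set.ncard_image_of_injective _ (D.push_injective i), hcard]

/-- Both sides are minus the sum of the inversions. The weight ρ_{n+1} itself need not restrict to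
ρ_n. -/
lemma apply_rho_sub (h : IsStep B D i u u')
    (hinv : D.push i '' inversions (G.cartan n) (B.b n) u =
      inversions (G.cartan (n + 1)) (B.b (n + 1)) u') :
    u' (rho (G.cartan (n + 1)) (B.b (n + 1))) - rho (G.cartan (n + 1)) (B.b (n + 1)) =
      D.push i (u (rho (G.cartan n) (B.b n)) - rho (G.cartan n) (B.b n)) := by
  have := isKilling (K := K) (G.minRank_le n)
  have := isKilling (K := K) (G.minRank_le (n + 1))
  rw [CartanPair.apply_rho_sub (B.isBorel n) (B.cartan_le n) (B.W_le_weylGroup n h.mem),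
    CartanPair.apply_rho_sub (B.isBorel (n + 1)) (B.cartan_le (n + 1))
      (B.W_le_weylGroup (n + 1) h.mem'), map_neg, ← hinv,
    finsum_mem_image (D.push_injective i).injOn]
  congr 1
  exact ((D.push i).toAddMonoidHom.map_finsum_mem (fun γ ↦ γ) (finite_inversions _ _)).symm

/-- If `ν` and `ν'` take the same values on the coroots of the inversions, then the action on these
weights is compatible. -/
lemma apply_sub (h : IsStep B D i u u') {ν : G.hDual n} {ν' : G.hDual (n + 1)}
    (hν : ∀ γ ∈ inversions (G.cartan n) (B.b n) u, ∀ c c', IsCoroot (G.cartan n) γ c →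
      IsCoroot (G.cartan (n + 1)) (D.push i γ) c' → ν' c' = ν c) :
    u' ν' - ν' = D.push i (u ν - ν) := by
  have := isKilling (K := K) (G.minRank_le n)
  have := isKilling (K := K) (G.minRank_le (n + 1))
  -- The weight `pull` ν' is compatible with ν', but need not be ν. The difference vanishes on the
  -- coroots of the inversions, so u fixes it and `pull` ν' may be replaced by ν.
  have h1 : u (D.pull i ν' - ν) = D.pull i ν' - ν := by
    refine apply_eq_self_of_forall_inversions (B.isBorel n) (B.cartan_le n)
      (B.W_le_weylGroup n h.mem) fun γ hγ c hc ↦ ?_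
    have hg := (h.full γ hγ).1 i
    obtain ⟨c', hc'⟩ := hg.isRoot_push.exists_isCoroot
    rw [LinearMap.sub_apply, ← D.compatible_pull ν' γ hg c c' hc hc', hν γ hγ c c' hc hc',
      sub_self]
  rw [StepData.apply_sub_of_mem_tauGraph B h.good h.graph (D.compatible_pull (i := i) ν')]
  congr 1
  rw [map_sub] at h1
  rw [sub_eq_sub_iff_sub_eq_sub]
  exact h1

/-- Elements of different groups `W^t` commute in the strong sense. -/
lemma apply_apply_sub_of_ne (h : IsStep B D i u u') (h' : IsStep B D j v v') (hij : j ≠ i)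
    (ν : G.hDual (n + 1)) : u' (v' ν - ν) = v' ν - ν := by
  rw [StepData.apply_sub_of_mem_tauGraph B h'.good h'.graph (D.compatible_pull (i := j) ν)]
  set μ := v (D.pull j ν) - D.pull j ν
  -- The displacement v'ν - ν is a `push` along j, which vanishes on the coroots coming from i ≠ j;
  -- it is thus compatible with 0.
  have h1 := StepData.apply_sub_of_mem_tauGraph B h.good h.graph (D.compatible_push_of_ne hij μ)
  rw [map_zero, sub_zero, map_zero] at h1
  exact sub_eq_zero.1 h1

/-- Independence persists when two sequences that have once separated continue along the same
component. -/
lemma apply_apply_sub (h : IsStep B D i u u') (h' : IsStep B D i v v')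
    (huv : ∀ ν, u (v ν - ν) = v ν - ν) (ν : G.hDual (n + 1)) : u' (v' ν - ν) = v' ν - ν := by
  rw [StepData.apply_sub_of_mem_tauGraph B h'.good h'.graph (D.compatible_pull (i := i) ν),
    StepData.apply_push_of_mem_tauGraph D B h.good h.graph, huv]

end IsStep

end DiagonalIndGroup

/-! ### Values of weights on the coroots of inversions -/

namespace CartanPair

variable {K L : Type*} [Field K] [LieRing L] [LieAlgebra K L] [FiniteDimensional K L]

/-- The value of a weight on the coroot of `γ`, if it is a natural number. -/
noncomputable def corootValue (H : LieSubalgebra K L) [H.IsCartanSubalgebra]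
    (ν γ : Module.Dual K H) : ℕ :=
  sInf {k | ∃ c, IsCoroot H γ c ∧ ν c = k}

variable [CharZero K] [IsAlgClosed K] [LieAlgebra.IsKilling K L] {H : LieSubalgebra K L}
  [H.IsCartanSubalgebra]

lemma corootValue_eq {ν γ : Module.Dual K H} (hγ : IsRoot H γ) {c : H} (hc : IsCoroot H γ c)
    {k : ℕ} (hk : ν c = k) : corootValue H ν γ = k := by
  have : {k : ℕ | ∃ c, IsCoroot H γ c ∧ ν c = k} = {k} := by
    ext m
    constructor
    · rintro ⟨d, hd, hm⟩
      rw [hd.unique hγ hc, hk] at hm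
      exact (Nat.cast_injective hm).symm
    · rintro rfl
      exact ⟨c, hc, hk⟩
  rw [corootValue, this, csInf_singleton]

end CartanPair

namespace DiagonalIndGroup

open Matrix _root_.Module ClassicalType LieAlgebra CartanPair

variable {K : Type*} [Field K] [CharZero K] [IsAlgClosed K] {G : DiagonalIndGroup K} {B : G.Borel}

/-- The sum of the values of a weight on the coroots of the inversions of `u`. -/
noncomputable def inversionSum (B : G.Borel) (n : ℕ) (u : G.hDual n ≃ₗ[K] G.hDual n)
    (ν : G.hDual n) : ℕ :=
  ∑ᶠ γ ∈ inversions (G.cartan n) (B.b n) u, corootValue (G.cartan n) ν γ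

namespace IsStep

variable {n : ℕ} {D : G.StepData n} {i : Fin (G.s n)} {u : G.hDual n ≃ₗ[K] G.hDual n}
    {u' : G.hDual (n + 1) ≃ₗ[K] G.hDual (n + 1)}

section

variable (h : IsStep B D i u u')
  (hinv : D.push i '' inversions (G.cartan n) (B.b n) u =
    inversions (G.cartan (n + 1)) (B.b (n + 1)) u')
  {ν : G.hDual (n + 1)} (hν : IsDominant (G.cartan (n + 1)) (B.b (n + 1)) ν)

include h hν in
lemma corootValue_push_le {γ : G.hDual n} (hγ : γ ∈ inversions (G.cartan n) (B.b n) u) :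
    corootValue (G.cartan (n + 1)) ν (D.push i γ) ≤
      corootValue (G.cartan n) (G.restrict n ν) γ := by
  have := isKilling (K := K) (G.minRank_le n)
  have := isKilling (K := K) (G.minRank_le (n + 1))
  have hf := (h.full γ hγ).1
  obtain ⟨c, hc⟩ := hγ.1.1.exists_isCoroot
  obtain ⟨c', hc'⟩ := (hf i).isRoot_push.exists_isCoroot
  obtain ⟨k, k', hk, hk', hle⟩ := hf.exists_coroot_le B hγ.1 hν hc hc'
  rwa [corootValue_eq hγ.1.1 hc hk, corootValue_eq (hf i).isRoot_push hc' hk']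

include hinv in
lemma inversionSum_eq : inversionSum B (n + 1) u' ν =
    ∑ᶠ γ ∈ inversions (G.cartan n) (B.b n) u,
      corootValue (G.cartan (n + 1)) ν (D.push i γ) := by
  rw [inversionSum, ← hinv, finsum_mem_image (D.push_injective i).injOn]

include h hinv hν in
lemma inversionSum_le : inversionSum B (n + 1) u' ν ≤ inversionSum B n u (G.restrict n ν) := by
  have := isKilling (K := K) (G.minRank_le n)
  rw [inversionSum_eq hinv, inversionSum, finsum_mem_eq_finite_toFinset_sum _
    (finite_inversions _ _), finsum_mem_eq_finite_toFinset_sum _ (finite_inversions _ _)]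
  exact Finset.sum_le_sum fun γ hγ ↦ h.corootValue_push_le hν (by simpa using hγ)

include h hinv hν in
-- The sums are compared term by term; equality of the totals forces equality of every term, which
-- is the hypothesis of `IsStep.apply_sub`.
lemma apply_sub_of_inversionSum_eq
    (hsum : inversionSum B (n + 1) u' ν = inversionSum B n u (G.restrict n ν)) :
    u' ν - ν = D.push i (u (G.restrict n ν) - G.restrict n ν) := by
  have := isKilling (K := K) (G.minRank_le n)
  have := isKilling (K := K) (G.minRank_le (n + 1))
  rw [inversionSum_eq hinv, inversionSum, finsum_mem_eq_finite_toFinset_sum _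
    (finite_inversions _ _), finsum_mem_eq_finite_toFinset_sum _ (finite_inversions _ _),
    Finset.sum_eq_sum_iff_of_le fun γ hγ ↦ h.corootValue_push_le hν (by simpa using hγ)] at hsum
  refine h.apply_sub fun γ hγ c c' hc hc' ↦ ?_
  have hf := (h.full γ hγ).1
  obtain ⟨k, k', hk, hk', -⟩ := hf.exists_coroot_le B hγ.1 hν hc hc'
  have h1 := hsum γ (by simpa using hγ)
  rw [corootValue_eq hγ.1.1 hc hk, corootValue_eq (hf i).isRoot_push hc' hk'] at h1
  rw [hk, hk', h1]

end

end IsStep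

/-! ### Sequences representing elements of W^t -/

section thread

variable {a : ∀ n, Fin (G.s n)} {x : ∀ n, G.hDual n ≃ₗ[K] G.hDual n} (D : ∀ n, G.StepData n)
  (hx : ∀ᶠ n in atTop, x n ∈ B.W n ∧ (x n, x (n + 1)) ∈ B.tauGraph n (a n))

include hx

lemma eventually_isStep : ∀ᶠ n in atTop, IsStep B (D n) (a n) (x n) (x (n + 1)) := by
  filter_upwards [hx, (tendsto_add_atTop_nat 1).eventually hx, B.eventually_isFull] with n h h' hf
  obtain ⟨h1, h2⟩ := hf (D n) (a n) (x n) h.1 _ h.2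
  exact ⟨h.1, h'.1, h.2, h1, h2⟩

variable (hlen : B.germLength (AutGerm.mk G x) ≠ ⊤)
include hlen

lemma eventually_image_inversions_eq : ∀ᶠ n in atTop,
    (D n).push (a n) '' inversions (G.cartan n) (B.b n) (x n) =
      inversions (G.cartan (n + 1)) (B.b (n + 1)) (x (n + 1)) := by
  obtain ⟨M, hM⟩ := ENat.ne_top_iff_exists.1 hlen
  -- A finite lower limit bounds the length only for infinitely many n. This suffices, because the
  -- number of inversions is eventually nondecreasing.
  have h1 : ∃ᶠ n in atTop, CartanPair.length (G.cartan n) (B.b n) (x n) ≤ M := by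
    have h2 : liminf (fun n ↦ (CartanPair.length (G.cartan n) (B.b n) (x n) : ℕ∞)) atTop <
        ((M + 1 : ℕ) : ℕ∞) := by
      change B.germLength (AutGerm.mk G x) < _
      rw [← hM]
      exact_mod_cast M.lt_succ_self
    refine (frequently_lt_of_liminf_lt (by isBoundedDefault) h2).mono fun n hn ↦ ?_
    exact Nat.lt_succ_iff.1 (by exact_mod_cast hn)
  have hstep := eventually_isStep D hx
  have h2 : ∃ᶠ n in atTop, (inversions (G.cartan n) (B.b n) (x n)).ncard ≤ M := by
    refine (h1.and_eventually hstep).mono fun n hn ↦ ?_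
    have := isKilling (K := K) (G.minRank_le n)
    exact (ncard_inversions_le_length (B.isBorel n) (B.cartan_le n)
      (B.W_le_weylGroup n hn.2.mem)).trans hn.1
  filter_upwards [hstep, Nat.eventually_eq_of_frequently_le
    (hstep.mono fun n hn ↦ hn.ncard_inversions_le) h2] with n hn hcard
  exact hn.image_inversions_eq hcard

lemma eventually_restrict_apply_rho_sub : ∀ᶠ n in atTop,
    G.restrict n (x (n + 1) (rho (G.cartan (n + 1)) (B.b (n + 1))) -
      rho (G.cartan (n + 1)) (B.b (n + 1))) =
        x n (rho (G.cartan n) (B.b n)) - rho (G.cartan n) (B.b n) := by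
  obtain ⟨D⟩ : Nonempty (∀ n, G.StepData n) := ⟨fun n ↦ (nonempty_stepData G n).some⟩
  filter_upwards [eventually_isStep D hx, eventually_image_inversions_eq D hx hlen] with n hn hi
  rw [hn.apply_rho_sub hi, StepData.restrict_push]

lemma eventually_restrict_apply_sub {lam : G.Weight} (hlam : lam ∈ B.dominantWeights) :
    ∀ᶠ n in atTop, G.restrict n (x (n + 1) (lam.1 (n + 1)) - lam.1 (n + 1)) =
      x n (lam.1 n) - lam.1 n := by
  obtain ⟨D⟩ : Nonempty (∀ n, G.StepData n) := ⟨fun n ↦ (nonempty_stepData G n).some⟩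
  have hstep := eventually_isStep D hx
  have hi := eventually_image_inversions_eq D hx hlen
  have h1 : ∀ᶠ n in atTop, inversionSum B (n + 1) (x (n + 1)) (lam.1 (n + 1)) ≤
      inversionSum B n (x n) (lam.1 n) := by
    filter_upwards [hstep, hi] with n hn hi
    rw [← lam.2.2 n]
    exact hn.inversionSum_le hi (hlam (n + 1))
  filter_upwards [hstep, hi, Nat.eventually_eq_of_eventually_le
    (f := fun n ↦ inversionSum B n (x n) (lam.1 n)) h1] with n hn hi hsum
  rw [← lam.2.2 n] at hsum ⊢
  rw [hn.apply_sub_of_inversionSum_eq hi (hlam (n + 1)) hsum, StepData.restrict_push]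

omit hlen in
-- At an index n₀ where the sequences use different constituents, the images at level n₀ + 1 become
-- independent, and every later step preserves this.
lemma eventually_apply_apply_sub {a' : ∀ n, Fin (G.s n)} {x' : ∀ n, G.hDual n ≃ₗ[K] G.hDual n}
    (hx' : ∀ᶠ n in atTop, x' n ∈ B.W n ∧ (x' n, x' (n + 1)) ∈ B.tauGraph n (a' n))
    (hne : ∃ᶠ n in atTop, a n ≠ a' n) :
    ∀ᶠ n in atTop, ∀ ν, x n (x' n ν - ν) = x' n ν - ν := by
  obtain ⟨D⟩ : Nonempty (∀ n, G.StepData n) := ⟨fun n ↦ (nonempty_stepData G n).some⟩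
  obtain ⟨N, hN⟩ := eventually_atTop.1 ((eventually_isStep D hx).and (eventually_isStep D hx'))
  obtain ⟨n₀, hn₀, hne⟩ := frequently_atTop.1 hne N
  refine eventually_atTop.2 ⟨n₀ + 1, fun n hn ↦ ?_⟩
  induction n, hn using Nat.le_induction with
  | base =>
    obtain ⟨h, h'⟩ := hN n₀ hn₀
    exact h.apply_apply_sub_of_ne h' hne.symm
  | succ n hn ih =>
    obtain ⟨h, h'⟩ := hN n (by omega)
    by_cases hn : a n = a' n
    · rw [← hn] at h'
      exact h.apply_apply_sub h' ih
    · exact h.apply_apply_sub_of_ne h' (Ne.symm hn)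

end thread

end DiagonalIndGroup

namespace DiagonalIndGroup

open Matrix _root_.Module ClassicalType LieAlgebra CartanPair

variable {K : Type*} [Field K] {G : DiagonalIndGroup K}

/-! ### Inverse systems of weights -/

/-- `μ` takes integral values on the semisimple elements of all `sl₂`-triples of `𝔤_n` which lie
in `𝔥_n`. -/
def IsStronglyIntegral {n : ℕ} (μ : G.hDual n) : Prop :=
  ∀ (h : G.cartan n) (e f : G.g n), IsSl2Triple (h : G.g n) e f → ∃ k : ℤ, μ h = k

/-- The image of a coroot of 𝔤_n need not be a coroot of 𝔤_{n+1}, but δ maps sl₂-triples to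
sl₂-triples. So this form of integrality, rather than the one by coroots, passes to restrictions. -/
lemma IsStronglyIntegral.restrict {n : ℕ} {μ : G.hDual (n + 1)} (hμ : IsStronglyIntegral μ) :
    IsStronglyIntegral (G.restrict n μ) := by
  intro h e f t
  refine hμ (G.cartanMap n h) (G.δ n e) (G.δ n f) ⟨?_, ?_, ?_, ?_⟩
  · intro h0
    exact t.h_ne_zero (G.δ_injective n (h0.trans (map_zero _).symm))
  · change _ = G.δ n h.1
    rw [← LieHom.map_lie, t.lie_e_f]
  · change ⁅G.δ n h.1, _⁆ = _
    rw [← LieHom.map_lie, t.lie_h_e_nsmul, map_nsmul]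
  · change ⁅G.δ n h.1, _⁆ = _
    rw [← LieHom.map_lie, t.lie_h_f_nsmul, map_neg, map_nsmul]

lemma exists_extension {d : ∀ n, G.hDual n} {N : ℕ}
    (hd : ∀ n ≥ N, G.restrict n (d (n + 1)) = d n) :
    ∃ μ : ∀ n, G.hDual n, (∀ n, G.restrict n (μ (n + 1)) = μ n) ∧ ∀ n ≥ N, μ n = d n := by
  induction N generalizing d with
  | zero => exact ⟨d, fun n ↦ hd n n.zero_le, fun _ _ ↦ rfl⟩
  | succ N ih =>
    obtain ⟨μ, hμ, hμd⟩ := ih (d := Function.update d N (G.restrict N (d (N + 1)))) fun n hn ↦ by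
      rw [Function.update_of_ne (by omega)]
      rcases hn.eq_or_lt with rfl | hn
      · rw [Function.update_self]
      · rw [Function.update_of_ne hn.ne', hd n hn]
    exact ⟨μ, hμ, fun n hn ↦ by rw [hμd n (by omega), Function.update_of_ne (by omega)]⟩

lemma Weight.eq_of_eventually_eq {μ ν : G.Weight} (h : ∀ᶠ n in atTop, μ.1 n = ν.1 n) :
    μ = ν := by
  obtain ⟨N, hN⟩ := eventually_atTop.1 h
  refine Subtype.ext (funext fun n ↦ ?_)
  have key (k) : ∀ n, N ≤ n + k → μ.1 n = ν.1 n := by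
    induction k with
    | zero => exact fun n hn ↦ hN n hn
    | succ k ih =>
      intro n hn
      rw [← μ.2.2 n, ← ν.2.2 n, ih (n + 1) (by omega)]
  exact key N n (by omega)

variable [CharZero K] [IsAlgClosed K]

lemma isStronglyIntegral_of_mem_closure {n : ℕ} {μ : G.hDual n}
    (hμ : μ ∈ AddSubgroup.closure {α | IsRoot (G.cartan n) α}) : IsStronglyIntegral μ := by
  have := isKilling (K := K) (G.minRank_le n)
  intro h e f t
  induction hμ using AddSubgroup.closure_induction with
  | mem α hα => exact hα.exists_int_of_isSl2Triple t
  | zero => exact ⟨0, by simp⟩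
  | add μ ν _ _ hμ hν =>
    obtain ⟨k, hk⟩ := hμ
    obtain ⟨m, hm⟩ := hν
    exact ⟨k + m, by rw [LinearMap.add_apply, hk, hm, Int.cast_add]⟩
  | neg μ _ hμ =>
    obtain ⟨k, hk⟩ := hμ
    exact ⟨-k, by rw [LinearMap.neg_apply, hk, Int.cast_neg]⟩

lemma IsStronglyIntegral.isIntegral {n : ℕ} {μ : G.hDual n} (hμ : IsStronglyIntegral μ) :
    IsIntegral (G.cartan n) μ := by
  have := isKilling (K := K) (G.minRank_le n)
  intro α c hα hc
  obtain ⟨c', e, f, hc', t, -⟩ := hα.exists_isSl2Triple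
  rw [hc.unique hα hc']
  exact hμ c' e f t

/-- The terms below N are forced by restriction. Their integrality descends step by step from the
root lattice at large n, on which all sl₂-triples take integral values. -/
lemma Weight.exists_eventually_eq_add (lam : G.Weight) {d : ∀ n, G.hDual n}
    (hd : ∀ᶠ n in atTop, G.restrict n (d (n + 1)) = d n)
    (hint : ∀ᶠ n in atTop, d n ∈ AddSubgroup.closure {α | IsRoot (G.cartan n) α}) :
    ∃ μ : G.Weight, ∀ᶠ n in atTop, μ.1 n = lam.1 n + d n := by
  obtain ⟨N, hN⟩ := eventually_atTop.1 (hd.and hint)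
  obtain ⟨e, he, hed⟩ := exists_extension fun n hn ↦ (hN n hn).1
  have hei (k) : ∀ n, N ≤ n + k → IsStronglyIntegral (e n) := by
    induction k with
    | zero =>
      intro n hn
      rw [hed n hn]
      exact isStronglyIntegral_of_mem_closure (hN n hn).2
    | succ k ih =>
      intro n hn
      rw [← he n]
      exact (ih (n + 1) (by omega)).restrict
  refine ⟨⟨fun n ↦ lam.1 n + e n, fun n α c hα hc ↦ ?_, fun n ↦ ?_⟩,
    eventually_atTop.2 ⟨N, fun n hn ↦ congrArg (lam.1 n + ·) (hed n hn)⟩⟩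
  · obtain ⟨k, hk⟩ := lam.2.1 n α c hα hc
    obtain ⟨m, hm⟩ := (hei N n (by omega)).isIntegral α c hα hc
    exact ⟨k + m, by rw [LinearMap.add_apply, hk, hm, Int.cast_add]⟩
  · change G.restrict n (lam.1 (n + 1)) + G.restrict n (e (n + 1)) = _
    rw [lam.2.2, he]

/-! ### The action of `W_B` -/

variable {B : G.Borel}

lemma Borel.germLength_one : B.germLength 1 = 0 := by
  have h (n : ℕ) : (CartanPair.length (G.cartan n) (B.b n) 1 : ℕ∞) = 0 := by
    have := isKilling (K := K) (G.minRank_le n)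
    rw [length_one, Nat.cast_zero]
  change liminf (fun n ↦ (CartanPair.length (G.cartan n) (B.b n) 1 : ℕ∞)) atTop = 0
  simp only [h, liminf_const]

lemma Borel.germLength_ne_top {w : B.WElem} (hw : w ∈ B.WB) (t : G.Tails) :
    B.germLength (w.comp t) ≠ ⊤ := by
  intro htop
  refine hw (top_unique ?_)
  -- Finiteness of the support makes the `finsum` a genuine sum instead of its default value 0; it
  -- holds because trivial components have length 0.
  have hfin : (Function.support fun t ↦ B.germLength (w.comp t)).Finite :=
    w.finite_support.subset fun t ht h1 ↦ ht (by
      change B.germLength (w.comp t) = 0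
      rw [h1, germLength_one])
  rw [← htop]
  exact single_le_finsum t hfin fun _ ↦ zero_le

/-- Representatives of the components of `w ∈ W_B`. -/
lemma Borel.WElem.exists_representatives {w : B.WElem} (hw : w ∈ B.WB) :
    ∃ x : G.Tails → ∀ n, G.hDual n ≃ₗ[K] G.hDual n, (∀ t, AutGerm.mk G (x t) = w.comp t) ∧
      (∀ t, ∀ᶠ n in atTop, x t n ∈ B.W n) ∧
      (∀ s t, s ≠ t → ∀ᶠ n in atTop, ∀ ν, x s n (x t n ν - ν) = x t n ν - ν) ∧
      (∀ t, ∀ᶠ n in atTop, G.restrict n (x t (n + 1) (rho (G.cartan (n + 1)) (B.b (n + 1))) -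
        rho (G.cartan (n + 1)) (B.b (n + 1))) =
          x t n (rho (G.cartan n) (B.b n)) - rho (G.cartan n) (B.b n)) ∧
      ∀ lam ∈ B.dominantWeights, ∀ t, ∀ᶠ n in atTop,
        G.restrict n (x t (n + 1) (lam.1 (n + 1)) - lam.1 (n + 1)) =
          x t n (lam.1 n) - lam.1 n := by
  choose a x ha hx hax using w.comp_mem
  have hlen (t) : B.germLength (AutGerm.mk G (x t)) ≠ ⊤ := by
    rw [hx]
    exact germLength_ne_top hw t
  refine ⟨x, hx, fun t ↦ (hax t).mono fun _ h ↦ h.1, fun s t hst ↦ ?_,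
    fun t ↦ eventually_restrict_apply_rho_sub (hax t) (hlen t),
    fun lam hlam t ↦ eventually_restrict_apply_sub (hax t) (hlen t) hlam⟩
  -- Distinct classes of sequences differ at infinitely many indices.
  refine eventually_apply_apply_sub (hax s) (hax t) fun hcon ↦ hst ?_
  rw [← ha s, ← ha t]
  exact Quotient.sound (hcon.mono fun n hn ↦ not_not.1 hn)

/-- Independence of w(n) from the enumeration of the support and from the representatives, for large
n: the displacement is a sum over the support. -/
lemma Borel.WElem.IsRealizedBy.eventually_sub_eq_sum {w : B.WElem}
    {y : ∀ n, G.hDual n ≃ₗ[K] G.hDual n} (hy : w.IsRealizedBy y)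
    {x : G.Tails → ∀ n, G.hDual n ≃ₗ[K] G.hDual n} (hx : ∀ t, AutGerm.mk G (x t) = w.comp t)
    (hcomm : ∀ s t, s ≠ t → ∀ᶠ n in atTop, ∀ ν, x s n (x t n ν - ν) = x t n ν - ν) :
    ∀ᶠ n in atTop, ∀ ν, y n ν - ν = ∑ t ∈ w.finite_support.toFinset, (x t n ν - ν) := by
  classical
  obtain ⟨l, a, hnodup, hl, ha, hy⟩ := hy
  set T := w.finite_support.toFinset with hT
  have hlT : l.toFinset = T := by
    ext t
    simp [hT, hl]
  have h1 : ∀ᶠ n in atTop, ∀ t ∈ T, a t n = x t n :=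
    (eventually_all_finset T).2 fun t _ ↦ Quotient.exact ((ha t).trans (hx t).symm)
  have h2 : ∀ᶠ n in atTop, ∀ s ∈ T, ∀ t ∈ T, s ≠ t → ∀ ν, x s n (x t n ν - ν) = x t n ν - ν :=
    (eventually_all_finset T).2 fun s _ ↦ (eventually_all_finset T).2 fun t _ ↦ by
      by_cases hst : s = t
      · exact Eventually.of_forall fun n h ↦ absurd hst h
      · exact (hcomm s t hst).mono fun n hn _ ↦ hn
  filter_upwards [hy, h1, h2] with n hy h1 h2 ν
  have h3 : (l.map fun t ↦ a t n) = l.map fun t ↦ x t n :=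
    List.map_congr_left fun t ht ↦ h1 t (by rw [← hlT]; exact List.mem_toFinset.2 ht)
  have h4 : (l.map fun t ↦ x t n).Pairwise fun u v ↦ ∀ ν, u (v ν - ν) = v ν - ν := by
    rw [List.pairwise_map]
    refine List.Pairwise.imp_of_mem (fun {s t} hs ht hst ↦ ?_) hnodup
    exact h2 s (by rw [← hlT]; exact List.mem_toFinset.2 hs) t
      (by rw [← hlT]; exact List.mem_toFinset.2 ht) hst
  rw [hy, h3, List.prod_apply_sub_eq_sum h4, List.map_map, ← hlT, List.sum_toFinset _ hnodup]
  rfl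

lemma Borel.WElem.exists_isRealizedBy (w : B.WElem) : ∃ y, w.IsRealizedBy y := by
  choose x hx using fun t ↦ Quotient.exists_rep (w.comp t)
  exact ⟨_, w.finite_support.toFinset.toList, x, Finset.nodup_toList _, fun t ↦ by simp, hx,
    Eventually.of_forall fun n ↦ rfl⟩

/-- The common form of the three assertions: the base weight is 0, λ, λ and η is ρ, λ, λ + ρ
respectively. -/
lemma Borel.WElem.existsUnique_weight {w : B.WElem} {x : G.Tails → ∀ n, G.hDual n ≃ₗ[K] G.hDual n}
    (hx : ∀ t, AutGerm.mk G (x t) = w.comp t)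
    (hcomm : ∀ s t, s ≠ t → ∀ᶠ n in atTop, ∀ ν, x s n (x t n ν - ν) = x t n ν - ν)
    (lam : G.Weight) {η : ∀ n, G.hDual n}
    (hη : ∀ t, ∀ᶠ n in atTop, G.restrict n (x t (n + 1) (η (n + 1)) - η (n + 1)) =
      x t n (η n) - η n)
    (hint : ∀ t, ∀ᶠ n in atTop, x t n (η n) - η n ∈
      AddSubgroup.closure {α | IsRoot (G.cartan n) α}) :
    ∃! μ : G.Weight, ∀ y, w.IsRealizedBy y →
      ∀ᶠ n in atTop, μ.1 n = lam.1 n + (y n (η n) - η n) := by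
  set T := w.finite_support.toFinset
  obtain ⟨μ, hμ⟩ := lam.exists_eventually_eq_add (d := fun n ↦ ∑ t ∈ T, (x t n (η n) - η n))
    (by
      filter_upwards [(eventually_all_finset T).2 fun t _ ↦ hη t] with n hn
      have h1 : G.restrict n (∑ t ∈ T, (x t (n + 1) (η (n + 1)) - η (n + 1))) =
          ∑ t ∈ T, G.restrict n (x t (n + 1) (η (n + 1)) - η (n + 1)) := by
        ext h
        simp [restrict]
      rw [h1]
      exact Finset.sum_congr rfl hn)
    (by
      filter_upwards [(eventually_all_finset T).2 fun t _ ↦ hint t] with n hn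
      exact sum_mem hn)
  refine ⟨μ, fun y hy ↦ ?_, fun μ' hμ' ↦ ?_⟩
  · filter_upwards [hμ, hy.eventually_sub_eq_sum hx hcomm] with n h h'
    rw [h, h']
  -- Uniqueness needs an actual realization, as the condition on the weight quantifies over all of
  -- them and might otherwise be void.
  · obtain ⟨y, hy⟩ := w.exists_isRealizedBy
    refine Weight.eq_of_eventually_eq ?_
    filter_upwards [hμ, hy.eventually_sub_eq_sum hx hcomm, hμ' y hy] with n h h' h''
    rw [h, h'', h']

end DiagonalIndGroup

theorem proposition3p3 {K : Type*} [Field K] [IsAlgClosed K] [CharZero K]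
    (G : DiagonalIndGroup K) (B : G.Borel) :
    (∀ w ∈ B.WB, ∃! μ : G.Weight, ∀ x, w.IsRealizedBy x →
      ∀ᶠ n in Filter.atTop, μ.1 n = B.dot n (x n) 0) ∧
    (∀ w ∈ B.WB, ∀ lam ∈ B.dominantWeights, ∃! μ : G.Weight, ∀ x, w.IsRealizedBy x →
      ∀ᶠ n in Filter.atTop, μ.1 n = x n (lam.1 n)) ∧
    (∀ w ∈ B.WB, ∀ lam ∈ B.dominantWeights, ∃! μ : G.Weight, ∀ x, w.IsRealizedBy x →
      ∀ᶠ n in Filter.atTop, μ.1 n = B.dot n (x n) (lam.1 n)) := by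
  have hρ {n : ℕ} {u : G.hDual n ≃ₗ[K] G.hDual n} (hu : u ∈ B.W n) :
      u (CartanPair.rho (G.cartan n) (B.b n)) - CartanPair.rho (G.cartan n) (B.b n) ∈
        AddSubgroup.closure {α | CartanPair.IsRoot (G.cartan n) α} := by
    have := ClassicalType.isKilling (K := K) (G.minRank_le n)
    rw [CartanPair.apply_rho_sub (B.isBorel n) (B.cartan_le n) (B.W_le_weylGroup n hu)]
    refine neg_mem (finsum_mem_induction _ (zero_mem _) (fun _ _ ↦ add_mem) fun γ hγ ↦ ?_)
    exact AddSubgroup.subset_closure hγ.1.1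
  have hlam {n : ℕ} {u : G.hDual n ≃ₗ[K] G.hDual n} (hu : u ∈ B.W n) (lam : G.Weight) :
      u (lam.1 n) - lam.1 n ∈ AddSubgroup.closure {α | CartanPair.IsRoot (G.cartan n) α} := by
    have := ClassicalType.isKilling (K := K) (G.minRank_le n)
    exact CartanPair.apply_sub_mem_closure (B.W_le_weylGroup n hu) (lam.2.1 n)
  refine ⟨fun w hw ↦ ?_, fun w hw lam hl ↦ ?_, fun w hw lam hl ↦ ?_⟩ <;>
    obtain ⟨x, hx, hmem, hcomm, hrho, hdom⟩ := DiagonalIndGroup.Borel.WElem.exists_representatives hw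
  · let zero : G.Weight :=
      ⟨fun n ↦ 0, fun n α c _ _ ↦ ⟨0, by simp⟩, fun n ↦ by ext h; simp [DiagonalIndGroup.restrict]⟩
    have h := DiagonalIndGroup.Borel.WElem.existsUnique_weight hx hcomm zero
      (η := fun n ↦ CartanPair.rho (G.cartan n) (B.b n)) hrho fun t ↦ (hmem t).mono fun n hn ↦ hρ hn
    simpa only [zero, DiagonalIndGroup.Borel.dot, CartanPair.dot, zero_add] using h
  · have h := DiagonalIndGroup.Borel.WElem.existsUnique_weight hx hcomm lam (η := lam.1) (hdom lam hl)
      fun t ↦ (hmem t).mono fun n hn ↦ hlam hn lam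
    simpa only [add_sub_cancel] using h
  · have h := DiagonalIndGroup.Borel.WElem.existsUnique_weight hx hcomm lam
      (η := fun n ↦ lam.1 n + CartanPair.rho (G.cartan n) (B.b n))
      -- The displacement of λ + ρ is the sum of the displacements of λ and of ρ, so the two inverse
      -- systems add.
      (fun t ↦ by
        filter_upwards [hdom lam hl t, hrho t] with n h1 h2
        rw [map_add, map_add, add_sub_add_comm, add_sub_add_comm, ← h1, ← h2]
        rfl)
      (fun t ↦ by
        filter_upwards [hmem t] with n hn
        rw [map_add, add_sub_add_comm]
        exact add_mem (hlam hn lam) (hρ hn))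
    have h3 (n : ℕ) (u : G.hDual n ≃ₗ[K] G.hDual n) :
        lam.1 n + (u (lam.1 n + CartanPair.rho (G.cartan n) (B.b n)) -
          (lam.1 n + CartanPair.rho (G.cartan n) (B.b n))) = B.dot n u (lam.1 n) := by
      rw [DiagonalIndGroup.Borel.dot, CartanPair.dot]
      abel
    simpa only [h3] using h
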